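/- Let $d\ge 1$ and let $\Omega\subset\mathbb R^d$ be a bounded domain (nonempty, open, connected) with Lipschitz boundary. Let $a,b,c:\mathbb R\to\mathbb R$ be of class $C^{1,1}_{loc}(\mathbb R)$ with $b\ge 0$ and $a,c>C$ on $\mathbb R$ for some constant $C>0$. (In applications $a=a_\varepsilon$, $b=b_\varepsilon$, $c=c_\varepsilon$ for a fixed $\varepsilon>0$.) For a weight $\rho\in L^\infty(\Omega)$ write $(u,v)_\rho=\int_\Omega\rho\,uv\,dx$ and $(\nabla u,\nabla v)_\rho=\int_\Omega\rho\,\nabla u\cdot\nabla v\,dx$. For $\varphi\in L^\infty(\Omega)$, a real number $\lambda$ is a Dirichlet eigenvalue if there is $0\ne w\in H^1_0(\Omega)$ (an eigenfunction) with $$(\nabla w,\nabla\eta)_{a(\varphi)}+(w,\eta)_{b(\varphi)}=\lambda\,(w,\eta)_{c(\varphi)}\quad\text{for all }\eta\in H^1_0(\Omega),$$ and a real number $\mu$ is a Neumann eigenvalue if there is $0\ne w\in H^1(\Omega)$ (an eigenfunction) with $$(\nabla w,\nabla\eta)_{a(\varphi)}=\mu\,(w,\eta)_{c(\varphi)}\quad\text{for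 all }\eta\in H^1(\Omega).$$ Let $0<\lambda_1^\varphi\le\lambda_2^\varphi\le\dots$ and $0=\mu_0^\varphi<\mu_1^\varphi\le\mu_2^\varphi\le\dots$ be all the Dirichlet and all the Neumann eigenvalues, repeated according to multiplicity. An eigenvalue is simple if its eigenspace is one-dimensional. An eigenfunction $w$ is $L^2_\varphi(\Omega)$-normalized if $(w,w)_{c(\varphi)}=1$. **Theorem (Fréchet differentiability of simple eigenvalues and their eigenfunctions).** Let $\varphi\in L^\infty(\Omega)$, $i\ge 1$ and $0<\sigma<1$. (D) Suppose that $\lambda_i^\varphi$ is simple and fix an $L^2_\varphi(\Omega)$-normalized eigenfunction $w_i^{D,\varphi}\in H^1_0(\Omega)$ to $\lambda_i^\varphi$. Then there are $\delta,r>0$ such that for every $\vartheta$ in the open ball $B_\delta(\varphi)\subset L^\infty(\Omega)$ there is exactly one $L^2_\vartheta(\Omega)$-normalized eigenfunction $w_i^{D,\vartheta}\in H_0^1(\Omega)$ to $\lambda_i^\vartheta$ with $(w_i^{D,\vartheta},w_i^{D,\varphi})_{c(\varphi)}>\sigma$, and the map $$B_\delta(\varphi)\to B_r\big((w_i^{D,\varphi},\lambda_i^\varphi)\big)\subset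 H^1_0(\Omega)\times\mathbb R,\qquad \vartheta\mapsto(w_i^{D,\vartheta},\lambda_i^\vartheta),$$ is well defined and continuously Fréchet differentiable. For all $\vartheta\in B_\delta(\varphi)$ and $h\in L^\infty(\Omega)$, writing $w=w_i^{D,\vartheta}$, $$(\lambda_i^\vartheta)'h=(\nabla w,\nabla w)_{a'(\vartheta)h}+(w,w)_{b'(\vartheta)h}-\lambda_i^\vartheta\,(w,w)_{c'(\vartheta)h}.$$ (N) Suppose that $\mu_i^\varphi$ is simple and fix an $L^2_\varphi(\Omega)$-normalized eigenfunction $w_i^{N,\varphi}\in H^1(\Omega)$ to $\mu_i^\varphi$. Then there are $\delta,r>0$ such that for every $\vartheta$ in the open ball $B_\delta(\varphi)\subset L^\infty(\Omega)$ there is exactly one $L^2_\vartheta(\Omega)$-normalized eigenfunction $w_i^{N,\vartheta}\in H^1(\Omega)$ to $\mu_i^\vartheta$ with $(w_i^{N,\vartheta},w_i^{N,\varphi})_{c(\varphi)}>\sigma$; it satisfies $\int_\Omega c(\vartheta)\,w_i^{N,\vartheta}\,dx=0$; and the map $$B_\delta(\varphi)\to B_r\big((w_i^{N,\varphi},\mu_i^\varphi)\big)\subset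 H^1(\Omega)\times\mathbb R,\qquad \vartheta\mapsto(w_i^{N,\vartheta},\mu_i^\vartheta),$$ is well defined and continuously Fréchet differentiable. For all $\vartheta\in B_\delta(\varphi)$ and $h\in L^\infty(\Omega)$, writing $w=w_i^{N,\vartheta}$, $$(\mu_i^\vartheta)'h=(\nabla w,\nabla w)_{a'(\vartheta)h}-\mu_i^\vartheta\,(w,w)_{c'(\vartheta)h}.$$ -/

import Mathlib

open MeasureTheory Set Filter Topology
open scoped ENNReal ContDiff

noncomputable section

/-- `E d` is Euclidean space `ℝᵈ`. -/
abbrev E (d : ℕ) := EuclideanSpace ℝ (Fin d)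

/-- Lipschitz boundary: near each boundary point and after a rigid motion, the set is the region
strictly above the graph of a Lipschitz function. The direction of the graph is the unit vector `e`,
and `y - ⟪e, y⟫ e` is the orthogonal projection of `y` to the hyperplane `e^⊥`. -/
def HasLipschitzBoundary {d : ℕ} (Ω : Set (E d)) : Prop :=
  ∀ x ∈ frontier Ω, ∃ r > 0, ∃ e : E d, ‖e‖ = 1 ∧ ∃ (K : NNReal) (g : E d → ℝ), LipschitzWith K g ∧
    ∀ y ∈ Metric.ball x r, y ∈ Ω ↔ g (y - inner ℝ e y • e) < inner ℝ e y

/-- A bounded Lipschitz domain: bounded, open, connected, nonempty, with Lipschitz boundary. -/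
structure IsBoundedLipschitzDomain {d : ℕ} (Ω : Set (E d)) : Prop where
  isOpen : IsOpen Ω
  isConnected : IsConnected Ω
  isBounded : Bornology.IsBounded Ω
  lipschitz : HasLipschitzBoundary Ω

/-- The class `C^{1,1}_loc(ℝ)`. -/
def IsC11Loc (f : ℝ → ℝ) : Prop := ContDiff ℝ 1 f ∧ LocallyLipschitz (deriv f)

/-- The coefficient functions: of class `C^{1,1}_loc`, with `a, c` bounded below by a positive
constant and `b` nonnegative. -/
structure Coefficients where
  a : ℝ → ℝ
  b : ℝ → ℝ
  c : ℝ → ℝ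
  a_reg : IsC11Loc a
  b_reg : IsC11Loc b
  c_reg : IsC11Loc c
  lower_bound : ∃ C > 0, ∀ s, C < a s ∧ C < c s
  b_nonneg : ∀ s, 0 ≤ b s

variable {d : ℕ}

/-- The space `L^∞(Ω)`. -/
abbrev Linf (Ω : Set (E d)) := Lp ℝ ∞ (volume.restrict Ω)

/-- The product `L²(Ω) × L²(Ω; ℝᵈ)` with its Hilbert space structure. -/
abbrev L2Pair (Ω : Set (E d)) :=
  WithLp 2 (Lp ℝ 2 (volume.restrict Ω) × Lp (E d) 2 (volume.restrict Ω))

/-- Test functions: smooth with compact support contained in `Ω`. -/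
structure IsTestFunction (Ω : Set (E d)) (ζ : E d → ℝ) : Prop where
  smooth : ContDiff ℝ ∞ ζ
  compact : HasCompactSupport ζ
  support : tsupport ζ ⊆ Ω

lemma IsTestFunction.memLp {Ω : Set (E d)} {ζ : E d → ℝ} (h : IsTestFunction Ω ζ) :
    MemLp ζ 2 (volume.restrict Ω) :=
  h.smooth.continuous.memLp_of_hasCompactSupport h.compact

lemma IsTestFunction.memLp_fderiv {Ω : Set (E d)} {ζ : E d → ℝ} (h : IsTestFunction Ω ζ)
    (v : E d) : MemLp (fun x => fderiv ℝ ζ x v) 2 (volume.restrict Ω) :=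
  ((h.smooth.continuous_fderiv (by simp)).clm_apply
    continuous_const).memLp_of_hasCompactSupport (h.compact.fderiv_apply ℝ v)

/-- `g` is the weak gradient of `u` in `Ω`. -/
def IsWeakGradient (Ω : Set (E d)) (u : E d → ℝ) (g : E d → E d) : Prop :=
  ∀ ζ : E d → ℝ, IsTestFunction Ω ζ → ∀ v : E d,
    ∫ x in Ω, u x * fderiv ℝ ζ x v = - ∫ x in Ω, inner ℝ (g x) v * ζ x

lemma isWeakGradient_congr {Ω : Set (E d)} {u u' : E d → ℝ} {g g' : E d → E d}
    (hu : u =ᵐ[volume.restrict Ω] u') (hg : g =ᵐ[volume.restrict Ω] g')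
    (h : IsWeakGradient Ω u g) : IsWeakGradient Ω u' g' := by
  intro ζ hζ v
  have h1 : ∫ x in Ω, u' x * fderiv ℝ ζ x v = ∫ x in Ω, u x * fderiv ℝ ζ x v :=
    integral_congr_ae (by filter_upwards [hu] with x hx; rw [hx])
  have h2 : ∫ x in Ω, inner ℝ (g' x) v * ζ x = ∫ x in Ω, inner ℝ (g x) v * ζ x :=
    integral_congr_ae (by filter_upwards [hg] with x hx; rw [hx])
  rw [h1, h2, h ζ hζ v]

/-- The Sobolev space `H¹(Ω)`, realized as the space of pairs `(u, ∇u)` with `∇u` the weak gradient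
of `u`. The norm it inherits is `(‖u‖² + ‖∇u‖²)^(1/2)`, with the norms of `L²(Ω)`. -/
def H1 (Ω : Set (E d)) : Submodule ℝ (L2Pair Ω) where
  carrier := {p | IsWeakGradient Ω p.fst p.snd}
  zero_mem' := by
    refine isWeakGradient_congr (u := 0) (g := 0) (Lp.coeFn_zero _ _ _).symm
      (Lp.coeFn_zero _ _ _).symm ?_
    intro ζ _ v
    simp
  add_mem' := by
    intro p q hp hq
    refine isWeakGradient_congr (Lp.coeFn_add p.fst q.fst).symm (Lp.coeFn_add p.snd q.snd).symm ?_
    intro ζ hζ v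
    have hD := hζ.memLp_fderiv v
    have i1 : ∀ f : Lp ℝ 2 (volume.restrict Ω),
        Integrable (fun x => f x * fderiv ℝ ζ x v) (volume.restrict Ω) := fun f =>
      (Lp.memLp f).integrable_mul hD
    have i2 : ∀ f : Lp (E d) 2 (volume.restrict Ω),
        Integrable (fun x => inner ℝ (f x) v * ζ x) (volume.restrict Ω) := fun f =>
      MemLp.integrable_mul ((Lp.memLp f).inner_const v) hζ.memLp
    simp only [Pi.add_apply, add_mul, inner_add_left]
    rw [integral_add (i1 _) (i1 _), integral_add (i2 _) (i2 _), hp ζ hζ v, hq ζ hζ v]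
    ring
  smul_mem' := by
    intro t p hp
    refine isWeakGradient_congr (Lp.coeFn_smul t p.fst).symm (Lp.coeFn_smul t p.snd).symm ?_
    intro ζ hζ v
    simp only [Pi.smul_apply, smul_eq_mul, real_inner_smul_left, mul_assoc]
    rw [integral_const_mul, integral_const_mul, hp ζ hζ v]
    ring

/-- The function underlying an element of `H¹(Ω)`. -/
def sobFn {Ω : Set (E d)} (u : H1 Ω) : Lp ℝ 2 (volume.restrict Ω) := u.1.fst

/-- The weak gradient of an element of `H¹(Ω)`. -/
def sobGrad {Ω : Set (E d)} (u : H1 Ω) : Lp (E d) 2 (volume.restrict Ω) := u.1.snd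

/-- The elements of `H¹(Ω)` that are given by test functions. -/
def testSubspace (Ω : Set (E d)) : Submodule ℝ (H1 Ω) where
  carrier := {u | ∃ ζ, IsTestFunction Ω ζ ∧ sobFn u =ᵐ[volume.restrict Ω] ζ}
  zero_mem' := by
    refine ⟨0, ⟨contDiff_const, HasCompactSupport.zero, ?_⟩, Lp.coeFn_zero _ _ _⟩
    simp [tsupport]
  add_mem' := by
    rintro u v ⟨ζ, hζ, hu⟩ ⟨ξ, hξ, hv⟩
    refine ⟨ζ + ξ, ⟨hζ.smooth.add hξ.smooth, hζ.compact.add hξ.compact, ?_⟩,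
      (Lp.coeFn_add (sobFn u) (sobFn v)).trans (hu.add hv)⟩
    exact (tsupport_add ζ ξ).trans (union_subset hζ.support hξ.support)
  smul_mem' := by
    rintro t u ⟨ζ, hζ, hu⟩
    refine ⟨t • ζ, ⟨contDiff_const.smul hζ.smooth, hζ.compact.smul_left (f := fun _ => t), ?_⟩,
      (Lp.coeFn_smul t (sobFn u)).trans (hu.const_smul t)⟩
    exact (closure_mono (Function.support_const_smul_subset t ζ)).trans hζ.support

/-- The Sobolev space `H¹₀(Ω)`: the closure of the test functions in `H¹(Ω)`. -/
def H10 (Ω : Set (E d)) : Submodule ℝ (H1 Ω) := (testSubspace Ω).topologicalClosure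

/-- The form `(u, v)_ρ = ∫_Ω ρ u v dx`. -/
def massForm {Ω : Set (E d)} (ρ : E d → ℝ) (u v : H1 Ω) : ℝ :=
  ∫ x in Ω, ρ x * (sobFn u x * sobFn v x)

/-- The form `(∇u, ∇v)_ρ = ∫_Ω ρ ∇u ⬝ ∇v dx`. -/
def gradForm {Ω : Set (E d)} (ρ : E d → ℝ) (u v : H1 Ω) : ℝ :=
  ∫ x in Ω, ρ x * inner ℝ (sobGrad u x) (sobGrad v x)

section Linearity

variable {Ω : Set (E d)} {k : ℝ → ℝ}

lemma coeff_bound (hk : Continuous k) (φ : Linf Ω) :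
    ∃ M, ∀ᵐ x ∂(volume.restrict Ω), ‖k (φ x)‖ ≤ M := by
  obtain ⟨M, hM⟩ := (isCompact_closedBall (0 : ℝ) ‖φ‖).exists_bound_of_continuousOn hk.continuousOn
  refine ⟨M, ?_⟩
  have h : ∀ᵐ x ∂(volume.restrict Ω), ‖φ x‖ ≤ ‖φ‖ := by
    have h0 := ae_le_eLpNormEssSup (f := φ) (μ := volume.restrict Ω)
    filter_upwards [h0] with x hx
    have hfin := Lp.eLpNorm_ne_top φ
    rw [Lp.norm_def, eLpNorm_exponent_top] at *
    simpa using ENNReal.toReal_mono hfin hx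
  filter_upwards [h] with x hx
  exact hM _ (by simpa using hx)

lemma coeff_meas (hk : Continuous k) (φ : Linf Ω) :
    AEStronglyMeasurable (fun x => k (φ x)) (volume.restrict Ω) :=
  hk.comp_aestronglyMeasurable (Lp.aestronglyMeasurable φ)

lemma massForm_integrable (hk : Continuous k) (φ : Linf Ω) (u v : H1 Ω) :
    Integrable (fun x => k (φ x) * (sobFn u x * sobFn v x)) (volume.restrict Ω) := by
  obtain ⟨M, hM⟩ := coeff_bound hk φ
  exact ((Lp.memLp (sobFn u)).integrable_mul (Lp.memLp (sobFn v))).bdd_mul (coeff_meas hk φ) hM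

lemma gradForm_integrable (hk : Continuous k) (φ : Linf Ω) (u v : H1 Ω) :
    Integrable (fun x => k (φ x) * inner ℝ (sobGrad u x) (sobGrad v x)) (volume.restrict Ω) := by
  obtain ⟨M, hM⟩ := coeff_bound hk φ
  exact (L2.integrable_inner (sobGrad u) (sobGrad v)).bdd_mul (coeff_meas hk φ) hM

lemma massForm_add (hk : Continuous k) (φ : Linf Ω) (u v η : H1 Ω) :
    massForm (fun x => k (φ x)) (u + v) η
      = massForm (fun x => k (φ x)) u η + massForm (fun x => k (φ x)) v η := by
  unfold massForm
  rw [← integral_add (massForm_integrable hk φ u η) (massForm_integrable hk φ v η)]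
  refine integral_congr_ae ?_
  filter_upwards [Lp.coeFn_add (sobFn u) (sobFn v)] with x hx
  have : sobFn (u + v) x = sobFn u x + sobFn v x := hx
  rw [this]; ring

lemma gradForm_add (hk : Continuous k) (φ : Linf Ω) (u v η : H1 Ω) :
    gradForm (fun x => k (φ x)) (u + v) η
      = gradForm (fun x => k (φ x)) u η + gradForm (fun x => k (φ x)) v η := by
  unfold gradForm
  rw [← integral_add (gradForm_integrable hk φ u η) (gradForm_integrable hk φ v η)]
  refine integral_congr_ae ?_
  filter_upwards [Lp.coeFn_add (sobGrad u) (sobGrad v)] with x hx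
  have : sobGrad (u + v) x = sobGrad u x + sobGrad v x := hx
  rw [this, inner_add_left]; ring

lemma massForm_smul (ρ : E d → ℝ) (t : ℝ) (u η : H1 Ω) :
    massForm ρ (t • u) η = t * massForm ρ u η := by
  unfold massForm
  rw [← integral_const_mul]
  refine integral_congr_ae ?_
  filter_upwards [Lp.coeFn_smul t (sobFn u)] with x hx
  have : sobFn (t • u) x = t * sobFn u x := hx
  rw [this]; ring

lemma gradForm_smul (ρ : E d → ℝ) (t : ℝ) (u η : H1 Ω) :
    gradForm ρ (t • u) η = t * gradForm ρ u η := by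
  unfold gradForm
  rw [← integral_const_mul]
  refine integral_congr_ae ?_
  filter_upwards [Lp.coeFn_smul t (sobGrad u)] with x hx
  have : sobGrad (t • u) x = t • sobGrad u x := hx
  rw [this, real_inner_smul_left]; ring

lemma massForm_zero (ρ : E d → ℝ) (η : H1 Ω) : massForm ρ 0 η = 0 := by
  simpa using massForm_smul ρ 0 (0 : H1 Ω) η

lemma gradForm_zero (ρ : E d → ℝ) (η : H1 Ω) : gradForm ρ 0 η = 0 := by
  simpa using gradForm_smul ρ 0 (0 : H1 Ω) η

end Linearity

namespace Coefficients

variable (P : Coefficients) {Ω : Set (E d)}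

lemma a_cont : Continuous P.a := P.a_reg.1.continuous
lemma b_cont : Continuous P.b := P.b_reg.1.continuous
lemma c_cont : Continuous P.c := P.c_reg.1.continuous

/-- The weighted scalar product `(u, v)_{c(φ)}` of `L²_φ(Ω)`. -/
def cForm (φ : Linf Ω) (u v : H1 Ω) : ℝ := massForm (fun x => P.c (φ x)) u v

/-- The weak solutions `w ∈ H¹₀(Ω)` of the Dirichlet problem with phase field `φ` and parameter `l`:
`(∇w, ∇η)_{a(φ)} + (w, η)_{b(φ)} = l (w, η)_{c(φ)}` for all `η ∈ H¹₀(Ω)`. A real `l` is a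
Dirichlet eigenvalue if this space is nonzero; the eigenfunctions are its nonzero elements. -/
def dirichletEigenspace (φ : Linf Ω) (l : ℝ) : Submodule ℝ (H10 Ω) where
  carrier := {w | ∀ η : H10 Ω,
    gradForm (fun x => P.a (φ x)) (w : H1 Ω) η + massForm (fun x => P.b (φ x)) (w : H1 Ω) η
      = l * P.cForm φ (w : H1 Ω) η}
  zero_mem' := by
    intro η
    simp [cForm, massForm_zero, gradForm_zero]
  add_mem' := by
    intro u v hu hv η
    have hu := hu η
    have hv := hv η
    simp only [cForm, Submodule.coe_add, massForm_add P.b_cont, massForm_add P.c_cont,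
      gradForm_add P.a_cont] at *
    linarith
  smul_mem' := by
    intro t u hu η
    have hu := hu η
    simp only [cForm, Submodule.coe_smul, massForm_smul, gradForm_smul] at *
    linear_combination t * hu

/-- The weak solutions `w ∈ H¹(Ω)` of the Neumann problem with phase field `φ` and parameter `m`:
`(∇w, ∇η)_{a(φ)} = m (w, η)_{c(φ)}` for all `η ∈ H¹(Ω)`. A real `m` is a Neumann eigenvalue if this
space is nonzero; the eigenfunctions are its nonzero elements. -/
def neumannEigenspace (φ : Linf Ω) (m : ℝ) : Submodule ℝ (H1 Ω) where
  carrier := {w | ∀ η : H1 Ω, gradForm (fun x => P.a (φ x)) w η = m * P.cForm φ w η}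
  zero_mem' := by
    intro η
    simp [cForm, massForm_zero, gradForm_zero]
  add_mem' := by
    intro u v hu hv η
    have hu := hu η
    have hv := hv η
    simp only [cForm, massForm_add P.c_cont, gradForm_add P.a_cont] at *
    linarith
  smul_mem' := by
    intro t u hu η
    have hu := hu η
    simp only [cForm, massForm_smul, gradForm_smul] at *
    linear_combination t * hu

/-- The Dirichlet eigenvalue `λ_i^φ`, `i = 1, 2, …`, of the increasing list of all eigenvalues
repeated according to multiplicity: the least `t` such that at least `i` eigenvalues, counted with
multiplicity, are `≤ t`. (Eigenspaces to different eigenvalues are linearly independent, so this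
count is the dimension of the sum of the eigenspaces.) -/
def dirichletEigenvalue (i : ℕ) (φ : Linf Ω) : ℝ :=
  sInf {t : ℝ | (i : Cardinal) ≤ Module.rank ℝ ↥(⨆ s ∈ Iic t, P.dirichletEigenspace φ s)}

/-- The Neumann eigenvalue `μ_i^φ`, `i = 0, 1, 2, …`, of the increasing list of all eigenvalues
repeated according to multiplicity; the list starts with the index `0`. -/
def neumannEigenvalue (i : ℕ) (φ : Linf Ω) : ℝ :=
  sInf {t : ℝ | ((i + 1 : ℕ) : Cardinal) ≤
    Module.rank ℝ ↥(⨆ s ∈ Iic t, P.neumannEigenspace φ s)}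

/-- The Dirichlet eigenvalue `λ_i^φ` is simple. -/
def DirichletSimple (i : ℕ) (φ : Linf Ω) : Prop :=
  Module.finrank ℝ (P.dirichletEigenspace φ (P.dirichletEigenvalue i φ)) = 1

/-- The Neumann eigenvalue `μ_i^φ` is simple. -/
def NeumannSimple (i : ℕ) (φ : Linf Ω) : Prop :=
  Module.finrank ℝ (P.neumannEigenspace φ (P.neumannEigenvalue i φ)) = 1

/-- `w` is an `L²_φ(Ω)`-normalized eigenfunction to the Dirichlet eigenvalue `λ_i^φ`. -/
def IsNormalizedDirichlet (i : ℕ) (φ : Linf Ω) (w : H10 Ω) : Prop :=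
  w ∈ P.dirichletEigenspace φ (P.dirichletEigenvalue i φ) ∧ P.cForm φ (w : H1 Ω) w = 1

/-- `w` is an `L²_φ(Ω)`-normalized eigenfunction to the Neumann eigenvalue `μ_i^φ`. -/
def IsNormalizedNeumann (i : ℕ) (φ : Linf Ω) (w : H1 Ω) : Prop :=
  w ∈ P.neumannEigenspace φ (P.neumannEigenvalue i φ) ∧ P.cForm φ w w = 1

/-- The space `H¹_{(0),φ}(Ω)` of `w ∈ H¹(Ω)` with `∫_Ω c(φ) w dx = 0`. -/
def meanZero (φ : Linf Ω) : Set (H1 Ω) := {w | ∫ x in Ω, P.c (φ x) * sobFn w x = 0}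

end Coefficients

end

/-! The eigenvalue problems have the form `A w = l C w` with bounded symmetric forms on a Hilbert
space `V`, where `A ≥ 0`, `C > 0`, `A + C` is coercive and `C` is compact (`IsSpectralPair`). Here
`V` is `H¹₀(Ω)` or `H¹(Ω)`, `C` is the weighted mass form and `A` the energy. Coercivity holds
because the `L²` part of the `H¹` norm is supplied by `C`; compactness is Rellich's theorem, proved
below for Lipschitz domains. The forms depend on the phase field in a `C¹` way, since they are
linear in the weights `a(φ)`, `b(φ)`, `c(φ)` and `φ ↦ k ∘ φ` is `C¹` on `L^∞` for every `C¹`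
function `k`.

Consider the map `(x, w, l) ↦ (A_x w - l C_x w, C_x(w, w))`. At a normalized simple eigenpair its
derivative in `(w, l)` is bijective (`bijective_eigenpairDeriv`): injective by simplicity and
normalization, surjective by the Fredholm alternative. The implicit function theorem then yields a
`C¹` branch of normalized eigenpairs. Differentiating `A(w, w) = l` and `C(w, w) = 1` along the
branch gives the formula for the derivative of the eigenvalue, in which the derivative of `w`
cancels.

It remains to see that the branch stays on the `i`-th eigenvalue and that this eigenvalue stays
simple. For this let `N(t)` be the number of eigenvalues `≤ t` with multiplicity. With the scalar
product `A + C` the problem is that of a compact symmetric operator, `l` corresponding to `(1 +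
l)⁻¹`. Hence `A - t C ≤ 0` on a space of dimension `N(t)`, while `A - t C` is coercive on a
complement of it. Comparing dimensions bounds `N(t)` from both sides under small perturbations of
the forms (`exists_eigenvalueCount_le`, `exists_le_eigenvalueCount`). Near a simple `i`-th
eigenvalue `m` the count is `i - 1` below `m` and `i` from `m` on, so a perturbed problem has
exactly one eigenvalue in a fixed window around `m`: it is simple, it is the `i`-th one, and it lies
on the branch. The condition with `σ` selects one of the two normalized eigenvectors `±w`. -/

noncomputable section

/-! ### Compact symmetric operators -/

section CompactSymmetric

open Module.End

variable {W : Type*} [NormedAddCommGroup W] [InnerProductSpace ℝ W]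

/-- The sum of the eigenspaces of `T` to the eigenvalues that are at least `τ`. -/
def upperSpectralSpace (T : W →L[ℝ] W) (τ : ℝ) : Submodule ℝ W :=
  ⨆ ν ∈ Ici τ, eigenspace (T : Module.End ℝ W) ν

/-- On the span of the eigenvectors to eigenvalues `≥ τ`, the quadratic form is `≥ τ`. -/
lemma le_inner_of_mem_upperSpectralSpace {T : W →L[ℝ] W} (hT : T.IsSymmetric) {τ : ℝ} {u : W}
    (hu : u ∈ upperSpectralSpace T τ) : τ * ‖u‖ ^ 2 ≤ inner ℝ (T u) u := by
  classical
  have hfam : OrthogonalFamily ℝ (fun ν : ℝ => eigenspace (T : Module.End ℝ W) ν)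
      fun ν => (eigenspace (T : Module.End ℝ W) ν).subtypeₗᵢ := hT.orthogonalFamily_eigenspaces
  have hfam' := hfam.comp (γ := Ici τ) (f := Subtype.val) Subtype.val_injective
  rw [upperSpectralSpace, iSup_subtype', Submodule.mem_iSup_iff_exists_finsupp] at hu
  obtain ⟨f, hf, rfl⟩ := hu
  let l : ∀ ν : Ici τ, eigenspace (T : Module.End ℝ W) (ν : ℝ) := fun ν => ⟨f ν, hf ν⟩
  have hsum : (f.sum fun _ x => x) = ∑ ν ∈ f.support, ((l ν : eigenspace _ _) : W) := rfl
  have hTl : ∀ ν, T (f ν) = (ν : ℝ) • f ν := fun ν => mem_eigenspace_iff.1 (hf ν)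
  have h1 : T (f.sum fun _ x => x)
      = ∑ ν ∈ f.support, (((ν : ℝ) • l ν : eigenspace (T : Module.End ℝ W) (ν : ℝ)) : W) := by
    rw [hsum, map_sum]
    exact Finset.sum_congr rfl fun ν _ => hTl ν
  have h2 : inner ℝ (∑ ν ∈ f.support,
        (((ν : ℝ) • l ν : eigenspace (T : Module.End ℝ W) (ν : ℝ)) : W))
      (∑ ν ∈ f.support, (l ν : W)) = ∑ ν ∈ f.support, inner ℝ ((ν : ℝ) • l ν) (l ν) :=
    hfam'.inner_sum (fun ν => (ν : ℝ) • l ν) l f.support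
  have h3 : ‖∑ ν ∈ f.support, (l ν : W)‖ ^ 2 = ∑ ν ∈ f.support, ‖l ν‖ ^ 2 :=
    hfam'.norm_sum l f.support
  rw [h1, hsum, h2, h3, Finset.mul_sum]
  refine Finset.sum_le_sum fun ν _ => ?_
  rw [inner_smul_left, real_inner_self_eq_norm_sq]
  exact mul_le_mul_of_nonneg_right ν.2 (sq_nonneg _)

variable [CompleteSpace W]

/-- `T` is bounded below by `τ` on the closure of the space, so its restriction there is a closed
embedding. As it is also compact, the identity is compact, and Riesz's theorem applies. The closure
is taken to have completeness. -/
lemma finiteDimensional_upperSpectralSpace {T : W →L[ℝ] W} (hc : IsCompactOperator T)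
    (hT : T.IsSymmetric) {τ : ℝ} (hτ : 0 < τ) :
    FiniteDimensional ℝ (upperSpectralSpace T τ) := by
  set M := (upperSpectralSpace T τ).topologicalClosure
  have hMc : IsClosed (M : Set W) := Submodule.isClosed_topologicalClosure _
  have hlow : ∀ u ∈ M, τ * ‖u‖ ≤ ‖T u‖ := by
    have hcl : IsClosed {u : W | τ * ‖u‖ ≤ ‖T u‖} :=
      isClosed_le (by fun_prop) (by fun_prop)
    have hsub : (upperSpectralSpace T τ : Set W) ⊆ {u : W | τ * ‖u‖ ≤ ‖T u‖} := by
      intro u hu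
      have h1 := (le_inner_of_mem_upperSpectralSpace hT hu).trans (real_inner_le_norm _ _)
      rcases eq_or_ne u 0 with rfl | h0
      · simp
      · have : 0 < ‖u‖ := norm_pos_iff.2 h0
        exact le_of_mul_le_mul_right (by rw [mul_assoc, ← sq]; exact h1) this
    exact fun u hu => hcl.closure_subset_iff.2 hsub hu
  have : CompleteSpace M := hMc.completeSpace_coe
  let S : M →L[ℝ] W := T.comp M.subtypeL
  have hS : AntilipschitzWith (τ⁻¹).toNNReal S := by
    refine ContinuousLinearMap.antilipschitz_of_bound S fun u => ?_
    rw [Real.coe_toNNReal _ (inv_nonneg.2 hτ.le), ← div_eq_inv_mul, le_div_iff₀' hτ]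
    exact hlow u u.2
  have hSc : IsCompactOperator S := hc.comp_clm M.subtypeL
  have hid : IsCompactOperator (id : M → M) := by
    obtain ⟨K, hK, hKS⟩ := hSc
    exact ⟨S ⁻¹' K, (hS.isClosedEmbedding S.uniformContinuous).isCompact_preimage hK, hKS⟩
  have hfin : FiniteDimensional ℝ M := FiniteDimensional.of_isCompactOperator_id hid
  exact Submodule.finiteDimensional_of_le (Submodule.le_topologicalClosure _)

/-- A nonzero compact symmetric operator with nonnegative quadratic form has its norm as an
eigenvalue. -/
lemma hasEigenvalue_norm_of_nonneg [Nontrivial W] {S : W →L[ℝ] W} (hc : IsCompactOperator S)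
    (hS : S.IsSymmetric) (hpos : ∀ u, 0 ≤ inner ℝ (S u) u) (h0 : S ≠ 0) :
    HasEigenvalue (S : Module.End ℝ W) ‖S‖ := by
  have hn : ‖S‖ ≠ 0 := norm_ne_zero_iff.2 h0
  -- Fredholm alternative: otherwise `‖S‖` is in the resolvent set, which keeps all Rayleigh
  -- quotients below `‖S‖ - ε`, whereas the supremum of their absolute values is `‖S‖`.
  refine (hc.hasEigenvalue_or_mem_resolventSet hn).resolve_right fun hr => ?_
  obtain ⟨ε, hε, hle⟩ := S.rayleighQuotient_le_of_norm_mem_resolventSet (𝕜 := ℝ) hr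
  have habs : ∀ x, |S.rayleighQuotient x| ≤ ‖S‖ - ε := by
    intro x
    rw [abs_of_nonneg]
    · exact hle x
    · exact div_nonneg (hpos x) (sq_nonneg _)
  have h1 := S.norm_eq_iSup_rayleighQuotient hS
  have h2 : (⨆ x, |S.rayleighQuotient x|) ≤ ‖S‖ - ε := ciSup_le habs
  linarith

/-- On the orthogonal complement of the span of the eigenvectors to eigenvalues `≥ τ`, the quadratic
form is bounded by some `q < τ`. -/
lemma exists_inner_le_of_mem_orthogonal {T : W →L[ℝ] W} (hc : IsCompactOperator T)
    (hT : T.IsSymmetric) (hpos : ∀ u, 0 ≤ inner ℝ (T u) u) {τ : ℝ} (hτ : 0 < τ) :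
    ∃ q < τ, ∀ u ∈ (upperSpectralSpace T τ)ᗮ, inner ℝ (T u) u ≤ q * ‖u‖ ^ 2 := by
  set M := upperSpectralSpace T τ
  have hinvM : ∀ u ∈ M, T u ∈ M := by
    have : M ≤ M.comap (T : W →ₗ[ℝ] W) := by
      refine iSup₂_le fun ν hν u hu => ?_
      have : T u = ν • u := mem_eigenspace_iff.1 hu
      change T u ∈ M
      rw [this]
      exact M.smul_mem _ (le_iSup₂_of_le (f := fun ν (_ : ν ∈ Ici τ) =>
        eigenspace (T : Module.End ℝ W) ν) ν hν le_rfl hu)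
    exact this
  have hinv : ∀ u ∈ Mᗮ, T u ∈ Mᗮ := by
    intro u hu
    rw [Submodule.mem_orthogonal] at hu ⊢
    intro v hv
    have := hT v u
    simp only [ContinuousLinearMap.coe_coe] at this
    rw [← this]
    exact hu _ (hinvM v hv)
  let S : Mᗮ →L[ℝ] Mᗮ := T.restrict hinv
  have hSc : IsCompactOperator S := hc.restrict' hinv
  have hSs : S.IsSymmetric := hT.restrict_invariant hinv
  have hSi : ∀ u : Mᗮ, inner ℝ (S u) u = inner ℝ (T u) (u : W) := fun u => rfl
  have hSpos : ∀ u : Mᗮ, 0 ≤ inner ℝ (S u) u := fun u => hpos u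
  by_cases h0 : S = 0
  · refine ⟨0, hτ, fun u hu => ?_⟩
    have := hSi ⟨u, hu⟩
    rw [h0] at this
    simp at this
    simp [← this]
  · have : Nontrivial Mᗮ := by
      by_contra hnt
      rw [not_nontrivial_iff_subsingleton] at hnt
      exact h0 (Subsingleton.elim _ _)
    obtain ⟨v, hv⟩ := (hasEigenvalue_norm_of_nonneg hSc hSs hSpos h0).exists_hasEigenvector
    -- The norm of the restriction to the complement is an eigenvalue. If it were at least `τ`, its
    -- eigenvector would lie both in `M` and in `Mᗮ`.
    refine ⟨‖S‖, ?_, fun u hu => ?_⟩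
    · by_contra hle
      push Not at hle
      have hv1 : T (v : W) = ‖S‖ • (v : W) := congrArg Subtype.val hv.apply_eq_smul
      have hvM : (v : W) ∈ M := le_iSup₂_of_le (f := fun ν (_ : ν ∈ Ici τ) =>
        eigenspace (T : Module.End ℝ W) ν) ‖S‖ hle le_rfl (mem_eigenspace_iff.2 hv1)
      have : inner ℝ (v : W) (v : W) = 0 := (Submodule.mem_orthogonal _ _).1 v.2 _ hvM
      exact hv.2 (Subtype.ext (inner_self_eq_zero.1 this))
    · have h1 : inner ℝ (S ⟨u, hu⟩) ⟨u, hu⟩ ≤ ‖S ⟨u, hu⟩‖ * ‖u‖ := real_inner_le_norm _ _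
      rw [hSi] at h1
      have h2 := mul_le_mul_of_nonneg_right (S.le_opNorm ⟨u, hu⟩) (norm_nonneg u)
      calc _ ≤ _ := h1
        _ ≤ _ := h2
        _ = _ := by rw [mul_assoc, sq]; rfl

end CompactSymmetric

end

noncomputable section

/-! ### The eigenvalue problem of a pair of forms -/

section FormPairs

universe u

variable {V : Type u} [NormedAddCommGroup V] [InnerProductSpace ℝ V]

/-- The vector space `V`, to be equipped with the scalar product given by the form `B`. -/
def FormSpace (_B : V →L[ℝ] V →L[ℝ] ℝ) : Type u := V

/-- Only the algebraic structure of `V` is carried over, so that the norm given by `B` does not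
compete with the norm of `V`. -/
instance (B : V →L[ℝ] V →L[ℝ] ℝ) : AddCommGroup (FormSpace B) := inferInstanceAs (AddCommGroup V)

instance (B : V →L[ℝ] V →L[ℝ] ℝ) : Module ℝ (FormSpace B) := inferInstanceAs (Module ℝ V)

/-- Boundedness and coercivity of `B` make its norm equivalent to the given one, `√α ‖u‖ ≤ ‖u‖_B ≤
√‖B‖ ‖u‖`, so completeness is inherited. -/
lemma exists_innerProductSpace_of_isCoercive [CompleteSpace V] {B : V →L[ℝ] V →L[ℝ] ℝ}
    (hs : ∀ u v, B u v = B v u) (hB : IsCoercive B) :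
    ∃ (W : Type u) (_ : NormedAddCommGroup W) (_ : InnerProductSpace ℝ W) (_ : CompleteSpace W)
      (e : V ≃L[ℝ] W), ∀ u v, inner ℝ (e u) (e v) = B u v := by
  obtain ⟨α, hα, hco⟩ := hB
  have hnn : ∀ u, 0 ≤ B u u := fun u => le_trans (by positivity) (hco u)
  have hdef : ∀ u, B u u = 0 → u = 0 := fun u hu => by
    have h1 := hco u
    rw [hu, mul_assoc] at h1
    have h2 : ‖u‖ * ‖u‖ ≤ 0 := nonpos_of_mul_nonpos_right h1 hα
    exact norm_eq_zero.1 (mul_self_eq_zero.1 (le_antisymm h2 (mul_self_nonneg _)))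
  let k : FormSpace B ≃ₗ[ℝ] V := LinearEquiv.refl ℝ V
  let core : InnerProductSpace.Core ℝ (FormSpace B) :=
    { inner := fun u v => B (k u) (k v)
      conj_inner_symm := fun u v => hs (k v) (k u)
      re_inner_nonneg := fun u => hnn (k u)
      add_left := fun u v w => by simp
      smul_left := fun u v r => by simp
      definite := fun u hu => k.injective ((hdef (k u) hu).trans (map_zero k).symm) }
  let _ : NormedAddCommGroup (FormSpace B) := core.toNormedAddCommGroup
  let _ : InnerProductSpace ℝ (FormSpace B) := InnerProductSpace.ofCore core.toCore
  let l : V ≃ₗ[ℝ] FormSpace B := k.symm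
  have hin : ∀ u v, inner ℝ (l u) (l v) = B u v := fun u v => rfl
  have hl : ∀ u, ‖l u‖ ^ 2 = B u u := fun u => by rw [← real_inner_self_eq_norm_sq, hin]
  let e : V ≃L[ℝ] FormSpace B := l.toContinuousLinearEquivOfBounds (√‖B‖) (√α)⁻¹
    (by
      intro u
      refine le_of_sq_le_sq ?_ (by positivity)
      rw [hl, mul_pow (√‖B‖), Real.sq_sqrt (norm_nonneg B)]
      calc B u u ≤ ‖B u u‖ := le_abs_self _
        _ ≤ ‖B‖ * ‖u‖ * ‖u‖ := B.le_opNorm₂ u u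
        _ = _ := by ring)
    (by
      intro w
      obtain ⟨u, rfl⟩ := l.surjective w
      rw [LinearEquiv.symm_apply_apply, ← div_eq_inv_mul, le_div_iff₀ (Real.sqrt_pos.2 hα)]
      refine le_of_sq_le_sq ?_ (by positivity)
      rw [hl, mul_pow, Real.sq_sqrt hα.le]
      calc _ = α * ‖u‖ * ‖u‖ := by ring
        _ ≤ _ := hco u)
  have hcompl : CompleteSpace (FormSpace B) :=
    (completeSpace_congr (e := e.toEquiv) e.isUniformEmbedding).1 inferInstance
  exact ⟨FormSpace B, inferInstance, inferInstance, hcompl, e, hin⟩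

/-- Two bounded symmetric forms `A ≥ 0` and `C > 0` with `A + C` coercive and `C` compact, the data
of the eigenvalue problem `A w = l C w`. -/
structure IsSpectralPair (A C : V →L[ℝ] V →L[ℝ] ℝ) : Prop where
  symm_left : ∀ u v, A u v = A v u
  symm_right : ∀ u v, C u v = C v u
  nonneg : ∀ u, 0 ≤ A u u
  pos : ∀ u, u ≠ 0 → 0 < C u u
  coercive : IsCoercive (A + C)
  compact : IsCompactOperator C

/-- The solutions `w` of `A w = l C w`. -/
def formEigenspace (A C : V →L[ℝ] V →L[ℝ] ℝ) (l : ℝ) : Submodule ℝ V :=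
  LinearMap.ker ((A - l • C : V →L[ℝ] V →L[ℝ] ℝ) : V →ₗ[ℝ] V →L[ℝ] ℝ)

lemma mem_formEigenspace {A C : V →L[ℝ] V →L[ℝ] ℝ} {l : ℝ} {w : V} :
    w ∈ formEigenspace A C l ↔ ∀ η, A w η = l * C w η := by
  simp [formEigenspace, ContinuousLinearMap.ext_iff, sub_eq_zero]

/-- The sum of the eigenspaces to the eigenvalues that are at most `t`. -/
def lowerSpectralSpace (A C : V →L[ℝ] V →L[ℝ] ℝ) (t : ℝ) : Submodule ℝ V :=
  ⨆ s ∈ Iic t, formEigenspace A C s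

/-- The `i`-th eigenvalue, counted from `1` and with multiplicity. -/
def formEigenvalue (A C : V →L[ℝ] V →L[ℝ] ℝ) (i : ℕ) : ℝ :=
  sInf {t : ℝ | (i : Cardinal) ≤ Module.rank ℝ ↥(lowerSpectralSpace A C t)}

lemma lowerSpectralSpace_mono (A C : V →L[ℝ] V →L[ℝ] ℝ) : Monotone (lowerSpectralSpace A C) :=
  fun _ _ h => biSup_mono fun _ hs => le_trans hs h

lemma formEigenspace_le_lowerSpectralSpace (A C : V →L[ℝ] V →L[ℝ] ℝ) {s t : ℝ} (h : s ≤ t) :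
    formEigenspace A C s ≤ lowerSpectralSpace A C t :=
  le_iSup₂_of_le (f := fun s (_ : s ∈ Iic t) => formEigenspace A C s) s h le_rfl

namespace IsSpectralPair

open Module.End

variable {A C : V →L[ℝ] V →L[ℝ] ℝ}

lemma formEigenspace_eq_bot (h : IsSpectralPair A C) {l : ℝ} (hl : l < 0) :
    formEigenspace A C l = ⊥ := by
  refine (Submodule.eq_bot_iff _).2 fun w hw => ?_
  by_contra h0
  have h1 := mem_formEigenspace.1 hw w
  have h2 := h.nonneg w
  rw [h1] at h2
  exact absurd h2 (not_le.2 (mul_neg_of_neg_of_pos hl (h.pos w h0)))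

lemma lowerSpectralSpace_eq_bot (h : IsSpectralPair A C) {t : ℝ} (ht : t < 0) :
    lowerSpectralSpace A C t = ⊥ := by
  refine (Submodule.eq_bot_iff _).2 fun w hw => ?_
  have : lowerSpectralSpace A C t ≤ ⊥ := iSup₂_le fun s hs =>
    (h.formEigenspace_eq_bot (lt_of_le_of_lt hs ht)).le
  exact (Submodule.mem_bot ℝ).1 (this hw)

/-- The eigenvalue problem `A w = l C w` as the one of a compact symmetric operator. -/
lemma exists_operator [CompleteSpace V] (h : IsSpectralPair A C) :
    ∃ (W : Type u) (_ : NormedAddCommGroup W) (_ : InnerProductSpace ℝ W) (_ : CompleteSpace W)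
      (e : V ≃L[ℝ] W) (T : W →L[ℝ] W), IsCompactOperator T ∧ T.IsSymmetric ∧
      (∀ u v, inner ℝ (e u) (e v) = A u v + C u v) ∧ (∀ u v, inner ℝ (T (e u)) (e v) = C u v) := by
  -- The scalar product is `A + C` and not `A`, which need not be coercive: the Neumann energy
  -- vanishes on constants. `T` represents `C` in this scalar product.
  obtain ⟨W, i1, i2, i3, e, he⟩ := exists_innerProductSpace_of_isCoercive
    (B := A + C) (fun u v => by simp [h.symm_left u v, h.symm_right u v]) h.coercive
  let D : W →L[ℝ] W →L[ℝ] ℝ := C.bilinearComp e.symm.toContinuousLinearMap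
    e.symm.toContinuousLinearMap
  have hD : ∀ u v, D (e u) (e v) = C u v := fun u v => by simp [D]
  let T : W →L[ℝ] W := InnerProductSpace.continuousLinearMapOfBilin (𝕜 := ℝ) D
  have hT : ∀ u v, inner ℝ (T (e u)) (e v) = C u v := fun u v => by
    rw [← hD]; exact InnerProductSpace.continuousLinearMapOfBilin_apply D _ _
  refine ⟨W, i1, i2, i3, e, T, ?_, ?_, fun u v => by simp [he], hT⟩
  · have hDc : IsCompactOperator D := by
      have h1 := (h.compact.comp_clm e.symm.toContinuousLinearMap).clm_comp
        ((ContinuousLinearMap.compL ℝ W V ℝ).flip e.symm.toContinuousLinearMap)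
      convert! h1
    have h2 := hDc.continuous_comp (InnerProductSpace.toDual ℝ W).symm.continuous
    convert! h2
  · intro x y
    obtain ⟨u, rfl⟩ := e.surjective x
    obtain ⟨v, rfl⟩ := e.surjective y
    simp only [ContinuousLinearMap.coe_coe]
    rw [hT, real_inner_comm, hT, h.symm_right]

/-- Adding `C u` to both sides turns `A u = l C u` into `(A + C) u = (1 + l) C u`, that is `e u = (1
+ l) T (e u)`. -/
lemma mem_formEigenspace_iff (h : IsSpectralPair A C) {W : Type*} [NormedAddCommGroup W]
    [InnerProductSpace ℝ W] {e : V ≃L[ℝ] W} {T : W →L[ℝ] W}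
    (he : ∀ u v, inner ℝ (e u) (e v) = A u v + C u v)
    (hT : ∀ u v, inner ℝ (T (e u)) (e v) = C u v) {l : ℝ} {u : V} :
    u ∈ formEigenspace A C l ↔ e u ∈ eigenspace (T : Module.End ℝ W) (1 + l)⁻¹ := by
  have h1 : u ∈ formEigenspace A C l ↔ e u = (1 + l) • T (e u) := by
    rw [mem_formEigenspace]
    constructor
    · intro hu
      refine ext_inner_right ℝ fun y => ?_
      obtain ⟨v, rfl⟩ := e.surjective y
      rw [he, real_inner_smul_left, hT, hu]
      ring
    · intro hu v
      have := congrArg (fun x => inner ℝ x (e v)) hu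
      simp only [real_inner_smul_left, hT, he] at this
      linarith
  rw [h1, mem_eigenspace_iff]
  simp only [ContinuousLinearMap.coe_coe]
  -- For `l = -1` the inverse is `0` by convention. The equivalence persists because both sides then
  -- mean `u = 0`, as `C > 0` makes `T` injective.
  rcases eq_or_ne (1 + l) 0 with h0 | h0
  · rw [h0]
    simp only [zero_smul, inv_zero]
    constructor
    · intro hu; simp [hu]
    · intro hu
      by_contra hne
      have := h.pos u (fun h => hne (by simp [h]))
      rw [← hT, hu] at this
      simp at this
  · rw [eq_comm (b := (1 + l)⁻¹ • e u), inv_smul_eq_iff₀ h0]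

/-- Eigenspaces of `T` to different eigenvalues are independent, and `l ↦ (1 + l)⁻¹` is injective on
all of `ℝ` with the convention `0⁻¹ = 0`. -/
lemma iSupIndep_formEigenspace [CompleteSpace V] (h : IsSpectralPair A C) :
    iSupIndep (formEigenspace A C) := by
  obtain ⟨W, _, _, _, e, T, -, -, he, hT⟩ := h.exists_operator
  have h1 : iSupIndep fun l : ℝ => eigenspace (T : Module.End ℝ W) (1 + l)⁻¹ :=
    (eigenspaces_iSupIndep (T : Module.End ℝ W)).comp (f := fun l : ℝ => (1 + l)⁻¹)
      fun a b hab => by simpa using hab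
  have h2 := h1.map_orderIso (Submodule.orderIsoMapComap e.toLinearEquiv).symm
  convert h2 using 2 with l
  ext u
  exact h.mem_formEigenspace_iff he hT

/-- The substitution `l ↦ (1 + l)⁻¹` reverses the order on `(-1, ∞)`, and there are no eigenvalues
below `0`. -/
lemma map_lowerSpectralSpace (h : IsSpectralPair A C) {W : Type*} [NormedAddCommGroup W]
    [InnerProductSpace ℝ W] {e : V ≃L[ℝ] W} {T : W →L[ℝ] W}
    (he : ∀ u v, inner ℝ (e u) (e v) = A u v + C u v)
    (hT : ∀ u v, inner ℝ (T (e u)) (e v) = C u v) {t : ℝ} (ht : -1 < t) :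
    lowerSpectralSpace A C t
      = (upperSpectralSpace T (1 + t)⁻¹).comap (e.toLinearEquiv : V →ₗ[ℝ] W) := by
  apply le_antisymm
  · refine iSup₂_le fun s hs u hu => ?_
    rcases lt_or_ge s 0 with h0 | h0
    · rw [h.formEigenspace_eq_bot h0, Submodule.mem_bot] at hu
      rw [hu]
      exact Submodule.zero_mem _
    · have h1 : (1 + t)⁻¹ ≤ (1 + s)⁻¹ := inv_anti₀ (by linarith) (by simpa using hs)
      exact le_iSup₂_of_le (f := fun ν (_ : ν ∈ Ici (1 + t)⁻¹) =>
        eigenspace (T : Module.End ℝ W) ν) _ h1 le_rfl ((h.mem_formEigenspace_iff he hT).1 hu)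
  · have h1 : upperSpectralSpace T (1 + t)⁻¹
        ≤ (lowerSpectralSpace A C t).map (e.toLinearEquiv : V →ₗ[ℝ] W) := by
      refine iSup₂_le fun ν hν x hx => ?_
      obtain ⟨u, rfl⟩ := e.surjective x
      have hν0 : 0 < ν := lt_of_lt_of_le (inv_pos.2 (by linarith)) hν
      refine ⟨u, formEigenspace_le_lowerSpectralSpace A C (s := ν⁻¹ - 1) ?_ ?_, rfl⟩
      · have : ν⁻¹ ≤ ((1 + t)⁻¹)⁻¹ := inv_anti₀ (inv_pos.2 (by linarith)) hν
        rw [inv_inv] at this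
        linarith
      · rw [h.mem_formEigenspace_iff he hT]
        simpa using hx
    intro u hu
    obtain ⟨v, hv, hvu⟩ := h1 hu
    have : v = u := e.injective hvu
    exact this ▸ hv

lemma coercive_of_le_neg_one (h : IsSpectralPair A C) {t : ℝ} (ht : t ≤ -1) :
    ∃ c > 0, ∀ u, c * ‖u‖ ^ 2 ≤ A u u - t * C u u := by
  obtain ⟨α, hα, hco⟩ := h.coercive
  refine ⟨α, hα, fun u => ?_⟩
  have h1 : α * ‖u‖ * ‖u‖ ≤ A u u + C u u := hco u
  have h2 : 0 ≤ C u u := by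
    rcases eq_or_ne u 0 with rfl | h0
    · simp
    · exact (h.pos u h0).le
  nlinarith

lemma finiteDimensional_lowerSpectralSpace [CompleteSpace V] (h : IsSpectralPair A C) (t : ℝ) :
    FiniteDimensional ℝ (lowerSpectralSpace A C t) := by
  rcases le_or_gt t (-1) with ht | ht
  · rw [h.lowerSpectralSpace_eq_bot (by linarith)]
    infer_instance
  · obtain ⟨W, _, _, _, e, T, hc, hs, he, hT⟩ := h.exists_operator
    rw [h.map_lowerSpectralSpace he hT ht]
    have := finiteDimensional_upperSpectralSpace hc hs (τ := (1 + t)⁻¹)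
      (inv_pos.2 (by linarith))
    rw [Submodule.comap_equiv_eq_map_symm]
    infer_instance

/-- In terms of the operator this is `(1 + t)⁻¹ (A + C) ≤ C` on the span of the eigenvectors of `T`
to eigenvalues `≥ (1 + t)⁻¹`. -/
lemma le_of_mem_lowerSpectralSpace [CompleteSpace V] (h : IsSpectralPair A C) {t : ℝ} {u : V}
    (hu : u ∈ lowerSpectralSpace A C t) : A u u ≤ t * C u u := by
  rcases le_or_gt t (-1) with ht | ht
  · rw [h.lowerSpectralSpace_eq_bot (by linarith), Submodule.mem_bot] at hu
    simp [hu]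
  · obtain ⟨W, _, _, _, e, T, hc, hs, he, hT⟩ := h.exists_operator
    rw [h.map_lowerSpectralSpace he hT ht] at hu
    have h1 : (1 + t)⁻¹ * ‖e u‖ ^ 2 ≤ inner ℝ (T (e u)) (e u) :=
      le_inner_of_mem_upperSpectralSpace hs hu
    rw [← real_inner_self_eq_norm_sq, he, hT, inv_mul_le_iff₀ (by linarith)] at h1
    linarith

/-- `U` is the orthogonal complement with respect to `A + C`. On it `C ≤ q (A + C)` with `q < (1 +
t)⁻¹`, hence `A - t C = (A + C) - (1 + t) C ≥ (1 - (1 + t) q) (A + C)`, which is coercive. For `t ≤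
-1` the whole space serves as `U`. -/
lemma exists_coercive_complement [CompleteSpace V] (h : IsSpectralPair A C) (t : ℝ) :
    ∃ U : Submodule ℝ V, lowerSpectralSpace A C t ⊔ U = ⊤ ∧
      ∃ c > 0, ∀ u ∈ U, c * ‖u‖ ^ 2 ≤ A u u - t * C u u := by
  rcases le_or_gt t (-1) with ht | ht
  · obtain ⟨c, hc, hle⟩ := h.coercive_of_le_neg_one ht
    exact ⟨⊤, by simp, c, hc, fun u _ => hle u⟩
  · obtain ⟨W, _, _, _, e, T, hc, hs, he, hT⟩ := h.exists_operator
    have htp : 0 < 1 + t := by linarith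
    have hpos : ∀ x, 0 ≤ inner ℝ (T x) x := by
      intro x
      obtain ⟨u, rfl⟩ := e.surjective x
      rw [hT]
      rcases eq_or_ne u 0 with rfl | h0
      · simp
      · exact (h.pos u h0).le
    obtain ⟨q, hq, hle⟩ := exists_inner_le_of_mem_orthogonal hc hs hpos (inv_pos.2 htp)
    have := finiteDimensional_upperSpectralSpace hc hs (inv_pos.2 htp)
    have hsup : upperSpectralSpace T (1 + t)⁻¹ ⊔ (upperSpectralSpace T (1 + t)⁻¹)ᗮ = ⊤ :=
      Submodule.sup_orthogonal_of_hasOrthogonalProjection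
    obtain ⟨α, hα, hco⟩ := h.coercive
    have hq' : 0 < 1 - (1 + t) * q := by
      have := mul_lt_mul_of_pos_left hq htp
      rw [mul_inv_cancel₀ htp.ne'] at this
      linarith
    refine ⟨(upperSpectralSpace T (1 + t)⁻¹)ᗮ.comap (e.toLinearEquiv : V →ₗ[ℝ] W), ?_,
      (1 - (1 + t) * q) * α, mul_pos hq' hα, fun u hu => ?_⟩
    · rw [h.map_lowerSpectralSpace he hT ht]
      have := congrArg (Submodule.comap (e.toLinearEquiv : V →ₗ[ℝ] W)) hsup
      rw [Submodule.comap_top] at this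
      rw [← this]
      exact ((Submodule.orderIsoMapComap e.toLinearEquiv).symm.map_sup _ _).symm
    · have h1 := hle _ hu
      have h2 : α * ‖u‖ * ‖u‖ ≤ A u u + C u u := hco u
      have h3 : C u u ≤ q * (A u u + C u u) := by
        rw [← he, ← hT, real_inner_self_eq_norm_sq]
        exact h1
      have h4 := mul_le_mul_of_nonneg_left h3 htp.le
      have h5 := mul_le_mul_of_nonneg_left h2 hq'.le
      nlinarith

end IsSpectralPair

end FormPairs

end

noncomputable section

/-! ### The counting function of the eigenvalues -/

section Counting

open Module

universe u

/-- A subspace that meets a complement of `L` trivially has at most the dimension of `L`. -/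
lemma finrank_le_of_sup_eq_top {V : Type*} [AddCommGroup V] [Module ℝ V] {L U F : Submodule ℝ V}
    [FiniteDimensional ℝ L] (hLU : L ⊔ U = ⊤) (hFU : ∀ u ∈ F, u ∈ U → u = 0) :
    finrank ℝ F ≤ finrank ℝ L := by
  -- `L` maps onto `V ⧸ U` and `F` embeds into it.
  have hsurj : Function.Surjective (U.mkQ.comp L.subtype) := by
    intro q
    obtain ⟨v, rfl⟩ := U.mkQ_surjective q
    obtain ⟨l, hl, w, hw, rfl⟩ := Submodule.mem_sup.1 (hLU ▸ Submodule.mem_top : v ∈ L ⊔ U)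
    refine ⟨⟨l, hl⟩, ?_⟩
    simpa [Submodule.Quotient.eq] using hw
  have hinj : Function.Injective (U.mkQ.comp F.subtype) := by
    rw [← LinearMap.ker_eq_bot, LinearMap.ker_eq_bot']
    intro u hu
    have : (u : V) ∈ U := by simpa using hu
    exact Subtype.ext (hFU _ u.2 this)
  have : FiniteDimensional ℝ (V ⧸ U) := Module.Finite.of_surjective _ hsurj
  exact (LinearMap.finrank_le_finrank_of_injective hinj).trans
    (LinearMap.finrank_le_finrank_of_surjective hsurj)

variable {V : Type u} [NormedAddCommGroup V] [InnerProductSpace ℝ V] [CompleteSpace V]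

/-- The number of eigenvalues that are at most `t`, counted with multiplicity. -/
def eigenvalueCount (A C : V →L[ℝ] V →L[ℝ] ℝ) (t : ℝ) : ℕ := finrank ℝ (lowerSpectralSpace A C t)

omit [CompleteSpace V] in
lemma abs_apply_sub_le (Q Q₀ : V →L[ℝ] V →L[ℝ] ℝ) (u : V) :
    |Q u u - Q₀ u u| ≤ ‖Q - Q₀‖ * ‖u‖ ^ 2 := by
  have := (Q - Q₀).le_opNorm₂ u u
  simpa [sq, mul_assoc] using this

namespace IsSpectralPair

variable {A C A₀ C₀ : V →L[ℝ] V →L[ℝ] ℝ}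

lemma eigenvalueCount_mono (h : IsSpectralPair A C) : Monotone (eigenvalueCount A C) := by
  intro s t hst
  have := h.finiteDimensional_lowerSpectralSpace t
  exact Submodule.finrank_mono (lowerSpectralSpace_mono A C hst)

lemma formEigenvalue_eq (h : IsSpectralPair A C) (i : ℕ) :
    formEigenvalue A C i = sInf {t : ℝ | i ≤ eigenvalueCount A C t} := by
  unfold formEigenvalue eigenvalueCount
  congr 1
  ext t
  have := h.finiteDimensional_lowerSpectralSpace t
  simp only [mem_ofPred_eq]
  rw [← finrank_eq_rank, Nat.cast_le]

omit [CompleteSpace V] in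
lemma eigenvalueCount_of_neg (h : IsSpectralPair A C) {t : ℝ} (ht : t < 0) :
    eigenvalueCount A C t = 0 := by
  unfold eigenvalueCount
  rw [h.lowerSpectralSpace_eq_bot ht]
  simp

/-- The eigenvalue count is upper semicontinuous in the forms. -/
lemma exists_eigenvalueCount_le (h₀ : IsSpectralPair A₀ C₀) (t : ℝ) :
    ∃ ε > 0, ∀ A C : V →L[ℝ] V →L[ℝ] ℝ, IsSpectralPair A C →
      ‖(A - t • C) - (A₀ - t • C₀)‖ < ε → eigenvalueCount A C t ≤ eigenvalueCount A₀ C₀ t := by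
  obtain ⟨U, hU, c, hc, hle⟩ := h₀.exists_coercive_complement t
  -- The coercivity constant on `U` is the admissible size of the perturbation: `A - t C` remains
  -- positive on `U \ {0}`, while it is `≤ 0` on the space that defines the count of `(A, C)`.
  refine ⟨c, hc, fun A C h hlt => ?_⟩
  have := h₀.finiteDimensional_lowerSpectralSpace t
  refine finrank_le_of_sup_eq_top hU fun u hu huU => ?_
  have h1 := h.le_of_mem_lowerSpectralSpace hu
  have h2 := hle u huU
  have h3 := abs_le.1 (abs_apply_sub_le (A - t • C) (A₀ - t • C₀) u)
  simp only [sub_apply, smul_apply, smul_eq_mul] at h3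
  by_contra h0
  have : 0 < ‖u‖ := norm_pos_iff.2 h0
  have := mul_lt_mul_of_pos_right hlt (pow_pos this 2)
  linarith [h3.1]

/-- The eigenvalue count does not drop under small perturbations of the forms when the threshold is
raised. -/
lemma exists_le_eigenvalueCount (h₀ : IsSpectralPair A₀ C₀) {s t : ℝ} (hst : s < t) :
    ∃ ε > 0, ∀ A C : V →L[ℝ] V →L[ℝ] ℝ, IsSpectralPair A C →
      ‖(A - t • C) - (A₀ - t • C₀)‖ < ε → eigenvalueCount A₀ C₀ s ≤ eigenvalueCount A C t := by
  rcases lt_or_ge s 0 with hs | hs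
  · exact ⟨1, one_pos, fun A C _ _ => by simp [h₀.eigenvalueCount_of_neg hs]⟩
  obtain ⟨α, hα, hco⟩ := h₀.coercive
  have hs1 : 0 < 1 + s := by linarith
  -- On the space counted at `s`, coercivity gives `α ‖u‖² ≤ A₀ + C₀ ≤ (1 + s) C₀`, so `A₀ - t C₀ ≤
  -- -(t - s) C₀ ≤ -(t - s) α / (1 + s) ‖u‖²`. This constant depends on the unperturbed pair only,
  -- although the complement `U` belongs to the perturbed one.
  refine ⟨(t - s) * (α / (1 + s)), mul_pos (sub_pos.2 hst) (div_pos hα hs1), fun A C h hlt => ?_⟩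
  obtain ⟨U, hU, c, hc, hle⟩ := h.exists_coercive_complement t
  have := h.finiteDimensional_lowerSpectralSpace t
  refine finrank_le_of_sup_eq_top hU fun u hu huU => ?_
  have h1 := h₀.le_of_mem_lowerSpectralSpace hu
  have h2 := hle u huU
  have h3 := abs_le.1 (abs_apply_sub_le (A - t • C) (A₀ - t • C₀) u)
  simp only [sub_apply, smul_apply, smul_eq_mul] at h3
  have h4 : α * ‖u‖ * ‖u‖ ≤ A₀ u u + C₀ u u := hco u
  have h5 : α / (1 + s) * ‖u‖ ^ 2 ≤ C₀ u u := by
    rw [div_mul_eq_mul_div, div_le_iff₀ hs1]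
    linarith
  have h6 := mul_le_mul_of_nonneg_left h5 (sub_pos.2 hst).le
  by_contra h0
  have hu0 : 0 < ‖u‖ := norm_pos_iff.2 h0
  have h7 := mul_lt_mul_of_pos_right hlt (pow_pos hu0 2)
  have h8 := mul_pos hc (pow_pos hu0 2)
  linarith [h3.2]

/-- By independence the eigenspace to `l` meets the sum of the eigenspaces up to `s < l` only in
`0`; both lie in the sum up to `t`. -/
lemma eigenvalueCount_add_finrank_le (h : IsSpectralPair A C) {s l t : ℝ} (hs : s < l)
    (hl : l ≤ t) :
    eigenvalueCount A C s + finrank ℝ (formEigenspace A C l) ≤ eigenvalueCount A C t := by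
  have := h.finiteDimensional_lowerSpectralSpace s
  have hft := h.finiteDimensional_lowerSpectralSpace t
  have hle := formEigenspace_le_lowerSpectralSpace A C hl
  have : FiniteDimensional ℝ (formEigenspace A C l) := Submodule.finiteDimensional_of_le hle
  have hdis : Disjoint (formEigenspace A C l) (lowerSpectralSpace A C s) :=
    h.iSupIndep_formEigenspace.disjoint_biSup (by simpa using hs)
  have h1 := Submodule.finrank_sup_add_finrank_inf_eq (lowerSpectralSpace A C s)
    (formEigenspace A C l)
  rw [hdis.symm.eq_bot, finrank_bot, add_zero] at h1
  unfold eigenvalueCount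
  rw [← h1]
  exact Submodule.finrank_mono (sup_le (lowerSpectralSpace_mono A C (hs.le.trans hl)) hle)

lemma eigenvalueCount_le_add_finrank (h : IsSpectralPair A C) {s l t : ℝ}
    (hl : ∀ r, s < r → r ≤ t → r ≠ l → formEigenspace A C r = ⊥) :
    eigenvalueCount A C t ≤ eigenvalueCount A C s + finrank ℝ (formEigenspace A C l) := by
  have := h.finiteDimensional_lowerSpectralSpace s
  have := h.finiteDimensional_lowerSpectralSpace l
  have : FiniteDimensional ℝ (formEigenspace A C l) :=
    Submodule.finiteDimensional_of_le (formEigenspace_le_lowerSpectralSpace A C le_rfl)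
  refine le_trans (Submodule.finrank_mono ?_) (Submodule.finrank_add_le_finrank_add_finrank _ _)
  refine iSup₂_le fun r hr => ?_
  rcases le_or_gt r s with h1 | h1
  · exact (formEigenspace_le_lowerSpectralSpace A C h1).trans le_sup_left
  · rcases eq_or_ne r l with rfl | h2
    · exact le_sup_right
    · rw [hl r h1 hr h2]
      exact bot_le

/-- The eigenvalues are isolated. -/
lemma exists_gap (h : IsSpectralPair A C) (m : ℝ) :
    ∃ ε > 0, ∀ s, |s - m| < ε → s ≠ m → formEigenspace A C s = ⊥ := by
  set F : Set ℝ := {s | s ≤ m + 1 ∧ formEigenspace A C s ≠ ⊥}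
  -- Eigenvectors to different eigenvalues `≤ m + 1` are linearly independent in a
  -- finite-dimensional space.
  have hF : F.Finite := by
    have := h.finiteDimensional_lowerSpectralSpace (m + 1)
    have hex : ∀ s : F, ∃ v ∈ formEigenspace A C s, v ≠ 0 := fun s =>
      (Submodule.ne_bot_iff _).1 s.2.2
    choose v hv hv0 using hex
    have hli : LinearIndependent ℝ v :=
      (h.iSupIndep_formEigenspace.comp (f := ((↑) : F → ℝ)) Subtype.val_injective).linearIndependent
        _ hv hv0
    let v' : F → lowerSpectralSpace A C (m + 1) := fun s =>
      ⟨v s, formEigenspace_le_lowerSpectralSpace A C s.2.1 (hv s)⟩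
    have hli' : LinearIndependent ℝ v' :=
      LinearIndependent.of_comp (lowerSpectralSpace A C (m + 1)).subtype hli
    exact hli'.finite
  have hopen : IsOpen (F \ {m})ᶜ := (hF.subset sdiff_subset).isClosed.isOpen_compl
  obtain ⟨ε, hε, hball⟩ := Metric.isOpen_iff.1 hopen m (by simp)
  refine ⟨min ε 1, lt_min hε one_pos, fun s hs hsm => ?_⟩
  by_contra hne
  have h1 : s ∈ (F \ {m})ᶜ := hball (by
    rw [Metric.mem_ball, Real.dist_eq]
    exact hs.trans_le (min_le_left _ _))
  have h2 : s ≤ m + 1 := by linarith [(abs_lt.1 (hs.trans_le (min_le_right _ _))).2]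
  exact h1 ⟨⟨h2, hne⟩, hsm⟩

-- The constant is the minimum of `C u u` over the unit sphere of `F`, which is compact.
omit [CompleteSpace V] in
lemma exists_pos_le_of_finiteDimensional (h : IsSpectralPair A C) (F : Submodule ℝ V)
    [FiniteDimensional ℝ F] : ∃ c > 0, ∀ u ∈ F, c * ‖u‖ ^ 2 ≤ C u u := by
  by_cases hF : Nontrivial F
  · obtain ⟨x, hx, hmin⟩ := (isCompact_sphere (0 : F) 1).exists_isMinOn
      (NormedSpace.sphere_nonempty.2 zero_le_one)
      (f := fun u : F => C u u) (by fun_prop)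
    have hx0 : (x : V) ≠ 0 := by
      rintro h0
      have : ‖x‖ = 1 := by simpa using hx
      rw [Submodule.coe_eq_zero.1 h0] at this
      simp at this
    refine ⟨C x x, h.pos _ hx0, fun u hu => ?_⟩
    rcases eq_or_ne u 0 with rfl | h0
    · simp
    · have hn : ‖u‖ ≠ 0 := norm_ne_zero_iff.2 h0
      have h1 := hmin (a := (‖u‖⁻¹ • ⟨u, hu⟩ : F)) (by
        simp [norm_smul, inv_mul_cancel₀ hn])
      simp only [mem_ofPred_eq, Submodule.coe_smul, map_smul, smul_apply,
        smul_eq_mul] at h1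
      rw [← mul_assoc, ← mul_inv, ← sq, inv_mul_eq_div, le_div_iff₀ (by positivity)] at h1
      exact h1
  · rw [not_nontrivial_iff_subsingleton, Submodule.subsingleton_iff_eq_bot] at hF
    refine ⟨1, one_pos, fun u hu => ?_⟩
    rw [hF, Submodule.mem_bot] at hu
    simp [hu]

/-- On a space `F` of dimension `i` one has `A ≤ (‖A‖ / c) C`, so `F` meets the coercive complement
at the threshold `‖A‖ / c` trivially. This makes the set in `formEigenvalue` nonempty; the infimum
of the empty set would be the default value `0`. -/
lemma exists_le_eigenvalueCount_of_infinite (h : IsSpectralPair A C)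
    (hV : ¬ FiniteDimensional ℝ V) (i : ℕ) : ∃ t, i ≤ eigenvalueCount A C t := by
  have hrank : (i : Cardinal) ≤ Module.rank ℝ V := by
    have : Cardinal.aleph0 ≤ Module.rank ℝ V := by
      by_contra hlt
      exact hV (Module.rank_lt_aleph0_iff.1 (not_le.1 hlt))
    exact (Cardinal.natCast_lt_aleph0 (n := i)).le.trans this
  obtain ⟨v, hv⟩ := exists_linearIndependent_of_le_rank hrank
  set F := Submodule.span ℝ (range v)
  have hFr : finrank ℝ F = i := by simpa using finrank_span_eq_card hv
  have : FiniteDimensional ℝ F := FiniteDimensional.span_of_finite ℝ (finite_range v)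
  obtain ⟨c, hc, hle⟩ := h.exists_pos_le_of_finiteDimensional F
  refine ⟨‖A‖ / c, ?_⟩
  obtain ⟨U, hU, c', hc', hle'⟩ := h.exists_coercive_complement (‖A‖ / c)
  have := h.finiteDimensional_lowerSpectralSpace (‖A‖ / c)
  rw [← hFr]
  refine finrank_le_of_sup_eq_top hU fun u hu huU => ?_
  have h1 := hle' u huU
  have h2 : A u u ≤ ‖A‖ * ‖u‖ ^ 2 := by
    have := (le_abs_self _).trans (A.le_opNorm₂ u u)
    rwa [mul_assoc, ← sq] at this
  have h3 : ‖A‖ * ‖u‖ ^ 2 ≤ ‖A‖ / c * C u u := by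
    have := mul_le_mul_of_nonneg_left (hle u hu) (div_nonneg (norm_nonneg A) hc.le)
    rwa [← mul_assoc, div_mul_cancel₀ _ hc.ne'] at this
  by_contra h0
  have := mul_pos hc' (pow_pos (norm_pos_iff.2 h0) 2)
  linarith

/-- The count near a simple eigenvalue. -/
lemma exists_eigenvalueCount_near (h : IsSpectralPair A C) (hV : ¬ FiniteDimensional ℝ V) {i : ℕ}
    (hi : 1 ≤ i) (hs : finrank ℝ (formEigenspace A C (formEigenvalue A C i)) = 1) :
    ∃ ε > 0, (∀ t, formEigenvalue A C i - ε < t → t < formEigenvalue A C i →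
        eigenvalueCount A C t + 1 = i) ∧
      ∀ t, formEigenvalue A C i ≤ t → t < formEigenvalue A C i + ε →
        eigenvalueCount A C t = i := by
  set m := formEigenvalue A C i
  have hm : m = sInf {t : ℝ | i ≤ eigenvalueCount A C t} := h.formEigenvalue_eq i
  have hne : {t : ℝ | i ≤ eigenvalueCount A C t}.Nonempty :=
    h.exists_le_eigenvalueCount_of_infinite hV i
  have hbdd : BddBelow {t : ℝ | i ≤ eigenvalueCount A C t} := by
    refine ⟨0, fun t ht => ?_⟩
    by_contra hlt
    have h1 : i ≤ eigenvalueCount A C t := ht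
    rw [h.eigenvalueCount_of_neg (not_le.1 hlt)] at h1
    omega
  have hlow : ∀ t, t < m → eigenvalueCount A C t < i := fun t ht => by
    by_contra hle
    exact absurd (csInf_le hbdd (not_lt.1 hle : t ∈ {t : ℝ | i ≤ eigenvalueCount A C t}))
      (not_le.2 (hm ▸ ht))
  have hup : ∀ t, m < t → i ≤ eigenvalueCount A C t := fun t ht => by
    obtain ⟨r, hr, hrt⟩ := exists_lt_of_csInf_lt hne (hm ▸ ht)
    exact le_trans hr (h.eigenvalueCount_mono hrt.le)
  obtain ⟨ε, hε, hgap⟩ := h.exists_gap m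
  -- Inside the gap only `m` is an eigenvalue, and it is simple: the count jumps by exactly one
  -- there.
  have key : ∀ s t, m - ε < s → s < m → m ≤ t → t < m + ε →
      eigenvalueCount A C t = eigenvalueCount A C s + 1 := by
    intro s t h1 h2 h3 h4
    refine le_antisymm ?_ ?_
    · rw [← hs]
      refine h.eigenvalueCount_le_add_finrank fun r hr1 hr2 hr3 => hgap r ?_ hr3
      rw [abs_lt]
      constructor <;> linarith
    · rw [← hs]
      exact h.eigenvalueCount_add_finrank_le h2 h3
  have hleft : ∀ t, m - ε < t → t < m → eigenvalueCount A C t + 1 = i := by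
    intro t h1 h2
    have h3 := key t (m + ε / 2) h1 h2 (by linarith) (by linarith)
    have h4 := hlow t h2
    have h5 := hup (m + ε / 2) (by linarith)
    omega
  refine ⟨ε, hε, hleft, fun t h1 h2 => ?_⟩
  rw [key (m - ε / 2) t (by linarith) (by linarith) h1 h2]
  exact hleft _ (by linarith) (by linarith)

/-- An eigenvalue between thresholds at which the counts are `i - 1` and `i` is the `i`-th one, and
it is simple. -/
lemma formEigenvalue_eq_of_eigenvalueCount (h : IsSpectralPair A C) {i : ℕ} {s t l : ℝ}
    (hs : eigenvalueCount A C s + 1 = i) (ht : eigenvalueCount A C t = i) (hsl : s < l)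
    (hlt : l ≤ t) (hl : formEigenspace A C l ≠ ⊥) :
    formEigenvalue A C i = l ∧ finrank ℝ (formEigenspace A C l) = 1 := by
  have := h.finiteDimensional_lowerSpectralSpace l
  have : FiniteDimensional ℝ (formEigenspace A C l) :=
    Submodule.finiteDimensional_of_le (formEigenspace_le_lowerSpectralSpace A C le_rfl)
  have hpos : 1 ≤ finrank ℝ (formEigenspace A C l) := Submodule.one_le_finrank_iff.2 hl
  have h1 := h.eigenvalueCount_add_finrank_le hsl le_rfl
  have h2 := h.eigenvalueCount_mono hlt
  refine ⟨?_, by omega⟩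
  rw [h.formEigenvalue_eq]
  refine IsLeast.csInf_eq ⟨by simp only [mem_ofPred_eq]; omega, fun r hr => ?_⟩
  by_contra hlt'
  have h3 := h.eigenvalueCount_add_finrank_le (not_le.1 hlt') le_rfl
  have h4 : i ≤ eigenvalueCount A C r := hr
  omega

/-- The count just below the `i`-th eigenvalue is `i - 1 ≥ 1`, but it vanishes below `0`. The first
eigenvalue may be `0`, as in the Neumann problem. -/
lemma formEigenvalue_pos (h : IsSpectralPair A C) (hV : ¬ FiniteDimensional ℝ V) {i : ℕ}
    (hi : 2 ≤ i) (hs : finrank ℝ (formEigenspace A C (formEigenvalue A C i)) = 1) :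
    0 < formEigenvalue A C i := by
  obtain ⟨ε, hε, hl, hr⟩ := h.exists_eigenvalueCount_near hV (by omega : 1 ≤ i) hs
  by_contra hle
  have h1 := hl (formEigenvalue A C i - ε / 2) (by linarith) (by linarith)
  rw [h.eigenvalueCount_of_neg (by linarith)] at h1
  omega

end IsSpectralPair

end Counting

end

noncomputable section

/-! ### The branch of eigenpairs through a simple one -/

section Branch

open Module

universe u

variable {V : Type u} [NormedAddCommGroup V] [InnerProductSpace ℝ V] [CompleteSpace V]

/-- The Fredholm alternative for a compact perturbation of a coercive form. -/
lemma surjective_sub_of_injective {B D : V →L[ℝ] V →L[ℝ] ℝ} (hB : IsCoercive B)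
    (hD : IsCompactOperator D) (hinj : ∀ v, (B - D) v = 0 → v = 0) :
    Function.Surjective (B - D) := by
  let L := hB.continuousLinearEquivOfBilin
  let D' : V →L[ℝ] V := InnerProductSpace.continuousLinearMapOfBilin (𝕜 := ℝ) D
  have hD' : ∀ u v, inner ℝ (D' u) v = D u v :=
    fun u v => InnerProductSpace.continuousLinearMapOfBilin_apply D u v
  have hD'c : IsCompactOperator D' := by
    have := hD.continuous_comp (InnerProductSpace.toDual ℝ V).symm.continuous
    convert! this
  -- With `B (T u) = D u` the form `B - D` is `B` composed with `1 - T`. As `T` is compact and `1`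
  -- is not an eigenvalue, `1 - T` is invertible.
  let T : V →L[ℝ] V := L.symm.toContinuousLinearMap.comp D'
  have hTc : IsCompactOperator T := hD'c.clm_comp L.symm.toContinuousLinearMap
  have hT : ∀ u v, B (T u) v = D u v := fun u v => by
    rw [← hB.continuousLinearEquivOfBilin_apply, ← hD']
    congr 1
    exact L.apply_symm_apply _
  have hev : ¬ Module.End.HasEigenvalue (T : Module.End ℝ V) 1 := by
    intro he
    obtain ⟨v, hv⟩ := he.exists_hasEigenvector
    have h1 : T v = v := by simpa using hv.apply_eq_smul
    refine hv.2 (hinj v (ContinuousLinearMap.ext fun w => ?_))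
    simp [← hT, h1]
  have hres := (hTc.hasEigenvalue_or_mem_resolventSet one_ne_zero).resolve_left hev
  rw [spectrum.mem_resolventSet_iff, map_one] at hres
  obtain ⟨R, hR⟩ := hres
  intro f
  let g := L.symm ((InnerProductSpace.toDual ℝ V).symm f)
  have hg : ∀ v, B g v = f v := fun v => by
    rw [← hB.continuousLinearEquivOfBilin_apply]
    change inner ℝ (L g) v = _
    rw [L.apply_symm_apply, InnerProductSpace.toDual_symm_apply]
  obtain ⟨z, hz⟩ : ∃ z, (1 - T) z = g := ⟨(R⁻¹ : (V →L[ℝ] V)ˣ).1 g, by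
    rw [← hR, ← mul_apply_eq_comp, Units.mul_inv, one_apply_eq_self]⟩
  refine ⟨z, ContinuousLinearMap.ext fun v => ?_⟩
  rw [← hg, ← hz]
  simp [hT]

omit [CompleteSpace V] in
lemma exists_unit_smul_of_finrank_eq_one {A C : V →L[ℝ] V →L[ℝ] ℝ} {l : ℝ} {w : V}
    (hE : finrank ℝ (formEigenspace A C l) = 1) (hw : w ∈ formEigenspace A C l)
    (hn : C w w = 1) {v : V} (hv : v ∈ formEigenspace A C l) : ∃ k : ℝ, v = k • w := by
  have h0 : (⟨w, hw⟩ : formEigenspace A C l) ≠ 0 := by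
    intro h
    have : w = 0 := congrArg Subtype.val h
    simp [this] at hn
  obtain ⟨k, hk⟩ := (finrank_eq_one_iff_of_nonzero' _ h0).1 hE ⟨v, hv⟩
  exact ⟨k, (congrArg Subtype.val hk).symm⟩

/-- The derivative of `(w, l) ↦ (A w - l C w, C (w, w))`. -/
def eigenpairDeriv (A C : V →L[ℝ] V →L[ℝ] ℝ) (w : V) (l : ℝ) :
    V × ℝ →L[ℝ] (V →L[ℝ] ℝ) × ℝ :=
  ((A - l • C).comp (ContinuousLinearMap.fst ℝ V ℝ)
      - (ContinuousLinearMap.snd ℝ V ℝ).smulRight (C w)).prod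
    ((C w + C.flip w).comp (ContinuousLinearMap.fst ℝ V ℝ))

omit [CompleteSpace V] in
lemma hasFDerivAt_eigenpair (A C : V →L[ℝ] V →L[ℝ] ℝ) (w : V) (l : ℝ) :
    HasFDerivAt (fun p : V × ℝ => (A p.1 - p.2 • C p.1, C p.1 p.1)) (eigenpairDeriv A C w l)
      (w, l) := by
  have hf : HasFDerivAt (fun p : V × ℝ => p.1) (ContinuousLinearMap.fst ℝ V ℝ) (w, l) :=
    hasFDerivAt_fst
  have hs : HasFDerivAt (fun p : V × ℝ => p.2) (ContinuousLinearMap.snd ℝ V ℝ) (w, l) :=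
    hasFDerivAt_snd
  have hA := A.hasFDerivAt.comp (w, l) hf
  have hC := C.hasFDerivAt.comp (w, l) hf
  have h1 := hA.sub (hs.smul hC)
  have h2 := hC.clm_apply hf
  refine (h1.prodMk h2).congr_fderiv ?_
  ext <;> simp [eigenpairDeriv]

/-- The derivative is `(v, s) ↦ ((A - l C) v - s C w, 2 C(w, v))`. Testing the first component with
`w` removes the `v` term by symmetry and isolates `s`. If the value is zero, then `s = 0`, `v` is a
multiple of `w` by simplicity, and `C(w, v) = 0` forces `v = 0`. -/
lemma bijective_eigenpairDeriv {A C : V →L[ℝ] V →L[ℝ] ℝ} (h : IsSpectralPair A C) {w : V} {l : ℝ}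
    (hE : finrank ℝ (formEigenspace A C l) = 1) (hw : w ∈ formEigenspace A C l)
    (hn : C w w = 1) : Function.Bijective (eigenpairDeriv A C w l) := by
  have hwe := mem_formEigenspace.1 hw
  have hwe' : ∀ v, A v w = l * C v w := fun v => by rw [h.symm_left, h.symm_right, hwe]
  have happ : ∀ (v : V) (s : ℝ), eigenpairDeriv A C w l (v, s)
      = ((A - l • C) v - s • C w, 2 * C w v) := fun v s => by
    simp only [eigenpairDeriv, ContinuousLinearMap.prod_apply, Prod.mk.injEq]
    constructor
    · ext; simp
    · simp [h.symm_right v w]; ring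
  constructor
  · rw [injective_iff_map_eq_zero]
    rintro ⟨v, s⟩ hvs
    rw [happ, Prod.mk_eq_zero] at hvs
    obtain ⟨h1, h2⟩ := hvs
    have h1' : ∀ η, A v η - l * C v η - s * C w η = 0 := fun η => by
      simpa using congrArg (fun f => f η) h1
    have hs : s = 0 := by
      have := h1' w
      rw [hwe', hn] at this
      linarith
    subst hs
    have hv : v ∈ formEigenspace A C l := mem_formEigenspace.2 fun η => by linarith [h1' η]
    obtain ⟨k, rfl⟩ := exists_unit_smul_of_finrank_eq_one hE hw hn hv
    have hk : k = 0 := by simpa [hn] using h2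
    simp [hk]
  -- `A - l C` has the kernel spanned by `w`. Adding the rank-one form `R` removes it, and `A - l C
  -- + R` is the coercive form `A + C` minus the compact form `D`.
  · let R : V →L[ℝ] V →L[ℝ] ℝ := (C w).smulRight (C w)
    have hR : ∀ u v, R u v = C w u * C w v := fun u v => by simp [R]
    let D : V →L[ℝ] V →L[ℝ] ℝ := (1 + l) • C - R
    have hDc : IsCompactOperator D := by
      have h1 : IsCompactOperator R :=
        (isCompactOperator_of_locallyCompactSpace_rng
          ((ContinuousLinearMap.id ℝ ℝ).smulRight (C w))).comp_clm (C w)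
      exact (h.compact.smul (1 + l)).sub h1
    have hBD : ∀ u v, (A + C - D) u v = A u v - l * C u v + C w u * C w v := fun u v => by
      simp [D, hR]; ring
    have hsurj := surjective_sub_of_injective h.coercive hDc (fun v hv => by
      have h1 : ∀ η, A v η - l * C v η + C w v * C w η = 0 := fun η => by
        rw [← hBD, hv]; rfl
      have h2 := h1 w
      rw [hwe', hn] at h2
      have h3 : C w v = 0 := by linarith
      have hv : v ∈ formEigenspace A C l := mem_formEigenspace.2 fun η => by
        have := h1 η
        rw [h3] at this
        linarith
      obtain ⟨k, rfl⟩ := exists_unit_smul_of_finrank_eq_one hE hw hn hv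
      have hk : k = 0 := by simpa [hn] using h3
      simp [hk])
    rintro ⟨f, r⟩
    -- This right-hand side vanishes at `w`, so that `C(w, v) = 0` and the `R` term drops out. The
    -- subtracted multiple of `C w` is restored by `s = -f w`, and adding `(r / 2) w` produces the
    -- second component `r` without changing the first.
    obtain ⟨v, hv⟩ := hsurj (f - f w • C w)
    have hv' : ∀ η, A v η - l * C v η + C w v * C w η = f η - f w * C w η := fun η => by
      rw [← hBD, hv]; simp
    have hv0 : C w v = 0 := by
      have := hv' w
      rw [hwe', hn] at this
      linarith
    refine ⟨(v + (r / 2) • w, - f w), ?_⟩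
    rw [happ, Prod.mk.injEq]
    constructor
    · ext η
      have := hv' η
      rw [hv0] at this
      have h2 := hwe η
      simp [h2]
      linarith
    · simp [hv0, hn]; ring

variable {X : Type*} [NormedAddCommGroup X] [NormedSpace ℝ X] [CompleteSpace X]

/-- Through a simple eigenpair passes a branch of normalized eigenpairs. -/
lemma exists_implicit_eigenpair {A C : X → V →L[ℝ] V →L[ℝ] ℝ} (hA : ContDiff ℝ 1 A)
    (hC : ContDiff ℝ 1 C) {x₀ : X} (h : IsSpectralPair (A x₀) (C x₀)) {w₀ : V} {l₀ : ℝ}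
    (hE : finrank ℝ (formEigenspace (A x₀) (C x₀) l₀) = 1)
    (hw : w₀ ∈ formEigenspace (A x₀) (C x₀) l₀) (hn : C x₀ w₀ w₀ = 1) :
    ∃ S : X → V × ℝ, S x₀ = (w₀, l₀) ∧ ContDiffAt ℝ 1 S x₀ ∧
      ∀ᶠ x in 𝓝 x₀, (S x).1 ∈ formEigenspace (A x) (C x) (S x).2 ∧ C x (S x).1 (S x).1 = 1 := by
  let F : X × (V × ℝ) → (V →L[ℝ] ℝ) × ℝ := fun p =>
    (A p.1 p.2.1 - p.2.2 • C p.1 p.2.1, C p.1 p.2.1 p.2.1)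
  have hF : ContDiff ℝ 1 F := by
    have h1 : ContDiff ℝ 1 fun p : X × (V × ℝ) => p.2.1 := by fun_prop
    have h2 : ContDiff ℝ 1 fun p : X × (V × ℝ) => p.2.2 := by fun_prop
    have h3 : ContDiff ℝ 1 fun p : X × (V × ℝ) => A p.1 p.2.1 :=
      (hA.comp contDiff_fst).clm_apply h1
    have h4 : ContDiff ℝ 1 fun p : X × (V × ℝ) => C p.1 p.2.1 :=
      (hC.comp contDiff_fst).clm_apply h1
    exact (h3.sub (h2.smul h4)).prodMk (h4.clm_apply h1)
  have hFat : ContDiffAt ℝ 1 F (x₀, (w₀, l₀)) := hF.contDiffAt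
  have hFd : fderiv ℝ F (x₀, (w₀, l₀)) ∘L ContinuousLinearMap.inr ℝ X (V × ℝ)
      = eigenpairDeriv (A x₀) (C x₀) w₀ l₀ := by
    have h1 : HasFDerivAt F (fderiv ℝ F (x₀, (w₀, l₀))) (x₀, (w₀, l₀)) :=
      (hFat.differentiableAt one_ne_zero).hasFDerivAt
    have h2 := h1.comp (w₀, l₀) (hasFDerivAt_prodMk_right x₀ (w₀, l₀))
    exact h2.unique (hasFDerivAt_eigenpair (A x₀) (C x₀) w₀ l₀)
  have hinv : (fderiv ℝ F (x₀, (w₀, l₀)) ∘L ContinuousLinearMap.inr ℝ X (V × ℝ)).IsInvertible := by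
    rw [hFd]
    have hb := bijective_eigenpairDeriv h hE hw hn
    exact ⟨ContinuousLinearEquiv.ofBijective _ (LinearMap.ker_eq_bot.2 hb.1)
      (LinearMap.range_eq_top.2 hb.2), by ext <;> rfl⟩
  refine ⟨hFat.implicitFunction one_ne_zero hinv, hFat.implicitFunction_apply_self one_ne_zero hinv,
    hFat.contDiffAt_implicitFunction one_ne_zero hinv, ?_⟩
  have hF0 : F (x₀, (w₀, l₀)) = (0, 1) := by
    have := mem_formEigenspace.1 hw
    simp only [F, Prod.mk.injEq, hn, and_true]
    ext η
    simp [this]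
  filter_upwards [hFat.eventually_apply_implicitFunction one_ne_zero hinv] with x hx
  rw [hF0, Prod.mk.injEq] at hx
  refine ⟨mem_formEigenspace.2 fun η => ?_, hx.2⟩
  have := congrArg (fun f => f η) hx.1
  simpa [sub_eq_zero] using this

omit [CompleteSpace V] [CompleteSpace X] in
/-- The derivative of the eigenvalue along a differentiable branch of normalized eigenpairs. -/
lemma eigenvalue_deriv_apply {A C : X → V →L[ℝ] V →L[ℝ] ℝ} {S : X → V × ℝ} {x : X}
    (h : IsSpectralPair (A x) (C x)) {A' C' : X →L[ℝ] V →L[ℝ] V →L[ℝ] ℝ}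
    {S' : X →L[ℝ] V × ℝ} (hA : HasFDerivAt A A' x) (hC : HasFDerivAt C C' x)
    (hS : HasFDerivAt S S' x)
    (hev : ∀ᶠ y in 𝓝 x, (S y).1 ∈ formEigenspace (A y) (C y) (S y).2 ∧ C y (S y).1 (S y).1 = 1)
    (k : X) : (S' k).2 = A' k (S x).1 (S x).1 - (S x).2 * C' k (S x).1 (S x).1 := by
  have hw : HasFDerivAt (fun y => (S y).1) ((ContinuousLinearMap.fst ℝ V ℝ).comp S') x :=
    hS.fst
  have hl : HasFDerivAt (fun y => (S y).2) ((ContinuousLinearMap.snd ℝ V ℝ).comp S') x :=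
    hS.snd
  have hAw := (hA.clm_apply hw).clm_apply hw
  have hCw := (hC.clm_apply hw).clm_apply hw
  -- The identities `A(w, w) = l` and `C(w, w) = 1` are differentiated. Since `A(w', w) = l C(w',
  -- w)`, the second one eliminates `w'` from the first.
  have h1 : (fun y => A y (S y).1 (S y).1) =ᶠ[𝓝 x] fun y => (S y).2 := by
    filter_upwards [hev] with y hy
    rw [mem_formEigenspace.1 hy.1, hy.2, mul_one]
  have h2 : (fun y => C y (S y).1 (S y).1) =ᶠ[𝓝 x] fun _ => (1 : ℝ) := by
    filter_upwards [hev] with y hy using hy.2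
  have e1 := (hAw.congr_of_eventuallyEq h1.symm).unique hl
  have e2 := (hCw.congr_of_eventuallyEq h2.symm).unique (hasFDerivAt_const (1 : ℝ) x)
  have e1' := congrArg (fun f => f k) e1
  have e2' := congrArg (fun f => f k) e2
  have hx := mem_formEigenspace.1 hev.self_of_nhds.1
  simp [h.symm_left (S' k).1, h.symm_right (S' k).1, hx] at e1' e2'
  linear_combination -e1' + (S x).2 * e2'

/-- A simple eigenvalue of a `C¹` family of form pairs and its normalized eigenvector depend on the
parameter in a `C¹` way. -/
theorem exists_contDiff_eigenpair {A C : X → V →L[ℝ] V →L[ℝ] ℝ} (hA : ContDiff ℝ 1 A)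
    (hC : ContDiff ℝ 1 C) (h : ∀ x, IsSpectralPair (A x) (C x)) (hV : ¬ FiniteDimensional ℝ V)
    {i : ℕ} (hi : 1 ≤ i) {x₀ : X} {w₀ : V}
    (hE : finrank ℝ (formEigenspace (A x₀) (C x₀) (formEigenvalue (A x₀) (C x₀) i)) = 1)
    (hw : w₀ ∈ formEigenspace (A x₀) (C x₀) (formEigenvalue (A x₀) (C x₀) i))
    (hn : C x₀ w₀ w₀ = 1) {σ : ℝ} (hσ : 0 < σ) (hσ1 : σ < 1) :
    ∃ δ > 0, ∃ r > 0, ∃ (S : X → V × ℝ) (S' : X → (X →L[ℝ] V × ℝ)),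
      (∀ x ∈ Metric.ball x₀ δ,
        (∀ w : V, ((w ∈ formEigenspace (A x) (C x) (formEigenvalue (A x) (C x) i) ∧ C x w w = 1) ∧
          σ < C x₀ w w₀) ↔ w = (S x).1) ∧
        (S x).2 = formEigenvalue (A x) (C x) i ∧
        S x ∈ Metric.ball (w₀, formEigenvalue (A x₀) (C x₀) i) r ∧
        (2 ≤ i → 0 < formEigenvalue (A x) (C x) i)) ∧
      (∀ x ∈ Metric.ball x₀ δ, HasFDerivAt S (S' x) x) ∧
      ContinuousOn S' (Metric.ball x₀ δ) ∧
      (∀ x ∈ Metric.ball x₀ δ, ∀ k : X, (S' x k).2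
        = fderiv ℝ A x k (S x).1 (S x).1
          - formEigenvalue (A x) (C x) i * fderiv ℝ C x k (S x).1 (S x).1) := by
  set m := formEigenvalue (A x₀) (C x₀) i
  obtain ⟨S, hS0, hSd, hSe⟩ := exists_implicit_eigenpair hA hC (h x₀) hE hw hn
  obtain ⟨ε, hε, hleft, hright⟩ := (h x₀).exists_eigenvalueCount_near hV hi hE
  have hcont := fun t : ℝ => (hA.sub (hC.const_smul t)).continuous
  have hnear : ∀ t : ℝ, ∀ η > 0, ∀ᶠ x in 𝓝 x₀, ‖(A x - t • C x) - (A x₀ - t • C x₀)‖ < η := by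
    intro t η hη
    have := (hcont t).continuousAt (x := x₀) (Metric.ball_mem_nhds _ hη)
    filter_upwards [this] with x hx
    rwa [mem_preimage, Metric.mem_ball, dist_eq_norm] at hx
  have hup : ∀ t, ∀ᶠ x in 𝓝 x₀,
      eigenvalueCount (A x) (C x) t ≤ eigenvalueCount (A x₀) (C x₀) t := fun t => by
    obtain ⟨η, hη, hle⟩ := (h x₀).exists_eigenvalueCount_le t
    filter_upwards [hnear t η hη] with x hx using hle _ _ (h x) hx
  have hlow : ∀ s t, s < t → ∀ᶠ x in 𝓝 x₀,
      eigenvalueCount (A x₀) (C x₀) s ≤ eigenvalueCount (A x) (C x) t := fun s t hst => by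
    obtain ⟨η, hη, hle⟩ := (h x₀).exists_le_eigenvalueCount hst
    filter_upwards [hnear t η hη] with x hx using hle _ _ (h x) hx
  have hScont : ContinuousAt S x₀ := hSd.continuousAt
  have hl : ContinuousAt (fun x => (S x).2) x₀ := hScont.snd
  have hw' : ContinuousAt (fun x => C x₀ (S x).1 w₀) x₀ :=
    ((C x₀).flip w₀).continuous.continuousAt.comp_of_eq hScont.fst rfl
  have hev : ∀ᶠ x in 𝓝 x₀,
      ((S x).1 ∈ formEigenspace (A x) (C x) (S x).2 ∧ C x (S x).1 (S x).1 = 1) ∧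
      (eigenvalueCount (A x) (C x) (m - ε / 2) + 1 = i ∧
        eigenvalueCount (A x) (C x) (m + ε / 2) = i) ∧
      ((m - ε / 2 < (S x).2 ∧ (S x).2 < m + ε / 2) ∧ (2 ≤ i → 0 < (S x).2)) ∧
      σ < C x₀ (S x).1 w₀ ∧ S x ∈ Metric.ball (w₀, m) 1 ∧ ContDiffAt ℝ 1 S x := by
    refine hSe.and (Eventually.and ?_ (Eventually.and ?_ (Eventually.and ?_ (Eventually.and ?_ ?_))))
    -- The upper bounds hold at the thresholds themselves. The lower bounds require a smaller
    -- threshold for the unperturbed pair, within the same interval of constancy of its count: `m -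
    -- 3ε/4` below `m - ε/2`, and `m` below `m + ε/2`.
    · filter_upwards [hup (m - ε / 2), hup (m + ε / 2),
        hlow (m - 3 * ε / 4) (m - ε / 2) (by linarith),
        hlow m (m + ε / 2) (by linarith)] with x h1 h2 h3 h4
      have k1 := hleft (m - ε / 2) (by linarith) (by linarith)
      have k2 := hleft (m - 3 * ε / 4) (by linarith) (by linarith)
      have k3 := hright m le_rfl (by linarith)
      have k4 := hright (m + ε / 2) (by linarith) (by linarith)
      constructor <;> omega
    · have e1 : ∀ᶠ x in 𝓝 x₀, m - ε / 2 < (S x).2 := hl.eventually (lt_mem_nhds (by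
        simp only [hS0]; linarith))
      have e2 : ∀ᶠ x in 𝓝 x₀, (S x).2 < m + ε / 2 := hl.eventually (gt_mem_nhds (by
        simp only [hS0]; linarith))
      have e3 : ∀ᶠ x in 𝓝 x₀, 2 ≤ i → 0 < (S x).2 := by
        by_cases h2 : 2 ≤ i
        · have : ∀ᶠ x in 𝓝 x₀, 0 < (S x).2 := hl.eventually (lt_mem_nhds (by
            simp only [hS0]; exact (h x₀).formEigenvalue_pos hV h2 hE))
          filter_upwards [this] with x hx _ using hx
        · exact Eventually.of_forall fun x hx => absurd hx h2
      exact (e1.and e2).and e3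
    · exact hw'.eventually (lt_mem_nhds (by simp only [hS0, hn]; exact hσ1))
    · exact hScont (by rw [hS0]; exact Metric.ball_mem_nhds _ one_pos)
    · exact hSd.eventually (by simp)
  obtain ⟨δ, hδ, hball⟩ := Metric.eventually_nhds_iff_ball.1 hev
  -- The branch provides an eigenvalue in the window where the count rises from `i - 1` to `i`.
  have hval : ∀ x ∈ Metric.ball x₀ δ, formEigenvalue (A x) (C x) i = (S x).2 ∧
      finrank ℝ (formEigenspace (A x) (C x) (S x).2) = 1 := by
    intro x hx
    obtain ⟨⟨h1, h2⟩, ⟨h3, h4⟩, ⟨⟨h5, h6⟩, -⟩, -⟩ := hball x hx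
    refine (h x).formEigenvalue_eq_of_eigenvalueCount h3 h4 h5 h6.le ?_
    rw [Submodule.ne_bot_iff]
    refine ⟨_, h1, fun h0 => ?_⟩
    simp [h0] at h2
  refine ⟨δ, hδ, 1, one_pos, S, fderiv ℝ S, fun x hx => ?_, fun x hx => ?_, fun x hx => ?_,
    fun x hx k => ?_⟩
  · obtain ⟨⟨h1, h2⟩, -, ⟨-, hpos⟩, h3, h4, -⟩ := hball x hx
    obtain ⟨hv, hfr⟩ := hval x hx
    rw [hv]
    refine ⟨fun w => ⟨?_, ?_⟩, rfl, h4, hpos⟩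
    · rintro ⟨⟨hw1, hw2⟩, hw3⟩
      obtain ⟨k, rfl⟩ := exists_unit_smul_of_finrank_eq_one hfr h1 h2 hw1
      -- Normalization leaves `k = ±1`, and the condition with `σ > 0` excludes `k = -1`.
      have hk : k * k = 1 := by simpa [h2] using hw2
      have hk' : 0 < k * C x₀ (S x).1 w₀ := by
        simpa using hσ.trans hw3
      have hkpos : 0 < k := pos_of_mul_pos_left hk' (hσ.trans h3).le
      have : k = 1 := by nlinarith
      simp [this]
    · rintro rfl
      exact ⟨⟨h1, h2⟩, h3⟩
  · exact ((hball x hx).2.2.2.2.2.differentiableAt one_ne_zero).hasFDerivAt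
  · exact ((hball x hx).2.2.2.2.2.fderiv_right (m := 0) (by simp)).continuousAt.continuousWithinAt
  · rw [(hval x hx).1]
    refine eigenvalue_deriv_apply (h x) ((hA.differentiable one_ne_zero) x).hasFDerivAt
      ((hC.differentiable one_ne_zero) x).hasFDerivAt
      ((hball x hx).2.2.2.2.2.differentiableAt one_ne_zero).hasFDerivAt ?_ k
    filter_upwards [Metric.isOpen_ball.mem_nhds hx] with y hy using (hball y hy).1

end Branch

end

noncomputable section

/-! ### Superposition operators in `L^∞` -/

section Superposition

variable {α : Type*} {m : MeasurableSpace α} {μ : Measure α}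

lemma ae_norm_le_norm_Lp_top (φ : Lp ℝ ∞ μ) : ∀ᵐ x ∂μ, ‖φ x‖ ≤ ‖φ‖ := by
  have hfin := Lp.eLpNorm_ne_top φ
  filter_upwards [ae_le_eLpNormEssSup (f := φ) (μ := μ)] with x hx
  rw [Lp.norm_def, eLpNorm_exponent_top] at *
  simpa using ENNReal.toReal_mono hfin hx

lemma norm_Lp_top_le {φ : Lp ℝ ∞ μ} {M : ℝ} (hM : 0 ≤ M) (h : ∀ᵐ x ∂μ, ‖φ x‖ ≤ M) : ‖φ‖ ≤ M := by
  rw [Lp.norm_def, eLpNorm_exponent_top]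
  exact ENNReal.toReal_le_of_le_ofReal hM (eLpNormEssSup_le_of_ae_bound h)

lemma memLp_comp_Lp_top {k : ℝ → ℝ} (hk : Continuous k) (φ : Lp ℝ ∞ μ) :
    MemLp (fun x => k (φ x)) ∞ μ := by
  obtain ⟨M, hM⟩ := (isCompact_closedBall (0 : ℝ) ‖φ‖).exists_bound_of_continuousOn hk.continuousOn
  refine memLp_top_of_bound (hk.comp_aestronglyMeasurable (Lp.aestronglyMeasurable φ)) M ?_
  filter_upwards [ae_norm_le_norm_Lp_top φ] with x hx
  exact hM _ (by simpa using hx)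

/-- The superposition operator `φ ↦ k ∘ φ` in `L^∞`. -/
def superposition {k : ℝ → ℝ} (hk : Continuous k) (φ : Lp ℝ ∞ μ) : Lp ℝ ∞ μ :=
  (memLp_comp_Lp_top hk φ).toLp _

lemma coeFn_superposition {k : ℝ → ℝ} (hk : Continuous k) (φ : Lp ℝ ∞ μ) :
    superposition hk φ =ᵐ[μ] fun x => k (φ x) :=
  MemLp.coeFn_toLp _

/-- Uniform continuity on `[-R, R]`. With `R = ‖φ‖ + 1` this interval contains almost all values of
every `ψ` within distance `1` of `φ`. -/
lemma exists_modulus {k : ℝ → ℝ} (hk : Continuous k) (R : ℝ) {ε : ℝ} (hε : 0 < ε) :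
    ∃ δ > 0, ∀ s t : ℝ, ‖s‖ ≤ R → ‖t‖ ≤ R → dist s t < δ → dist (k s) (k t) < ε := by
  have huc := (isCompact_closedBall (0 : ℝ) R).uniformContinuousOn_of_continuous hk.continuousOn
  obtain ⟨δ, hδ, h⟩ := Metric.uniformContinuousOn_iff.1 huc ε hε
  exact ⟨δ, hδ, fun s t hs ht => h s (by simpa using hs) t (by simpa using ht)⟩

lemma continuous_superposition {k : ℝ → ℝ} (hk : Continuous k) :
    Continuous (superposition (μ := μ) hk) := by
  rw [Metric.continuous_iff]
  intro φ ε hε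
  obtain ⟨δ, hδ, h⟩ := exists_modulus hk (‖φ‖ + 1) (half_pos hε)
  refine ⟨min δ 1, lt_min hδ one_pos, fun ψ hψ => ?_⟩
  rw [dist_eq_norm] at hψ ⊢
  refine lt_of_le_of_lt (norm_Lp_top_le (half_pos hε).le ?_) (half_lt_self hε)
  filter_upwards [coeFn_superposition hk φ, coeFn_superposition hk ψ,
    Lp.coeFn_sub (superposition hk ψ) (superposition hk φ), Lp.coeFn_sub ψ φ,
    ae_norm_le_norm_Lp_top φ, ae_norm_le_norm_Lp_top (ψ - φ)] with x h1 h2 h3 h4 h5 h6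
  rw [h3, Pi.sub_apply, h1, h2, ← dist_eq_norm]
  rw [h4, Pi.sub_apply] at h6
  have h7 := h6.trans_lt hψ
  refine (h _ _ ?_ (by linarith) (by rw [dist_eq_norm]; exact h7.trans_le (min_le_left _ _))).le
  have h8 : ‖ψ x‖ ≤ ‖φ x‖ + ‖ψ x - φ x‖ := norm_le_norm_add_norm_sub' _ _
  linarith [h7.trans_le (min_le_right δ 1)]

variable (μ) in
/-- The multiplication of `L^∞`. -/
def mulTop : Lp ℝ ∞ μ →L[ℝ] Lp ℝ ∞ μ →L[ℝ] Lp ℝ ∞ μ :=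
  (ContinuousLinearMap.mul ℝ ℝ).holderL μ ∞ ∞ ∞

lemma coeFn_mulTop (φ ψ : Lp ℝ ∞ μ) : mulTop μ φ ψ =ᵐ[μ] fun x => φ x * ψ x :=
  (ContinuousLinearMap.mul ℝ ℝ).coeFn_holder φ ψ

/-- The mean value inequality, applied at almost every `x` to `s ↦ k s - k'(φ x) s` between `φ x`
and `ψ x`, bounds the remainder by `ε |ψ x - φ x|`. Closeness in `L^∞` makes the oscillation of `k'`
small uniformly in `x`. -/
lemma hasFDerivAt_superposition {k : ℝ → ℝ} (hk : ContDiff ℝ 1 k) (φ : Lp ℝ ∞ μ) :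
    HasFDerivAt (superposition hk.continuous)
      (mulTop μ (superposition (hk.continuous_deriv le_rfl) φ)) φ := by
  have hk' := hk.continuous_deriv le_rfl
  rw [hasFDerivAt_iff_isLittleO, Asymptotics.isLittleO_iff]
  intro ε hε
  obtain ⟨δ, hδ, h⟩ := exists_modulus hk' (‖φ‖ + 1) hε
  filter_upwards [Metric.ball_mem_nhds φ (lt_min hδ one_pos)] with ψ hψ
  rw [Metric.mem_ball, dist_eq_norm] at hψ
  refine norm_Lp_top_le (by positivity) ?_
  filter_upwards [coeFn_superposition hk.continuous φ, coeFn_superposition hk.continuous ψ,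
    coeFn_superposition hk' φ, coeFn_mulTop (superposition hk' φ) (ψ - φ),
    Lp.coeFn_sub (superposition hk.continuous ψ - superposition hk.continuous φ)
      (mulTop μ (superposition hk' φ) (ψ - φ)),
    Lp.coeFn_sub (superposition hk.continuous ψ) (superposition hk.continuous φ),
    Lp.coeFn_sub ψ φ, ae_norm_le_norm_Lp_top φ,
    ae_norm_le_norm_Lp_top (ψ - φ)] with x h1 h2 h3 h4 h5 h6 h7 h8 h9
  rw [h5, Pi.sub_apply, h6, Pi.sub_apply, h1, h2, h4, h3]
  rw [h7, Pi.sub_apply] at h9 ⊢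
  have hd : HasDerivAt k (deriv k (φ x)) (φ x) := ((hk.differentiable one_ne_zero) _).hasDerivAt
  have hder : ∀ s, HasDerivAt (fun s => k s - deriv k (φ x) * s) (deriv k s - deriv k (φ x)) s :=
    fun s => (((hk.differentiable one_ne_zero) s).hasDerivAt).sub
      (by simpa using (hasDerivAt_id s).const_mul (deriv k (φ x)))
  have hbound : ∀ s ∈ segment ℝ (φ x) (ψ x), ‖deriv k s - deriv k (φ x)‖ ≤ ε := by
    intro s hs
    have hs1 : ‖s - φ x‖ ≤ ‖ψ x - φ x‖ := norm_sub_le_of_mem_segment hs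
    have hs2 := (hs1.trans h9).trans_lt hψ
    have hs3 : ‖s‖ ≤ ‖φ x‖ + ‖s - φ x‖ := norm_le_norm_add_norm_sub' _ _
    rw [← dist_eq_norm]
    refine (h _ _ ?_ (by linarith) ?_).le
    · linarith [hs2.trans_le (min_le_right δ 1)]
    · rw [dist_eq_norm]; exact hs2.trans_le (min_le_left _ _)
  have := (convex_segment (𝕜 := ℝ) (φ x) (ψ x)).norm_image_sub_le_of_norm_hasDerivWithin_le
    (fun s _ => (hder s).hasDerivWithinAt) hbound (left_mem_segment ℝ _ _)
    (right_mem_segment ℝ _ _)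
  refine le_trans (le_of_eq ?_) (this.trans (mul_le_mul_of_nonneg_left h9 hε.le))
  congr 1
  ring

end Superposition

/-! ### Weighted forms on `L²` and their pull-backs -/

section Forms

variable {α : Type*} {m : MeasurableSpace α} {μ : Measure α}
  {F : Type*} [NormedAddCommGroup F] [InnerProductSpace ℝ F]

variable (μ F) in
/-- The form `∫ ρ ⟪f, g⟫` on `L²`, as a linear function of the weight `ρ`. -/
def weightedForm : Lp ℝ ∞ μ →L[ℝ] Lp F 2 μ →L[ℝ] Lp F 2 μ →L[ℝ] ℝ :=
  (ContinuousLinearMap.compL ℝ (Lp F 2 μ) (Lp F 2 μ) (Lp F 2 μ →L[ℝ] ℝ) (innerSL ℝ)).comp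
    ((ContinuousLinearMap.lsmul ℝ ℝ).holderL μ ∞ 2 2)

lemma weightedForm_apply (ρ : Lp ℝ ∞ μ) (f g : Lp F 2 μ) :
    weightedForm μ F ρ f g = ∫ x, ρ x * inner ℝ (f x) (g x) ∂μ := by
  change inner ℝ ((ContinuousLinearMap.lsmul ℝ ℝ).holder 2 ρ f) g = _
  rw [L2.inner_def]
  refine integral_congr_ae ?_
  filter_upwards [(ContinuousLinearMap.lsmul ℝ ℝ).coeFn_holder (r := 2) ρ f] with x hx
  rw [hx]
  simp [real_inner_smul_left]

variable {V H : Type*} [NormedAddCommGroup V] [NormedSpace ℝ V] [NormedAddCommGroup H]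
  [NormedSpace ℝ H]

/-- The pull-back of bilinear forms along a linear map. -/
def pullForm (J : V →L[ℝ] H) : (H →L[ℝ] H →L[ℝ] ℝ) →L[ℝ] V →L[ℝ] V →L[ℝ] ℝ :=
  (ContinuousLinearMap.compL ℝ V (H →L[ℝ] ℝ) (V →L[ℝ] ℝ)
    ((ContinuousLinearMap.compL ℝ V H ℝ).flip J)).comp
    ((ContinuousLinearMap.compL ℝ V H (H →L[ℝ] ℝ)).flip J)

/-- As a map into the dual, the pull-back sends `u` to `B (J u) ∘ J`: a bounded map after the
compact map `J`. -/
lemma isCompactOperator_pullForm {J : V →L[ℝ] H} (hJ : IsCompactOperator J)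
    (B : H →L[ℝ] H →L[ℝ] ℝ) : IsCompactOperator (pullForm J B) := by
  have := hJ.clm_comp (((ContinuousLinearMap.compL ℝ V H ℝ).flip J).comp B)
  convert! this

end Forms

end

noncomputable section

variable {d : ℕ}

/-! ### The space `H¹(Ω)` and test functions -/

section SobolevBasics

variable {Ω : Set (E d)}

variable (Ω) in
/-- The map `u ↦ u` from `H¹(Ω)` to `L²(Ω)`. -/
def sobFnL : H1 Ω →L[ℝ] Lp ℝ 2 (volume.restrict Ω) := (WithLp.fstL 2 ℝ _ _).comp (H1 Ω).subtypeL

variable (Ω) in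
/-- The map `u ↦ ∇u` from `H¹(Ω)` to `L²(Ω; ℝᵈ)`. -/
def sobGradL : H1 Ω →L[ℝ] Lp (E d) 2 (volume.restrict Ω) :=
  (WithLp.sndL 2 ℝ _ _).comp (H1 Ω).subtypeL

lemma sobFnL_apply (u : H1 Ω) : sobFnL Ω u = sobFn u := rfl

lemma norm_sq_H1 (u : H1 Ω) : ‖u‖ ^ 2 = ‖sobFn u‖ ^ 2 + ‖sobGrad u‖ ^ 2 :=
  WithLp.prod_norm_sq_eq_of_L2 u.1

lemma IsTestFunction.memLp_smul_const {ζ : E d → ℝ} (h : IsTestFunction Ω ζ) (v : E d) :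
    MemLp (fun x => ζ x • v) 2 (volume.restrict Ω) :=
  (h.smooth.continuous.smul continuous_const).memLp_of_hasCompactSupport
    (h.compact.smul_right (f' := fun _ => v))

/-- For each test function and direction, the defining identity of the weak gradient compares scalar
products of the pair with two fixed elements of `L²`. -/
lemma isClosed_H1 : IsClosed (H1 Ω : Set (L2Pair Ω)) := by
  have hset : (H1 Ω : Set (L2Pair Ω)) = ⋂ (ζ : E d → ℝ) (hζ : IsTestFunction Ω ζ) (v : E d),
      {p : L2Pair Ω | inner ℝ ((hζ.memLp_fderiv v).toLp _) p.fst
        = - inner ℝ ((hζ.memLp_smul_const v).toLp _) p.snd} := by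
    ext p
    simp only [mem_iInter, mem_ofPred_eq]
    refine forall₃_congr fun ζ hζ v => ?_
    have h1 : inner ℝ ((hζ.memLp_fderiv v).toLp _) p.fst = ∫ x in Ω, p.fst x * fderiv ℝ ζ x v := by
      rw [L2.inner_def]
      refine integral_congr_ae ?_
      filter_upwards [(hζ.memLp_fderiv v).coeFn_toLp] with x hx
      rw [hx]; rfl
    have h2 : inner ℝ ((hζ.memLp_smul_const v).toLp _) p.snd
        = ∫ x in Ω, inner ℝ (p.snd x) v * ζ x := by
      rw [L2.inner_def]
      refine integral_congr_ae ?_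
      filter_upwards [(hζ.memLp_smul_const v).coeFn_toLp] with x hx
      rw [hx, real_inner_smul_left, real_inner_comm, mul_comm]
    rw [h1, h2]
  rw [hset]
  refine isClosed_iInter fun ζ => isClosed_iInter fun hζ => isClosed_iInter fun v => ?_
  refine isClosed_eq ?_ ?_
  · exact continuous_const.inner (WithLp.fstL 2 ℝ _ _).continuous
  · exact (continuous_const.inner (WithLp.sndL 2 ℝ _ _).continuous).neg

instance : CompleteSpace (H1 Ω) := isClosed_H1.completeSpace_coe

instance : CompleteSpace (H10 Ω) :=
  (Submodule.isClosed_topologicalClosure (testSubspace Ω)).completeSpace_coe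

lemma IsTestFunction.eq_zero {ζ : E d → ℝ} (h : IsTestFunction Ω ζ) {x : E d} (hx : x ∉ Ω) :
    ζ x = 0 := image_eq_zero_of_notMem_tsupport fun hx' => hx (h.support hx')

lemma IsTestFunction.fderiv_eq_zero {ζ : E d → ℝ} (h : IsTestFunction Ω ζ) {x : E d}
    (hx : x ∉ Ω) : fderiv ℝ ζ x = 0 := by
  have hx' : x ∉ tsupport ζ := fun hx' => hx (h.support hx')
  exact Function.notMem_support.1 fun h' => hx' (support_fderiv_subset ℝ h')

lemma IsTestFunction.setIntegral_mul {ζ : E d → ℝ} (h : IsTestFunction Ω ζ) (f : E d → ℝ) :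
    ∫ x in Ω, f x * ζ x = ∫ x, f x * ζ x :=
  setIntegral_eq_integral_of_forall_compl_eq_zero fun x hx => by rw [h.eq_zero hx, mul_zero]

lemma integral_mul_fderiv_testFunction {f ζ : E d → ℝ} (hf : ContDiff ℝ ∞ f)
    (h : IsTestFunction Ω ζ) (v : E d) :
    ∫ x in Ω, f x * fderiv ℝ ζ x v = - ∫ x in Ω, fderiv ℝ f x v * ζ x := by
  have hζ' : HasCompactSupport fun x => fderiv ℝ ζ x v := h.compact.fderiv_apply ℝ v
  have hc : Continuous fun x => fderiv ℝ ζ x v :=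
    (h.smooth.continuous_fderiv (by simp)).clm_apply continuous_const
  have hcf : Continuous fun x => fderiv ℝ f x v :=
    (hf.continuous_fderiv (by simp)).clm_apply continuous_const
  rw [h.setIntegral_mul, setIntegral_eq_integral_of_forall_compl_eq_zero
    fun x hx => by rw [h.fderiv_eq_zero hx]; simp]
  refine integral_mul_fderiv_eq_neg_fderiv_mul_of_integrable ?_ ?_ ?_
    (fun x _ => (hf.differentiable (by simp)) x) (fun x _ => (h.smooth.differentiable (by simp)) x)
  · exact (hcf.mul h.smooth.continuous).integrable_of_hasCompactSupport h.compact.mul_left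
  · exact (hf.continuous.mul hc).integrable_of_hasCompactSupport hζ'.mul_left
  · exact (hf.continuous.mul h.smooth.continuous).integrable_of_hasCompactSupport h.compact.mul_left

/-- A smooth function with square integrable gradient as an element of `H¹(Ω)`. -/
lemma exists_H1_of_contDiff {f : E d → ℝ} (hf : ContDiff ℝ ∞ f)
    (h : MemLp f 2 (volume.restrict Ω)) (h' : MemLp (gradient f) 2 (volume.restrict Ω)) :
    ∃ u : H1 Ω, sobFn u =ᵐ[volume.restrict Ω] f ∧ sobGrad u =ᵐ[volume.restrict Ω] gradient f := by
  refine ⟨⟨WithLp.toLp 2 (h.toLp f, h'.toLp _), ?_⟩, h.coeFn_toLp, h'.coeFn_toLp⟩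
  refine isWeakGradient_congr (h.coeFn_toLp (f := f)).symm (h'.coeFn_toLp).symm ?_
  intro ζ hζ v
  rw [integral_mul_fderiv_testFunction hf hζ v]
  simp [gradient, InnerProductSpace.toDual_symm_apply]

/-- Test functions are dense in `L²`. -/
lemma norm_le_of_forall_testFunction {U : Set (E d)} (hU : IsOpen U)
    (f : Lp ℝ 2 (volume.restrict U)) {M : ℝ} (hM : 0 ≤ M)
    (h : ∀ ζ (hζ : IsTestFunction U ζ), |∫ x in U, f x * ζ x| ≤ M * ‖hζ.memLp.toLp ζ‖) :
    ‖f‖ ≤ M := by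
  let T : Submodule ℝ (Lp ℝ 2 (volume.restrict U)) := Submodule.span ℝ
    {g | ∃ ζ, ∃ hζ : IsTestFunction U ζ, g = hζ.memLp.toLp ζ}
  have hinner : ∀ (g : Lp ℝ 2 (volume.restrict U)) ζ (hζ : IsTestFunction U ζ),
      inner ℝ g (hζ.memLp.toLp ζ) = ∫ x in U, g x * ζ x := by
    intro g ζ hζ
    rw [L2.inner_def]
    refine integral_congr_ae ?_
    filter_upwards [hζ.memLp.coeFn_toLp] with x hx
    rw [hx]
    exact mul_comm _ _
  have hTrep : ∀ g ∈ T, ∃ ζ, ∃ hζ : IsTestFunction U ζ, g = hζ.memLp.toLp ζ := by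
    intro g hg
    induction hg using Submodule.span_induction with
    | mem g hg => exact hg
    | zero =>
      exact ⟨0, ⟨contDiff_const, HasCompactSupport.zero, by simp [tsupport]⟩, rfl⟩
    | add g g' _ _ h1 h2 =>
      obtain ⟨ζ, hζ, rfl⟩ := h1
      obtain ⟨ξ, hξ, rfl⟩ := h2
      exact ⟨ζ + ξ, ⟨hζ.smooth.add hξ.smooth, hζ.compact.add hξ.compact,
        (tsupport_add ζ ξ).trans (union_subset hζ.support hξ.support)⟩, rfl⟩
    | smul t g _ h1 =>
      obtain ⟨ζ, hζ, rfl⟩ := h1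
      exact ⟨t • ζ, ⟨contDiff_const.smul hζ.smooth, hζ.compact.smul_left (f := fun _ => t),
        (closure_mono (Function.support_const_smul_subset t ζ)).trans hζ.support⟩, rfl⟩
  -- A function orthogonal to all test functions vanishes by the fundamental lemma of the calculus
  -- of variations. The assumed bound therefore extends from test functions to all of `L²`, and is
  -- finally used with `f` itself.
  have hdense : T.topologicalClosure = ⊤ := by
    rw [Submodule.topologicalClosure_eq_top_iff, Submodule.eq_bot_iff]
    intro g hg
    have hint : LocallyIntegrableOn g U volume :=
      locallyIntegrableOn_of_locallyIntegrable_restrict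
        ((Lp.memLp g).locallyIntegrable (by norm_num))
    have h0 := hU.ae_eq_zero_of_integral_contDiff_smul_eq_zero hint fun ζ h1 h2 h3 => by
      have hζ : IsTestFunction U ζ := ⟨h1, h2, h3⟩
      have := (Submodule.mem_orthogonal' _ _).1 hg _ (Submodule.subset_span ⟨ζ, hζ, rfl⟩)
      rw [hinner _ _ hζ, hζ.setIntegral_mul] at this
      simpa [mul_comm] using this
    rw [Lp.eq_zero_iff_ae_eq_zero]
    exact (ae_restrict_iff' hU.measurableSet).2 h0
  have hcl : IsClosed {g : Lp ℝ 2 (volume.restrict U) | |inner ℝ f g| ≤ M * ‖g‖} :=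
    isClosed_le (by fun_prop) (by fun_prop)
  have hsub : (T : Set (Lp ℝ 2 (volume.restrict U))) ⊆ {g | |inner ℝ f g| ≤ M * ‖g‖} := by
    intro g hg
    obtain ⟨ζ, hζ, rfl⟩ := hTrep g hg
    rw [mem_ofPred_eq, hinner _ _ hζ]
    exact h ζ hζ
  have hall := hcl.closure_subset_iff.2 hsub
  have hf : f ∈ closure (T : Set (Lp ℝ 2 (volume.restrict U))) := by
    rw [← Submodule.topologicalClosure_coe, hdense]
    trivial
  have := hall hf
  simp only [mem_ofPred_eq, real_inner_self_eq_norm_sq, abs_of_nonneg (sq_nonneg ‖f‖)] at this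
  rcases eq_or_ne f 0 with rfl | h0
  · simpa using hM
  · have : 0 < ‖f‖ := norm_pos_iff.2 h0
    nlinarith

end SobolevBasics

end

noncomputable section

variable {d : ℕ}

/-! ### Translation estimates in `H¹(Ω)` -/

section Translation

variable {Ω U : Set (E d)}

lemma lintegral_enorm_sq_eq {α F : Type*} {m : MeasurableSpace α} {μ : Measure α}
    [NormedAddCommGroup F] (f : α → F) : ∫⁻ x, ‖f x‖ₑ ^ 2 ∂μ = eLpNorm f 2 μ ^ 2 := by
  have := eLpNorm_nnreal_pow_eq_lintegral (f := f) (μ := μ) (p := 2) (by norm_num)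
  simpa using this.symm

lemma eLpNorm_comp_add_le (hΩ : MeasurableSet Ω) (hU : MeasurableSet U) (f : E d → ℝ)
    {h : E d} (hUh : ∀ y ∈ U, y + h ∈ Ω) :
    eLpNorm (fun x => f (x + h)) 2 (volume.restrict U) ≤ eLpNorm f 2 (volume.restrict Ω) := by
  rw [← ENNReal.pow_le_pow_left_iff two_ne_zero, ← lintegral_enorm_sq_eq, ← lintegral_enorm_sq_eq,
    ← lintegral_indicator hU, ← lintegral_indicator hΩ,
    ← lintegral_add_right_eq_self (μ := volume) (Ω.indicator fun x => ‖f x‖ₑ ^ 2) h]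
  refine lintegral_mono fun x => ?_
  by_cases hx : x ∈ U
  · rw [indicator_of_mem hx, indicator_of_mem (hUh x hx)]
  · rw [indicator_of_notMem hx]
    exact zero_le

lemma IsTestFunction.translate {ψ : E d → ℝ} (hψ : IsTestFunction U ψ) {k : E d}
    (hk : ∀ y ∈ U, y + k ∈ Ω) : IsTestFunction Ω fun y => ψ (y - k) := by
  have hts : tsupport (fun y => ψ (y - k)) = (fun y => y - k) ⁻¹' tsupport ψ :=
    tsupport_comp_eq_preimage ψ (Homeomorph.subRight k)
  refine ⟨hψ.smooth.comp (contDiff_id.sub contDiff_const),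
    hψ.compact.comp_homeomorph (Homeomorph.subRight k), ?_⟩
  rw [hts]
  intro y hy
  simpa using hk _ (hψ.support hy)

lemma abs_integral_grad_mul_le (u : H1 Ω) {ζ : E d → ℝ} (hζ : IsTestFunction Ω ζ) (h : E d) :
    |∫ x in Ω, inner ℝ (sobGrad u x) h * ζ x| ≤ ‖h‖ * ‖sobGrad u‖ * ‖hζ.memLp.toLp ζ‖ := by
  have h1 : ∫ x in Ω, inner ℝ (sobGrad u x) h * ζ x
      = inner ℝ ((hζ.memLp_smul_const h).toLp _) (sobGrad u) := by
    rw [L2.inner_def]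
    refine integral_congr_ae ?_
    filter_upwards [(hζ.memLp_smul_const h).coeFn_toLp] with x hx
    rw [hx, real_inner_smul_left, real_inner_comm, mul_comm]
  have h2 : ‖(hζ.memLp_smul_const h).toLp _‖ ≤ ‖h‖ * ‖hζ.memLp.toLp ζ‖ := by
    refine Lp.norm_le_mul_norm_of_ae_le_mul ?_
    filter_upwards [(hζ.memLp_smul_const h).coeFn_toLp, hζ.memLp.coeFn_toLp] with x hx hx'
    rw [hx, hx', norm_smul, mul_comm]
  rw [h1]
  calc _ ≤ _ := abs_real_inner_le_norm _ _
    _ ≤ _ := mul_le_mul_of_nonneg_right h2 (norm_nonneg _)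
    _ = _ := by ring

lemma norm_toLp_translate_le (hΩ : IsOpen Ω) (hU : IsOpen U) {ψ : E d → ℝ}
    (hψ : IsTestFunction U ψ) {k : E d} (hk : ∀ y ∈ U, y + k ∈ Ω) :
    ‖(hψ.translate hk).memLp.toLp _‖ ≤ ‖hψ.memLp.toLp ψ‖ := by
  rw [Lp.norm_toLp, Lp.norm_toLp]
  refine ENNReal.toReal_mono hψ.memLp.eLpNorm_ne_top ?_
  rw [← ENNReal.pow_le_pow_left_iff two_ne_zero, ← lintegral_enorm_sq_eq, ← lintegral_enorm_sq_eq,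
    ← lintegral_indicator hΩ.measurableSet, ← lintegral_indicator hU.measurableSet,
    ← lintegral_sub_right_eq_self (μ := volume) (U.indicator fun x => ‖ψ x‖ₑ ^ 2) k]
  refine lintegral_mono fun x => ?_
  refine (indicator_le_self' (fun _ _ => zero_le) x).trans ?_
  by_cases hx : x - k ∈ U
  · rw [indicator_of_mem hx]
  · simp [hψ.eq_zero hx]

/-- The weak form of `u (x + h) - u x = ∫₀¹ ∇u (x + t h) ⬝ h dt`. -/
lemma abs_integral_translate_sub_le (hΩ : IsOpen Ω) (hb : Bornology.IsBounded Ω) (hU : IsOpen U)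
    (u : H1 Ω) {h : E d} (hUh : ∀ y ∈ U, ∀ t ∈ Icc (0 : ℝ) 1, y + t • h ∈ Ω) {ψ : E d → ℝ}
    (hψ : IsTestFunction U ψ) :
    |(∫ y in Ω, sobFn u y * ψ (y - h)) - ∫ y in Ω, sobFn u y * ψ y|
      ≤ ‖h‖ * ‖sobGrad u‖ * ‖hψ.memLp.toLp ψ‖ := by
  have hfin : IsFiniteMeasure (volume.restrict Ω) :=
    isFiniteMeasure_restrict.2 hb.measure_lt_top.ne
  have hint : Integrable (sobFn u) (volume.restrict Ω) :=
    (Lp.memLp (sobFn u)).integrable (by norm_num)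
  have hψ'c : Continuous (fderiv ℝ ψ) := hψ.smooth.continuous_fderiv (by simp)
  obtain ⟨M, hM⟩ := (hψ.compact.fderiv ℝ).exists_bound_of_continuous hψ'c
  obtain ⟨M', hM'⟩ := hψ.compact.exists_bound_of_continuous hψ.smooth.continuous
  have hd : ∀ t : ℝ, HasDerivAt (fun t => ∫ y in Ω, sobFn u y * ψ (y - t • h))
      (∫ y in Ω, sobFn u y * (- fderiv ℝ ψ (y - t • h) h)) t := by
    intro t
    refine (hasDerivAt_integral_of_dominated_loc_of_deriv_le (μ := volume.restrict Ω)
      (s := univ) (bound := fun y => ‖sobFn u y‖ * (M * ‖h‖)) (x₀ := t)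
      (F := fun t y => sobFn u y * ψ (y - t • h))
      (F' := fun t y => sobFn u y * (- fderiv ℝ ψ (y - t • h) h)) univ_mem ?_ ?_ ?_ ?_ ?_ ?_).2
    · refine Eventually.of_forall fun t => hint.aestronglyMeasurable.mul ?_
      exact (hψ.smooth.continuous.comp (by fun_prop)).aestronglyMeasurable
    · refine hint.mul_bdd (c := M') ?_ (Eventually.of_forall fun y => hM' _)
      exact (hψ.smooth.continuous.comp (by fun_prop)).aestronglyMeasurable
    · refine hint.aestronglyMeasurable.mul ?_
      exact (((hψ'c.comp (by fun_prop)).clm_apply continuous_const).neg).aestronglyMeasurable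
    · refine Eventually.of_forall fun y s _ => ?_
      rw [norm_mul, norm_neg]
      refine mul_le_mul_of_nonneg_left ?_ (norm_nonneg _)
      exact (ContinuousLinearMap.le_opNorm _ _).trans
        (mul_le_mul_of_nonneg_right (hM _) (norm_nonneg _))
    · exact hint.norm.mul_const _
    · refine Eventually.of_forall fun y s _ => ?_
      have h1 : HasDerivAt (fun s : ℝ => y - s • h) (-h) s := by
        simpa using ((hasDerivAt_id s).smul_const h).const_sub y
      have h2 := ((hψ.smooth.differentiable (by simp)) (y - s • h)).hasFDerivAt.comp_hasDerivAt s h1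
      rw [map_neg] at h2
      exact h2.const_mul _
  -- As `U + t h ⊆ Ω`, the translate `ψ (· - t h)` is a test function in `Ω`, and the weak gradient
  -- takes over the derivative.
  have hbound : ∀ t ∈ Ico (0 : ℝ) 1,
      ‖∫ y in Ω, sobFn u y * (- fderiv ℝ ψ (y - t • h) h)‖
        ≤ ‖h‖ * ‖sobGrad u‖ * ‖hψ.memLp.toLp ψ‖ := by
    intro t ht
    have hk : ∀ y ∈ U, y + t • h ∈ Ω := fun y hy => hUh y hy t ⟨ht.1, ht.2.le⟩
    have hζ := hψ.translate hk
    have hfd : ∀ y, fderiv ℝ (fun y => ψ (y - t • h)) y = fderiv ℝ ψ (y - t • h) := fun y =>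
      fderiv_comp_sub (f := ψ) (t • h)
    have h1 : ∫ y in Ω, sobFn u y * fderiv ℝ (fun y => ψ (y - t • h)) y h
        = - ∫ y in Ω, inner ℝ (sobGrad u y) h * ψ (y - t • h) := u.2 _ hζ h
    simp only [hfd] at h1
    simp only [mul_neg, integral_neg, h1, neg_neg]
    refine (abs_integral_grad_mul_le u hζ h).trans ?_
    exact mul_le_mul_of_nonneg_left (norm_toLp_translate_le hΩ hU hψ hk) (by positivity)
  have := norm_image_sub_le_of_norm_deriv_le_segment_01'
    (fun t _ => (hd t).hasDerivWithinAt) hbound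
  simpa using this

/-- The translation estimate in `H¹`. -/
lemma lintegral_translate_sub_sq_le (hΩ : IsOpen Ω) (hb : Bornology.IsBounded Ω) (hU : IsOpen U)
    (u : H1 Ω) {h : E d} (hUh : ∀ y ∈ U, ∀ t ∈ Icc (0 : ℝ) 1, y + t • h ∈ Ω) :
    ∫⁻ x in U, ‖sobFn u (x + h) - sobFn u x‖ₑ ^ 2
      ≤ ENNReal.ofReal (‖h‖ ^ 2 * ‖sobGrad u‖ ^ 2) := by
  have hf := Lp.stronglyMeasurable (sobFn u)
  have hh : ∀ y ∈ U, y + h ∈ Ω := fun y hy => by simpa using hUh y hy 1 (by simp)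
  have hUΩ : U ⊆ Ω := fun y hy => by simpa using hUh y hy 0 (by simp)
  have m1 : MemLp (fun x => sobFn u (x + h)) 2 (volume.restrict U) :=
    ⟨(hf.comp_measurable (measurable_add_const h)).aestronglyMeasurable,
      (eLpNorm_comp_add_le hΩ.measurableSet hU.measurableSet _ hh).trans_lt
        (Lp.memLp (sobFn u)).eLpNorm_lt_top⟩
  have m2 : MemLp (sobFn u) 2 (volume.restrict U) :=
    (Lp.memLp (sobFn u)).mono_measure (Measure.restrict_mono hUΩ le_rfl)
  have m3 := m1.sub m2
  have key : ‖m3.toLp _‖ ≤ ‖h‖ * ‖sobGrad u‖ := by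
    -- Duality: the `L²(U)` norm of the difference is tested against `ψ`, and the substitution `y =
    -- x + h` moves the translation to `ψ`.
    refine norm_le_of_forall_testFunction hU _ (by positivity) fun ψ hψ => ?_
    refine le_trans (le_of_eq ?_) (abs_integral_translate_sub_le hΩ hb hU u hUh hψ)
    have hψΩ : IsTestFunction Ω ψ := ⟨hψ.smooth, hψ.compact, hψ.support.trans hUΩ⟩
    have hψh : IsTestFunction Ω fun y => ψ (y - h) := hψ.translate hh
    have e1 : ∫ x in U, m3.toLp _ x * ψ x
        = (∫ x in U, sobFn u (x + h) * ψ x) - ∫ x in U, sobFn u x * ψ x := by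
      have i1 : Integrable (fun x => sobFn u (x + h) * ψ x) (volume.restrict U) :=
        m1.integrable_mul hψ.memLp
      have i2 : Integrable (fun x => sobFn u x * ψ x) (volume.restrict U) :=
        m2.integrable_mul hψ.memLp
      rw [← integral_sub i1 i2]
      refine integral_congr_ae ?_
      filter_upwards [m3.coeFn_toLp] with x hx
      rw [hx, Pi.sub_apply, sub_mul]
    rw [e1, hψ.setIntegral_mul, hψ.setIntegral_mul, hψΩ.setIntegral_mul, hψh.setIntegral_mul,
      ← integral_add_right_eq_self (μ := volume) (fun y => sobFn u y * ψ (y - h)) h]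
    simp
  have e2 : eLpNorm (fun x => sobFn u (x + h) - sobFn u x) 2 (volume.restrict U)
      ≤ ENNReal.ofReal (‖h‖ * ‖sobGrad u‖) := by
    rw [Lp.norm_toLp] at key
    exact (ENNReal.le_ofReal_iff_toReal_le m3.eLpNorm_ne_top (by positivity)).2 key
  rw [lintegral_enorm_sq_eq, ← mul_pow, ENNReal.ofReal_pow (by positivity)]
  exact pow_le_pow_left₀ zero_le e2 2

end Translation

end

noncomputable section

variable {d : ℕ}

/-! ### Rellich's theorem on Lipschitz domains -/

section Rellich

/-- A bounded operator on a Hilbert space is compact if it is arbitrarily small on the common kernels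
of finitely many functionals. -/
lemma isCompactOperator_of_forall_finset {V H : Type*} [NormedAddCommGroup V]
    [InnerProductSpace ℝ V] [CompleteSpace V] [NormedAddCommGroup H] [NormedSpace ℝ H]
    [CompleteSpace H] (R : V →L[ℝ] H)
    (h : ∀ ε > 0, ∃ Φ : Finset (V →L[ℝ] ℝ), ∀ u, (∀ f ∈ Φ, f u = 0) → ‖R u‖ ≤ ε * ‖u‖) :
    IsCompactOperator R := by
  have hcl := isClosed_setOfPred_isCompactOperator (σ₁₂ := RingHom.id ℝ) (M₁ := V) (M₂ := H)
  refine hcl.closure_subset (Metric.mem_closure_iff.2 fun ε hε => ?_)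
  obtain ⟨Φ, hΦ⟩ := h (ε / 2) (half_pos hε)
  let r : (V →L[ℝ] ℝ) → V := (InnerProductSpace.toDual ℝ V).symm
  -- `K` is spanned by the Riesz representatives, so the component of `u` orthogonal to `K` lies in
  -- all the kernels. Hence `R` is within `ε / 2` of the finite-rank operator `R ∘ P_K`.
  let K : Submodule ℝ V := Submodule.span ℝ (r '' Φ)
  have hK : FiniteDimensional ℝ K := FiniteDimensional.span_of_finite ℝ (Φ.finite_toSet.image r)
  refine ⟨R.comp K.starProjection, ?_, ?_⟩
  · have h1 : IsCompactOperator (R.comp K.subtypeL) :=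
      isCompactOperator_of_locallyCompactSpace_rng _
    exact h1.comp_clm K.orthogonalProjectionOnto
  · rw [dist_eq_norm]
    refine lt_of_le_of_lt (ContinuousLinearMap.opNorm_le_bound _ (half_pos hε).le fun u => ?_)
      (half_lt_self hε)
    have h2 : (R - R.comp K.starProjection) u = R (u - K.starProjection u) := by simp
    have h3 : u - K.starProjection u ∈ Kᗮ := K.sub_starProjection_mem_orthogonal u
    rw [h2]
    refine (hΦ _ fun f hf => ?_).trans (mul_le_mul_of_nonneg_left ?_ (half_pos hε).le)
    · have := (Submodule.mem_orthogonal _ _).1 h3 (r f) (Submodule.subset_span ⟨f, hf, rfl⟩)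
      rwa [InnerProductSpace.toDual_symm_apply] at this
    · have := Kᗮ.norm_starProjection_apply_le u
      rwa [Submodule.starProjection_orthogonal_val] at this

/-- Near each point of its closure, a Lipschitz domain has the uniform cone property. -/
lemma exists_cone {Ω : Set (E d)} (hΩ : IsOpen Ω) (hL : HasLipschitzBoundary Ω) {x : E d}
    (hx : x ∈ closure Ω) :
    ∃ r > 0, ∃ (e : E d) (κ : ℝ), 0 < κ ∧ ∃ s₀ > 0, ∀ y ∈ Metric.ball x r ∩ Ω,
      ∀ t ∈ Icc (0 : ℝ) s₀, ∀ z ∈ Metric.ball e κ, y + t • z ∈ Ω := by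
  by_cases hxΩ : x ∈ Ω
  · obtain ⟨r, hr, hball⟩ := Metric.isOpen_iff.1 hΩ x hxΩ
    -- At an interior point the cone is a full ball around the origin.
    refine ⟨r / 2, half_pos hr, 0, 1, one_pos, r / 2, half_pos hr, fun y hy t ht z hz => ?_⟩
    refine hball ?_
    have h1 : ‖y - x‖ < r / 2 := by simpa [dist_eq_norm] using hy.1
    have h2 : ‖z‖ < 1 := by simpa using hz
    have h3 : ‖t • z‖ ≤ r / 2 := by
      rw [norm_smul, Real.norm_of_nonneg ht.1]
      calc t * ‖z‖ ≤ (r / 2) * 1 := mul_le_mul ht.2 h2.le (norm_nonneg _) (half_pos hr).le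
        _ = _ := mul_one _
    rw [Metric.mem_ball, dist_eq_norm]
    calc ‖y + t • z - x‖ = ‖(y - x) + t • z‖ := by congr 1; abel
      _ ≤ ‖y - x‖ + ‖t • z‖ := norm_add_le _ _
      _ < r := by linarith
  · have hxf : x ∈ frontier Ω := by
      rw [hΩ.frontier_eq]
      exact ⟨hx, hxΩ⟩
    obtain ⟨r, hr, e, he, K, g, hg, hiff⟩ := hL x hxf
    have hK : (0 : ℝ) < K + 1 := by positivity
    have hκ1 : ((K : ℝ) + 1)⁻¹ ≤ 1 := inv_le_one_of_one_le₀ (by simp)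
    -- For `z = e + w` with `(K + 1) ‖w‖ ≤ 1`, moving by `t z` raises the height by at least `t (1 -
    -- ‖w‖) ≥ t K ‖w‖`, and `g` changes by at most `t K ‖w‖`. The bound `t ≤ r / 4` with `‖z‖ ≤ 2`
    -- keeps the point in the ball.
    refine ⟨r / 2, half_pos hr, e, ((K : ℝ) + 1)⁻¹, inv_pos.2 hK, r / 4, by positivity,
      fun y hy t ht z hz => ?_⟩
    have hze : ‖z - e‖ < ((K : ℝ) + 1)⁻¹ := by simpa [dist_eq_norm] using hz
    have hyx : ‖y - x‖ < r / 2 := by simpa [dist_eq_norm] using hy.1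
    have hz2 : ‖z‖ ≤ 2 := by
      have : ‖z‖ ≤ ‖e‖ + ‖z - e‖ := norm_le_norm_add_norm_sub' _ _
      linarith
    have htz : ‖t • z‖ ≤ r / 2 := by
      rw [norm_smul, Real.norm_of_nonneg ht.1]
      calc t * ‖z‖ ≤ (r / 4) * 2 := mul_le_mul ht.2 hz2 (norm_nonneg _) (by positivity)
        _ = _ := by ring
    have hyb : y ∈ Metric.ball x r := Metric.ball_subset_ball (by linarith) hy.1
    have hyz : y + t • z ∈ Metric.ball x r := by
      rw [Metric.mem_ball, dist_eq_norm]
      calc ‖y + t • z - x‖ = ‖(y - x) + t • z‖ := by congr 1; abel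
        _ ≤ ‖y - x‖ + ‖t • z‖ := norm_add_le _ _
        _ < r := by linarith
    rw [hiff _ hyz]
    have h1 := (hiff y hyb).1 hy.2
    have hee : inner ℝ e e = (1 : ℝ) := by rw [real_inner_self_eq_norm_sq, he]; norm_num
    set w := z - e
    have hzw : z = e + w := by simp [w]
    have hew : |inner ℝ e w| ≤ ‖w‖ := by
      have := abs_real_inner_le_norm e w
      rwa [he, one_mul] at this
    have hin : inner ℝ e (y + t • z) = inner ℝ e y + t * (1 + inner ℝ e w) := by
      rw [hzw, inner_add_right, real_inner_smul_right, inner_add_right, hee]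
    have hproj : (y + t • z - inner ℝ e (y + t • z) • e) - (y - inner ℝ e y • e)
        = t • (w - inner ℝ e w • e) := by
      rw [hin, hzw]
      module
    have hpn : ‖w - inner ℝ e w • e‖ ≤ ‖w‖ := by
      have h4 : ‖w - inner ℝ e w • e‖ ^ 2 = ‖w‖ ^ 2 - (inner ℝ e w) ^ 2 := by
        rw [norm_sub_sq_real, real_inner_smul_right, norm_smul, he, real_inner_comm w e,
          Real.norm_eq_abs, mul_one, sq_abs]
        ring
      refine le_of_sq_le_sq ?_ (norm_nonneg _)
      rw [h4]
      linarith [sq_nonneg (inner ℝ e w)]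
    have hlip := hg.dist_le_mul (y + t • z - inner ℝ e (y + t • z) • e) (y - inner ℝ e y • e)
    rw [dist_eq_norm (y + t • z - inner ℝ e (y + t • z) • e), hproj, norm_smul,
      Real.norm_of_nonneg ht.1, Real.dist_eq] at hlip
    have h5 := (abs_le.1 hlip).2
    have h6 : (K : ℝ) * (t * ‖w - inner ℝ e w • e‖) ≤ t * (K * ‖w‖) := by
      have := mul_le_mul_of_nonneg_left hpn (mul_nonneg ht.1 K.coe_nonneg)
      linarith
    have h7 : (K + 1) * ‖w‖ ≤ 1 := by
      have := mul_le_mul_of_nonneg_left hze.le hK.le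
      rwa [mul_inv_cancel₀ hK.ne'] at this
    have h8 : (K : ℝ) * ‖w‖ ≤ 1 + inner ℝ e w := by linarith [(abs_le.1 hew).1]
    have h9 := mul_le_mul_of_nonneg_left h8 ht.1
    rw [hin] at h5 ⊢
    linarith

/-- A function with mean zero on `Q` satisfies `|Q| c² ≤ ∫_Q (u - c)²`. -/
lemma volume_mul_enorm_sq_le {α : Type*} {m : MeasurableSpace α} {μ : Measure α}
    [IsFiniteMeasure μ] {f : α → ℝ} (hf : MemLp f 2 μ) (h0 : ∫ y, f y ∂μ = 0) (c : ℝ) :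
    μ univ * ‖c‖ₑ ^ 2 ≤ ∫⁻ y, ‖f y - c‖ₑ ^ 2 ∂μ := by
  have hi : Integrable f μ := hf.integrable (by norm_num)
  have hi2 : Integrable (fun y => f y ^ 2) μ := hf.integrable_sq
  have hi3 : Integrable (fun y => (f y - c) ^ 2) μ := (hf.sub (memLp_const c)).integrable_sq
  have he : ∀ a : ℝ, ‖a‖ₑ ^ 2 = ENNReal.ofReal (a ^ 2) := fun a => by
    rw [← ofReal_norm, ← ENNReal.ofReal_pow (norm_nonneg _), Real.norm_eq_abs, sq_abs]
  simp only [he]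
  rw [← ofReal_integral_eq_lintegral_ofReal hi3 (Eventually.of_forall fun y => sq_nonneg _),
    ← ENNReal.ofReal_toReal (measure_ne_top μ univ), ← ENNReal.ofReal_mul ENNReal.toReal_nonneg]
  refine ENNReal.ofReal_le_ofReal ?_
  have h1 : ∫ y, (f y - c) ^ 2 ∂μ = (∫ y, f y ^ 2 ∂μ) + (μ univ).toReal * c ^ 2 := by
    have : ∀ y, (f y - c) ^ 2 = f y ^ 2 + ((-2 * c) * f y + c ^ 2) := fun y => by ring
    have i1 : Integrable (fun y => -2 * c * f y) μ := hi.const_mul _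
    have i2 : Integrable (fun y => -2 * c * f y + c ^ 2) μ := i1.add (integrable_const _)
    simp only [this]
    rw [integral_add hi2 i2, integral_add i1 (integrable_const _), integral_const_mul, h0]
    simp [Measure.real]
  rw [h1]
  linarith [integral_nonneg (μ := μ) (f := fun y => f y ^ 2) fun y => sq_nonneg _]

variable {Ω : Set (E d)}

variable (Ω) in
/-- The functional `u ↦ ∫_{Q ∩ Ω} u` on `H¹(Ω)`. -/
def setIntegralL (hb : Bornology.IsBounded Ω) {Q : Set (E d)} (hQ : MeasurableSet Q) :
    H1 Ω →L[ℝ] ℝ :=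
  (innerSL ℝ (indicatorConstLp 2 hQ
    (ne_top_of_le_ne_top (by simpa using hb.measure_lt_top.ne)
      (measure_mono (subset_univ Q))) (1 : ℝ))).comp (sobFnL Ω)

lemma setIntegralL_apply (hb : Bornology.IsBounded Ω) {Q : Set (E d)} (hQ : MeasurableSet Q)
    (hQΩ : Q ⊆ Ω) (u : H1 Ω) : setIntegralL Ω hb hQ u = ∫ y in Q, sobFn u y := by
  have := L2.inner_indicatorConstLp_one (𝕜 := ℝ) (μ := volume.restrict Ω) hQ
    (ne_top_of_le_ne_top (by simpa using hb.measure_lt_top.ne)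
      (measure_mono (subset_univ Q))) (sobFn u)
  rw [Measure.restrict_restrict hQ, inter_eq_self_of_subset_left hQΩ] at this
  exact this

/-- The pointwise estimate behind the local compactness. -/
lemma volume_ball_mul_enorm_sq_le (u : H1 Ω) {x p : E d} {ρ : ℝ} {v : E d}
    (hxp : x ∈ Metric.ball p ρ) (hQ : Metric.ball (p + v) ρ ⊆ Ω)
    (h0 : ∫ y in Metric.ball (p + v) ρ, sobFn u y = 0) :
    volume (Metric.ball (p + v) ρ) * ‖sobFn u x‖ₑ ^ 2
      ≤ ∫⁻ h in Metric.ball v (2 * ρ), ‖sobFn u (x + h) - sobFn u x‖ₑ ^ 2 := by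
  have hfin : IsFiniteMeasure (volume.restrict (Metric.ball (p + v) ρ)) :=
    isFiniteMeasure_restrict.2 measure_ball_lt_top.ne
  have h1 := volume_mul_enorm_sq_le (μ := volume.restrict (Metric.ball (p + v) ρ))
    ((Lp.memLp (sobFn u)).mono_measure (Measure.restrict_mono hQ le_rfl)) h0 (sobFn u x)
  rw [Measure.restrict_apply_univ] at h1
  refine h1.trans ?_
  rw [← lintegral_indicator measurableSet_ball, ← lintegral_indicator measurableSet_ball,
    ← lintegral_add_left_eq_self (μ := volume)
      ((Metric.ball (p + v) ρ).indicator fun y => ‖sobFn u y - sobFn u x‖ₑ ^ 2) x]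
  refine lintegral_mono fun h => ?_
  by_cases hh : x + h ∈ Metric.ball (p + v) ρ
  · have hv : h ∈ Metric.ball v (2 * ρ) := by
      rw [Metric.mem_ball, dist_eq_norm] at *
      calc ‖h - v‖ = ‖(x + h - (p + v)) - (x - p)‖ := by congr 1; abel
        _ ≤ ‖x + h - (p + v)‖ + ‖x - p‖ := norm_sub_le _ _
        _ < 2 * ρ := by linarith
    rw [indicator_of_mem hh, indicator_of_mem hv]
  · rw [indicator_of_notMem hh]
    exact zero_le

/-- The local estimate in a set with the cone property. -/
lemma exists_finset_lintegral_le_of_cone (hd : 1 ≤ d) (hΩ : IsOpen Ω)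
    (hb : Bornology.IsBounded Ω) {U : Set (E d)} (hU : IsOpen U) (hUΩ : U ⊆ Ω) {e : E d}
    {κ s₀ : ℝ} (hκ : 0 < κ) (hs₀ : 0 < s₀)
    (hcone : ∀ y ∈ U, ∀ t ∈ Icc (0 : ℝ) s₀, ∀ z ∈ Metric.ball e κ, y + t • z ∈ Ω) {ε : ℝ}
    (hε : 0 < ε) :
    ∃ Φ : Finset (H1 Ω →L[ℝ] ℝ), ∀ u, (∀ f ∈ Φ, f u = 0) →
      ∫⁻ x in U, ‖sobFn u x‖ₑ ^ 2 ≤ ENNReal.ofReal (ε * ‖u‖ ^ 2) := by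
  classical
  -- In the final estimate `2 ^ d` is the ratio of the volumes of balls of radii `2ρ` and `ρ`, and
  -- `s (‖e‖ + κ)` bounds the length of the shifts.
  obtain ⟨s, hs, hss, hsε⟩ : ∃ s > 0, s ≤ s₀ ∧ 2 ^ d * (s * (‖e‖ + κ)) ^ 2 ≤ ε := by
    have hc : ContinuousAt (fun s : ℝ => 2 ^ d * (s * (‖e‖ + κ)) ^ 2) 0 := by fun_prop
    have h1 : ∀ᶠ s in 𝓝[>] (0 : ℝ), 2 ^ d * (s * (‖e‖ + κ)) ^ 2 < ε :=
      nhdsWithin_le_nhds (hc.eventually (gt_mem_nhds (by simpa using hε)))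
    obtain ⟨s, h2, h3, h4⟩ := (h1.and (Ioc_mem_nhdsGT hs₀)).exists
    exact ⟨s, h3, h4, h2.le⟩
  -- With this radius the ball of radius `2ρ` around `s e` is the slice `s • ball e κ` of the cone.
  set ρ := κ * s / 2
  have hρ : 0 < ρ := by positivity
  have hscale : ∀ h ∈ Metric.ball (s • e) (2 * ρ), ∃ z ∈ Metric.ball e κ, h = s • z := by
    intro h hh
    refine ⟨s⁻¹ • h, ?_, by rw [smul_inv_smul₀ hs.ne']⟩
    rw [Metric.mem_ball, dist_eq_norm] at *
    have h1 : s⁻¹ • h - e = s⁻¹ • (h - s • e) := by rw [smul_sub, inv_smul_smul₀ hs.ne']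
    rw [h1, norm_smul, norm_inv, Real.norm_of_nonneg hs.le, inv_mul_lt_iff₀ hs]
    calc _ < _ := hh
      _ = s * κ := by simp only [ρ]; ring
  obtain ⟨Z, hZU, hZf, hZ⟩ := Metric.finite_approx_of_totallyBounded
    ((hb.subset hUΩ).isCompact_closure.totallyBounded.subset subset_closure) ρ hρ
  have hball : ∀ p ∈ U, Metric.ball (p + s • e) ρ ⊆ Ω := by
    intro p hp y hy
    obtain ⟨z, hz, hyz⟩ := hscale (y - p) (by
      rw [Metric.mem_ball, dist_eq_norm] at *
      rw [sub_sub]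
      linarith)
    have := hcone p hp s ⟨hs.le, hss⟩ z hz
    rwa [← hyz, add_sub_cancel] at this
  -- The functionals are the integrals over the balls around `p + s e`, for the finitely many
  -- centres `p` of a `ρ`-net of `U`. If they vanish, `u x` is controlled by the differences `u (x +
  -- h) - u x` with `h` in the slice of the cone.
  refine ⟨hZf.toFinset.image fun p => setIntegralL Ω hb
    (measurableSet_ball (x := p + s • e) (ε := ρ)), fun u hu => ?_⟩
  have h0 : ∀ p ∈ Z, ∫ y in Metric.ball (p + s • e) ρ, sobFn u y = 0 := by
    intro p hp
    rw [← setIntegralL_apply hb measurableSet_ball (hball p (hZU hp))]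
    exact hu _ (Finset.mem_image_of_mem _ (hZf.mem_toFinset.2 hp))
  have hnt : Nontrivial (E d) := by
    have : Nonempty (Fin d) := ⟨⟨0, hd⟩⟩
    infer_instance
  have hvol : ∀ (q : E d) (a : ℝ), 0 ≤ a → volume (Metric.ball q a)
      = ENNReal.ofReal (a ^ d) * volume (Metric.ball (0 : E d) 1) := fun q a ha => by
    rw [Measure.addHaar_ball volume q ha, finrank_euclideanSpace_fin]
  have hpt : ∀ x ∈ U, volume (Metric.ball (0 : E d) ρ) * ‖sobFn u x‖ₑ ^ 2
      ≤ ∫⁻ h in Metric.ball (s • e) (2 * ρ), ‖sobFn u (x + h) - sobFn u x‖ₑ ^ 2 := by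
    intro x hx
    obtain ⟨p, hp, hxp⟩ := mem_iUnion₂.1 (hZ hx)
    have := volume_ball_mul_enorm_sq_le u hxp (hball p (hZU hp)) (h0 p hp)
    rwa [hvol _ _ hρ.le, ← hvol 0 _ hρ.le] at this
  have htr : ∀ h ∈ Metric.ball (s • e) (2 * ρ),
      ∫⁻ x in U, ‖sobFn u (x + h) - sobFn u x‖ₑ ^ 2
        ≤ ENNReal.ofReal ((s * (‖e‖ + κ)) ^ 2 * ‖u‖ ^ 2) := by
    intro h hh
    obtain ⟨z, hz, rfl⟩ := hscale h hh
    refine (lintegral_translate_sub_sq_le hΩ hb hU u fun y hy t ht => ?_).trans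
      (ENNReal.ofReal_le_ofReal ?_)
    · rw [smul_smul]
      refine hcone y hy _ ⟨mul_nonneg ht.1 hs.le, ?_⟩ z hz
      exact (mul_le_of_le_one_left hs.le ht.2).trans hss
    · have h1 : ‖z‖ ≤ ‖e‖ + κ := by
        have h2 : ‖z‖ ≤ ‖e‖ + ‖z - e‖ := norm_le_norm_add_norm_sub' _ _
        have h3 : ‖z - e‖ < κ := by simpa [dist_eq_norm] using hz
        linarith
      have h2 : ‖s • z‖ ≤ s * (‖e‖ + κ) := by
        rw [norm_smul, Real.norm_of_nonneg hs.le]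
        exact mul_le_mul_of_nonneg_left h1 hs.le
      have h3 : ‖sobGrad u‖ ^ 2 ≤ ‖u‖ ^ 2 := by
        rw [norm_sq_H1]
        linarith [sq_nonneg ‖sobFn u‖]
      exact mul_le_mul (pow_le_pow_left₀ (norm_nonneg _) h2 2) h3 (sq_nonneg _) (sq_nonneg _)
  have hmeas : Measurable (sobFn u) := (Lp.stronglyMeasurable (sobFn u)).measurable
  -- The pointwise bound is integrated over `U`, the integrals are exchanged, and the translation
  -- estimate is applied for each fixed shift `h`.
  have key : volume (Metric.ball (0 : E d) ρ) * ∫⁻ x in U, ‖sobFn u x‖ₑ ^ 2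
      ≤ volume (Metric.ball (0 : E d) ρ) * ENNReal.ofReal (ε * ‖u‖ ^ 2) := by
    calc volume (Metric.ball (0 : E d) ρ) * ∫⁻ x in U, ‖sobFn u x‖ₑ ^ 2
        = ∫⁻ x in U, volume (Metric.ball (0 : E d) ρ) * ‖sobFn u x‖ₑ ^ 2 := by
          rw [lintegral_const_mul]
          exact hmeas.enorm.pow_const 2
      _ ≤ ∫⁻ x in U, ∫⁻ h in Metric.ball (s • e) (2 * ρ),
            ‖sobFn u (x + h) - sobFn u x‖ₑ ^ 2 :=
          setLIntegral_mono' hU.measurableSet hpt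
      _ = ∫⁻ h in Metric.ball (s • e) (2 * ρ), ∫⁻ x in U,
            ‖sobFn u (x + h) - sobFn u x‖ₑ ^ 2 := by
          refine lintegral_lintegral_swap (Measurable.aemeasurable ?_)
          exact (((hmeas.comp (measurable_fst.add measurable_snd)).sub
            (hmeas.comp measurable_fst)).enorm.pow_const 2)
      _ ≤ ∫⁻ _ in Metric.ball (s • e) (2 * ρ),
            ENNReal.ofReal ((s * (‖e‖ + κ)) ^ 2 * ‖u‖ ^ 2) :=
          setLIntegral_mono' measurableSet_ball htr
      _ = volume (Metric.ball (0 : E d) ρ)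
            * ENNReal.ofReal (2 ^ d * (s * (‖e‖ + κ)) ^ 2 * ‖u‖ ^ 2) := by
          rw [setLIntegral_const, hvol _ (2 * ρ) (by positivity), hvol 0 ρ hρ.le, mul_pow 2 ρ,
            mul_assoc (2 ^ d : ℝ), ENNReal.ofReal_mul (p := 2 ^ d) (by positivity),
            ENNReal.ofReal_mul (p := 2 ^ d) (by positivity)]
          ring
      _ ≤ _ := by
          gcongr
  exact (ENNReal.mul_le_mul_iff_right (Metric.measure_ball_pos volume _ hρ).ne'
    measure_ball_lt_top.ne).1 key

/-- The property passes to subsets and finite unions and holds near every point of the closure by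
the cone property; compactness makes it global. -/
lemma exists_finset_lintegral_le (hd : 1 ≤ d) (hΩ : IsBoundedLipschitzDomain Ω) :
    ∀ ε > 0, ∃ Φ : Finset (H1 Ω →L[ℝ] ℝ), ∀ u, (∀ f ∈ Φ, f u = 0) →
      ∫⁻ x in closure Ω ∩ Ω, ‖sobFn u x‖ₑ ^ 2 ≤ ENNReal.ofReal (ε * ‖u‖ ^ 2) := by
  classical
  refine hΩ.isBounded.isCompact_closure.induction_on (p := fun s => ∀ ε > 0,
    ∃ Φ : Finset (H1 Ω →L[ℝ] ℝ), ∀ u, (∀ f ∈ Φ, f u = 0) →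
      ∫⁻ x in s ∩ Ω, ‖sobFn u x‖ₑ ^ 2 ≤ ENNReal.ofReal (ε * ‖u‖ ^ 2)) ?_ ?_ ?_ ?_
  · exact fun ε _ => ⟨∅, fun u _ => by simp⟩
  · intro s t hst ht ε hε
    obtain ⟨Φ, hΦ⟩ := ht ε hε
    exact ⟨Φ, fun u hu => (lintegral_mono_set (inter_subset_inter_left Ω hst)).trans (hΦ u hu)⟩
  · intro s t hs ht ε hε
    obtain ⟨Φ, hΦ⟩ := hs (ε / 2) (half_pos hε)
    obtain ⟨Ψ, hΨ⟩ := ht (ε / 2) (half_pos hε)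
    refine ⟨Φ ∪ Ψ, fun u hu => ?_⟩
    rw [union_inter_distrib_right]
    refine (lintegral_union_le _ _ _).trans ?_
    have h1 := hΦ u fun f hf => hu f (Finset.mem_union_left _ hf)
    have h2 := hΨ u fun f hf => hu f (Finset.mem_union_right _ hf)
    refine (add_le_add h1 h2).trans (le_of_eq ?_)
    rw [← ENNReal.ofReal_add (by positivity) (by positivity)]
    congr 1
    ring
  · intro x hx
    obtain ⟨r, hr, e, κ, hκ, s₀, hs₀, hcone⟩ := exists_cone hΩ.isOpen hΩ.lipschitz hx
    exact ⟨Metric.ball x r, mem_nhdsWithin_of_mem_nhds (Metric.ball_mem_nhds x hr), fun ε hε =>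
      exists_finset_lintegral_le_of_cone hd hΩ.isOpen hΩ.isBounded
        (Metric.isOpen_ball.inter hΩ.isOpen) inter_subset_right hκ hs₀ hcone hε⟩

/-- **Rellich's theorem**: `H¹(Ω)` embeds compactly into `L²(Ω)`. -/
theorem isCompactOperator_sobFnL (hd : 1 ≤ d) (hΩ : IsBoundedLipschitzDomain Ω) :
    IsCompactOperator (sobFnL Ω) := by
  refine isCompactOperator_of_forall_finset (sobFnL Ω) fun ε hε => ?_
  obtain ⟨Φ, hΦ⟩ := exists_finset_lintegral_le hd hΩ (ε ^ 2) (pow_pos hε 2)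
  refine ⟨Φ, fun u hu => ?_⟩
  have h1 := hΦ u hu
  rw [inter_eq_self_of_subset_right subset_closure, lintegral_enorm_sq_eq, ← mul_pow,
    ENNReal.ofReal_pow (by positivity), ENNReal.pow_le_pow_left_iff two_ne_zero] at h1
  rw [sobFnL_apply, Lp.norm_def]
  exact ENNReal.toReal_le_of_le_ofReal (by positivity) h1

end Rellich

end

noncomputable section

variable {d : ℕ}

/-! ### Infinite dimension of the Sobolev spaces -/

section InfiniteDimensional

variable {Ω : Set (E d)}

/-- The weak gradient of the zero function is zero by the fundamental lemma. Hence the mass form is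
positive on `H¹(Ω)`, although its elements are pairs. -/
lemma sobFnL_injective (hΩ : IsOpen Ω) : Function.Injective (sobFnL Ω) := by
  rw [injective_iff_map_eq_zero]
  intro u hu
  have h0 : sobFn u =ᵐ[volume.restrict Ω] 0 := by
    rw [← sobFnL_apply, hu]
    exact Lp.coeFn_zero _ _ _
  have hint : LocallyIntegrableOn (sobGrad u) Ω volume :=
    locallyIntegrableOn_of_locallyIntegrable_restrict
      ((Lp.memLp (sobGrad u)).locallyIntegrable (by norm_num))
  have hg : sobGrad u = 0 := by
    rw [Lp.eq_zero_iff_ae_eq_zero]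
    refine (ae_restrict_iff' hΩ.measurableSet).2
      (hΩ.ae_eq_zero_of_integral_contDiff_smul_eq_zero hint fun ζ h1 h2 h3 => ?_)
    have hζ : IsTestFunction Ω ζ := ⟨h1, h2, h3⟩
    rw [← setIntegral_eq_integral_of_forall_compl_eq_zero (s := Ω)
      fun x hx => by rw [hζ.eq_zero hx, zero_smul]]
    have hi : Integrable (fun x => ζ x • sobGrad u x) (volume.restrict Ω) :=
      memLp_one_iff_integrable.1 ((Lp.memLp (sobGrad u)).smul hζ.memLp)
    refine ext_inner_left ℝ fun v => ?_
    rw [← integral_inner hi, inner_zero_right]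
    have h := u.2 ζ hζ v
    have hl : ∫ x in Ω, u.1.fst x * fderiv ℝ ζ x v = 0 := by
      rw [integral_eq_zero_of_ae]
      filter_upwards [h0] with x hx
      have hx' : u.1.fst x = 0 := hx
      simp [hx']
    rw [hl, eq_comm, neg_eq_zero] at h
    rw [← h]
    refine integral_congr_ae (ae_of_all _ fun x => ?_)
    simp only [real_inner_smul_right]
    rw [real_inner_comm, mul_comm]
    rfl
  have hn : ‖u‖ ^ 2 = 0 := by
    rw [norm_sq_H1, hg, ← sobFnL_apply, hu]
    simp
  exact norm_eq_zero.1 (pow_eq_zero_iff two_ne_zero |>.1 hn)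

lemma IsTestFunction.memLp_gradient {ζ : E d → ℝ} (h : IsTestFunction Ω ζ) :
    MemLp (gradient ζ) 2 (volume.restrict Ω) := by
  refine Continuous.memLp_of_hasCompactSupport ?_ ?_
  · exact (InnerProductSpace.toDual ℝ (E d)).symm.continuous.comp
      (h.smooth.continuous_fderiv (by simp))
  · exact (h.compact.fderiv ℝ).comp_left (map_zero _)

lemma IsTestFunction.exists_H10 {ζ : E d → ℝ} (h : IsTestFunction Ω ζ) :
    ∃ u : H10 Ω, sobFn (u : H1 Ω) =ᵐ[volume.restrict Ω] ζ := by
  obtain ⟨u, hu, -⟩ := exists_H1_of_contDiff h.smooth h.memLp h.memLp_gradient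
  exact ⟨⟨u, Submodule.le_topologicalClosure _ ⟨ζ, h, hu⟩⟩, hu⟩

/-- For `d ≥ 1` the nonempty open set `Ω` is infinite, and an infinite Hausdorff space contains
infinitely many disjoint nonempty open sets; each one carries a bump function. -/
lemma exists_disjoint_testFunctions (hd : 1 ≤ d) (hΩ : IsOpen Ω) (hne : Ω.Nonempty) :
    ∃ ζ : ℕ → E d → ℝ, (∀ n, IsTestFunction Ω (ζ n)) ∧ (∀ n, ζ n ≠ 0) ∧
      ∀ m n, m ≠ n → ∀ x, ζ m x * ζ n x = 0 := by
  obtain ⟨x₀, hx₀⟩ := hne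
  have : Nonempty (Fin d) := ⟨⟨0, hd⟩⟩
  have : NeBot (𝓝[≠] x₀) := Module.punctured_nhds_neBot ℝ (E d) x₀
  have : Infinite Ω := (infinite_of_mem_nhds x₀ (hΩ.mem_nhds hx₀)).to_subtype
  obtain ⟨U, hU, hUo, hUd⟩ := exists_seq_infinite_isOpen_pairwise_disjoint Ω
  have hex : ∀ n, ∃ f : E d → ℝ, tsupport f ⊆ Subtype.val '' U n ∧ HasCompactSupport f ∧
      ContDiff ℝ ∞ f ∧ f ≠ 0 := by
    intro n
    obtain ⟨y, hy⟩ := (hU n).nonempty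
    have hn : Subtype.val '' U n ∈ 𝓝 (y : E d) :=
      (hΩ.isOpenMap_subtype_val _ (hUo n)).mem_nhds (mem_image_of_mem _ hy)
    obtain ⟨f, h1, h2, h3, -, h5⟩ := exists_contDiff_tsupport_subset (n := ⊤) hn
    refine ⟨f, h1, h2, h3, fun h => ?_⟩
    simp [h] at h5
  choose ζ h1 h2 h3 h4 using hex
  refine ⟨ζ, fun n => ⟨h3 n, h2 n, (h1 n).trans (Subtype.coe_image_subset _ _)⟩, h4,
    fun m n hmn x => ?_⟩
  by_contra hx
  obtain ⟨hm, hn⟩ := mul_ne_zero_iff.1 hx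
  have hx1 := h1 m (subset_tsupport _ hm)
  have hx2 := h1 n (subset_tsupport _ hn)
  have hdis := (disjoint_image_iff Subtype.val_injective).2 (hUd hmn)
  exact disjoint_left.1 hdis hx1 hx2

lemma not_finiteDimensional_of_orthogonal {V H : Type*} [AddCommGroup V] [Module ℝ V]
    [NormedAddCommGroup H] [InnerProductSpace ℝ H] (L : V →ₗ[ℝ] H) (u : ℕ → V)
    (h0 : ∀ n, L (u n) ≠ 0) (h : ∀ m n, m ≠ n → inner ℝ (L (u m)) (L (u n)) = 0) :
    ¬ FiniteDimensional ℝ V := fun _ =>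
  Module.Finite.not_linearIndependent_of_infinite u
    (LinearIndependent.of_comp L (linearIndependent_of_ne_zero_of_inner_eq_zero h0 fun m n => h m n))

lemma not_finiteDimensional_H10 (hd : 1 ≤ d) (hΩ : IsOpen Ω) (hne : Ω.Nonempty) :
    ¬ FiniteDimensional ℝ (H10 Ω) := by
  obtain ⟨ζ, hζ, hζ0, hζd⟩ := exists_disjoint_testFunctions hd hΩ hne
  choose u hu using fun n => (hζ n).exists_H10
  refine not_finiteDimensional_of_orthogonal
    ((sobFnL Ω).comp (H10 Ω).subtypeL).toLinearMap u
    (fun n h => hζ0 n ?_) fun m n hmn => ?_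
  · have h0 : ζ n =ᵐ[volume.restrict Ω] 0 := by
      refine (hu n).symm.trans ?_
      change sobFn (u n : H1 Ω) = 0 at h
      rw [h]
      exact Lp.coeFn_zero _ _ _
    have h1 := Measure.eqOn_open_of_ae_eq h0 hΩ (hζ n).smooth.continuous.continuousOn
      continuousOn_const
    funext x
    by_cases hx : x ∈ Ω
    · exact h1 hx
    · exact (hζ n).eq_zero hx
  · change inner ℝ (sobFn (u m : H1 Ω)) (sobFn (u n : H1 Ω)) = 0
    rw [L2.inner_def]
    refine integral_eq_zero_of_ae ?_
    filter_upwards [hu m, hu n] with x hx hx'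
    rw [hx, hx']
    exact hζd n m hmn.symm x

lemma not_finiteDimensional_H1 (hd : 1 ≤ d) (hΩ : IsOpen Ω) (hne : Ω.Nonempty) :
    ¬ FiniteDimensional ℝ (H1 Ω) := fun _ =>
  not_finiteDimensional_H10 hd hΩ hne inferInstance

end InfiniteDimensional

/-! ### The weighted Sobolev forms and their dependence on the phase field -/

section SobolevForms

variable {Ω : Set (E d)}

variable (Ω) in
/-- The form `(u, v)_ρ` as a linear function of `ρ`. -/
def massFormL : Linf Ω →L[ℝ] H1 Ω →L[ℝ] H1 Ω →L[ℝ] ℝ :=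
  (pullForm (sobFnL Ω)).comp (weightedForm (volume.restrict Ω) ℝ)

variable (Ω) in
/-- The form `(∇u, ∇v)_ρ` as a linear function of `ρ`. -/
def gradFormL : Linf Ω →L[ℝ] H1 Ω →L[ℝ] H1 Ω →L[ℝ] ℝ :=
  (pullForm (sobGradL Ω)).comp (weightedForm (volume.restrict Ω) (E d))

lemma massFormL_eq {ρ : Linf Ω} {r : E d → ℝ} (h : ρ =ᵐ[volume.restrict Ω] r) (u v : H1 Ω) :
    massFormL Ω ρ u v = massForm r u v := by
  refine (weightedForm_apply ρ (sobFn u) (sobFn v)).trans (integral_congr_ae ?_)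
  filter_upwards [h] with x hx
  rw [hx, mul_comm (sobFn u x)]
  rfl

lemma gradFormL_eq {ρ : Linf Ω} {r : E d → ℝ} (h : ρ =ᵐ[volume.restrict Ω] r) (u v : H1 Ω) :
    gradFormL Ω ρ u v = gradForm r u v := by
  refine (weightedForm_apply ρ (sobGrad u) (sobGrad v)).trans (integral_congr_ae ?_)
  filter_upwards [h] with x hx
  rw [hx]

lemma massForm_comm (ρ : E d → ℝ) (u v : H1 Ω) : massForm ρ u v = massForm ρ v u := by
  simp only [massForm, mul_comm (sobFn u _)]

lemma gradForm_comm (ρ : E d → ℝ) (u v : H1 Ω) : gradForm ρ u v = gradForm ρ v u := by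
  simp only [gradForm, real_inner_comm]

lemma mul_norm_sq_le_massForm {k : ℝ → ℝ} (hk : Continuous k) (φ : Linf Ω) {c : ℝ}
    (hc : ∀ s, c ≤ k s) (u : H1 Ω) : c * ‖sobFn u‖ ^ 2 ≤ massForm (fun x => k (φ x)) u u := by
  rw [← real_inner_self_eq_norm_sq, L2.inner_def, ← integral_const_mul]
  refine integral_mono ((L2.integrable_inner _ _).const_mul c) (massForm_integrable hk φ u u)
    fun x => ?_
  change c * (sobFn u x * sobFn u x) ≤ _
  exact mul_le_mul_of_nonneg_right (hc _) (mul_self_nonneg _)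

lemma mul_norm_sq_le_gradForm {k : ℝ → ℝ} (hk : Continuous k) (φ : Linf Ω) {c : ℝ}
    (hc : ∀ s, c ≤ k s) (u : H1 Ω) : c * ‖sobGrad u‖ ^ 2 ≤ gradForm (fun x => k (φ x)) u u := by
  rw [← real_inner_self_eq_norm_sq, L2.inner_def, ← integral_const_mul]
  refine integral_mono ((L2.integrable_inner _ _).const_mul c) (gradForm_integrable hk φ u u)
    fun x => ?_
  exact mul_le_mul_of_nonneg_right (hc _) real_inner_self_nonneg

section Derivative

variable {W : Type*} [NormedAddCommGroup W] [NormedSpace ℝ W] (L L' : Linf Ω →L[ℝ] W)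
  {k k' : ℝ → ℝ} (hk : ContDiff ℝ 1 k) (hk' : ContDiff ℝ 1 k')

lemma contDiff_superposition :
    ContDiff ℝ 1 (superposition hk.continuous : Linf Ω → Linf Ω) :=
  contDiff_one_iff_hasFDerivAt.2 ⟨_,
    (mulTop _).continuous.comp (continuous_superposition (hk.continuous_deriv le_rfl)),
    hasFDerivAt_superposition hk⟩

lemma contDiff_comp_superposition : ContDiff ℝ 1 fun φ => L (superposition hk.continuous φ) :=
  L.contDiff.comp (contDiff_superposition hk)

lemma hasFDerivAt_comp_superposition (φ : Linf Ω) :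
    HasFDerivAt (fun φ => L (superposition hk.continuous φ))
      (L.comp (mulTop _ (superposition (hk.continuous_deriv le_rfl) φ))) φ :=
  L.hasFDerivAt.comp φ (hasFDerivAt_superposition hk φ)

lemma fderiv_comp_superposition (φ h : Linf Ω) :
    fderiv ℝ (fun φ => L (superposition hk.continuous φ)) φ h
      = L (mulTop _ (superposition (hk.continuous_deriv le_rfl) φ) h) := by
  rw [(hasFDerivAt_comp_superposition L hk φ).fderiv]
  rfl

/-- The sum of two linear functions of superposition operators. -/
def superpositionSum (φ : Linf Ω) : W :=
  L (superposition hk.continuous φ) + L' (superposition hk'.continuous φ)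

lemma contDiff_superpositionSum : ContDiff ℝ 1 (superpositionSum L L' hk hk') :=
  (contDiff_comp_superposition L hk).add (contDiff_comp_superposition L' hk')

lemma fderiv_superpositionSum (φ h : Linf Ω) :
    fderiv ℝ (superpositionSum L L' hk hk') φ h
      = L (mulTop _ (superposition (hk.continuous_deriv le_rfl) φ) h)
        + L' (mulTop _ (superposition (hk'.continuous_deriv le_rfl) φ) h) := by
  have : HasFDerivAt (superpositionSum L L' hk hk') _ φ :=
    (hasFDerivAt_comp_superposition L hk φ).fun_add (hasFDerivAt_comp_superposition L' hk' φ)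
  rw [this.fderiv]
  rfl

end Derivative

lemma mulTop_superposition_ae_eq {k : ℝ → ℝ} (hk : Continuous k) (φ h : Linf Ω) :
    mulTop _ (superposition hk φ) h =ᵐ[volume.restrict Ω] fun x => k (φ x) * h x := by
  filter_upwards [coeFn_mulTop (superposition hk φ) h, coeFn_superposition hk φ] with x h1 h2
  rw [h1, h2]

end SobolevForms

end

noncomputable section

variable {d : ℕ}

/-! ### Dirichlet and Neumann problems in a common setting -/

section Eigenspaces

variable {V : Type*} [NormedAddCommGroup V] [InnerProductSpace ℝ V] {A C : V →L[ℝ] V →L[ℝ] ℝ}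
  {F : ℝ → Submodule ℝ V}

lemma eq_formEigenspace (h : ∀ l w, w ∈ F l ↔ ∀ η, A w η = l * C w η) :
    F = formEigenspace A C := by
  funext l
  ext w
  rw [h, mem_formEigenspace]

end Eigenspaces

section Pullback

variable {Ω : Set (E d)} {V : Type*} [NormedAddCommGroup V] [InnerProductSpace ℝ V]
  (J : V →ₗᵢ[ℝ] H1 Ω)

/-- The pull-back of `(∇u, ∇v)_ρ`. -/
def gradFormAlong : Linf Ω →L[ℝ] V →L[ℝ] V →L[ℝ] ℝ :=
  (pullForm J.toContinuousLinearMap).comp (gradFormL Ω)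

/-- The pull-back of `(u, v)_ρ`. -/
def massFormAlong : Linf Ω →L[ℝ] V →L[ℝ] V →L[ℝ] ℝ :=
  (pullForm J.toContinuousLinearMap).comp (massFormL Ω)

lemma gradFormAlong_eq {ρ : Linf Ω} {r : E d → ℝ} (h : ρ =ᵐ[volume.restrict Ω] r) (u v : V) :
    gradFormAlong J ρ u v = gradForm r (J u) (J v) := gradFormL_eq h (J u) (J v)

lemma massFormAlong_eq {ρ : Linf Ω} {r : E d → ℝ} (h : ρ =ᵐ[volume.restrict Ω] r) (u v : V) :
    massFormAlong J ρ u v = massForm r (J u) (J v) := massFormL_eq h (J u) (J v)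

lemma massFormAlong_eq_pullForm (ρ : Linf Ω) :
    massFormAlong J ρ = pullForm ((sobFnL Ω).comp J.toContinuousLinearMap)
      (weightedForm (volume.restrict Ω) ℝ ρ) := rfl

end Pullback

namespace Coefficients

variable (P : Coefficients) {Ω : Set (E d)} {V : Type*} [instV : NormedAddCommGroup V]
  [instInnerV : InnerProductSpace ℝ V] (J : V →ₗᵢ[ℝ] H1 Ω)

/-- The form `(∇u, ∇v)_{a(φ)} + (u, v)_{b(φ)}` on a space that embeds into `H¹(Ω)`. -/
def energyL : Linf Ω → V →L[ℝ] V →L[ℝ] ℝ :=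
  superpositionSum (W := V →L[ℝ] V →L[ℝ] ℝ) (gradFormAlong J) (massFormAlong J) P.a_reg.1
    P.b_reg.1

/-- The form `(u, v)_{c(φ)}` on a space that embeds into `H¹(Ω)`. -/
def weightL (φ : Linf Ω) : V →L[ℝ] V →L[ℝ] ℝ :=
  massFormAlong J (superposition P.c_reg.1.continuous φ)

lemma energyL_apply (φ : Linf Ω) (u v : V) :
    P.energyL J φ u v
      = gradForm (fun x => P.a (φ x)) (J u) (J v) + massForm (fun x => P.b (φ x)) (J u) (J v) := by
  rw [← gradFormAlong_eq J (coeFn_superposition P.a_cont φ),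
    ← massFormAlong_eq J (coeFn_superposition P.b_cont φ)]
  rfl

lemma weightL_apply (φ : Linf Ω) (u v : V) : P.weightL J φ u v = P.cForm φ (J u) (J v) :=
  massFormAlong_eq J (coeFn_superposition P.c_cont φ) u v

lemma contDiff_energyL : ContDiff ℝ 1 (P.energyL J) :=
  contDiff_superpositionSum (W := V →L[ℝ] V →L[ℝ] ℝ) _ _ P.a_reg.1 P.b_reg.1

lemma contDiff_weightL : ContDiff ℝ 1 (P.weightL J) :=
  contDiff_comp_superposition (W := V →L[ℝ] V →L[ℝ] ℝ) (massFormAlong J) P.c_reg.1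

lemma fderiv_energyL (φ h : Linf Ω) (u v : V) :
    fderiv ℝ (P.energyL J) φ h u v
      = gradForm (fun x => deriv P.a (φ x) * h x) (J u) (J v)
        + massForm (fun x => deriv P.b (φ x) * h x) (J u) (J v) := by
  have h1 := fderiv_superpositionSum (W := V →L[ℝ] V →L[ℝ] ℝ) (gradFormAlong J) (massFormAlong J)
    P.a_reg.1 P.b_reg.1 φ h
  rw [energyL, h1, ← gradFormAlong_eq J (mulTop_superposition_ae_eq _ φ h),
    ← massFormAlong_eq J (mulTop_superposition_ae_eq _ φ h)]
  rfl

lemma fderiv_weightL (φ h : Linf Ω) (u v : V) :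
    fderiv ℝ (P.weightL J) φ h u v = massForm (fun x => deriv P.c (φ x) * h x) (J u) (J v) := by
  have h1 : fderiv ℝ (P.weightL J) φ h = _ :=
    fderiv_comp_superposition (W := V →L[ℝ] V →L[ℝ] ℝ) (massFormAlong J) P.c_reg.1 φ h
  rw [h1, massFormAlong_eq J (mulTop_superposition_ae_eq _ φ h)]

/-- The lower bounds of `a` and `c` give `A + C ≥ c (‖∇u‖² + ‖u‖²)`, the square of the `H¹` norm
times the common bound. Compactness of the mass form is Rellich's theorem. -/
lemma isSpectralPair (hd : 1 ≤ d) (hΩ : IsBoundedLipschitzDomain Ω) (φ : Linf Ω) :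
    IsSpectralPair (P.energyL J φ) (P.weightL J φ) := by
  obtain ⟨c, hc, hac⟩ := P.lower_bound
  have hA : ∀ u, c * ‖sobGrad (J u)‖ ^ 2 ≤ P.energyL J φ u u := by
    intro u
    rw [energyL_apply]
    have h1 := mul_norm_sq_le_gradForm P.a_cont φ (fun s => (hac s).1.le) (J u)
    have h2 := mul_norm_sq_le_massForm P.b_cont φ P.b_nonneg (J u)
    linarith
  have hC : ∀ u, c * ‖sobFn (J u)‖ ^ 2 ≤ P.weightL J φ u u := by
    intro u
    rw [weightL_apply]
    exact mul_norm_sq_le_massForm P.c_cont φ (fun s => (hac s).2.le) (J u)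
  refine ⟨fun u v => ?_, fun u v => ?_, fun u => ?_, fun u hu => ?_, ⟨c, hc, fun u => ?_⟩, ?_⟩
  · rw [energyL_apply, energyL_apply, gradForm_comm, massForm_comm]
  · rw [weightL_apply, weightL_apply]
    exact massForm_comm _ _ _
  · exact (by positivity : 0 ≤ c * ‖sobGrad (J u)‖ ^ 2).trans (hA u)
  · refine lt_of_lt_of_le (mul_pos hc (pow_pos (norm_pos_iff.2 fun h => hu ?_) 2)) (hC u)
    refine J.injective (sobFnL_injective hΩ.isOpen ?_)
    rw [map_zero, map_zero]
    exact h
  · have h1 : ‖u‖ ^ 2 = ‖sobFn (J u)‖ ^ 2 + ‖sobGrad (J u)‖ ^ 2 := by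
      rw [← J.norm_map, norm_sq_H1]
    rw [mul_assoc, ← sq, h1, add_apply, add_apply, mul_add]
    linarith [hA u, hC u]
  · rw [weightL, massFormAlong_eq_pullForm]
    exact isCompactOperator_pullForm
      ((isCompactOperator_sobFnL hd hΩ).comp_clm J.toContinuousLinearMap) _

/-- Both boundary conditions are covered: `J` is the inclusion of `H¹₀(Ω)` or the identity of
`H¹(Ω)`, and `F` and `lam` stand for the respective eigenspaces and eigenvalues. -/
theorem exists_contDiff_eigenpair [CompleteSpace V] (hd : 1 ≤ d) (hΩ : IsBoundedLipschitzDomain Ω)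
    (hV : ¬ FiniteDimensional ℝ V) {F : Linf Ω → ℝ → Submodule ℝ V}
    (hF : ∀ φ l w, w ∈ F φ l ↔ ∀ η, gradForm (fun x => P.a (φ x)) (J w) (J η)
      + massForm (fun x => P.b (φ x)) (J w) (J η) = l * P.cForm φ (J w) (J η))
    {i : ℕ} (hi : 1 ≤ i) {lam : Linf Ω → ℝ}
    (hlam : ∀ φ, lam φ
      = sInf {t : ℝ | (i : Cardinal) ≤ Module.rank ℝ ↥(⨆ s ∈ Iic t, F φ s)})
    {φ : Linf Ω} (hs : Module.finrank ℝ (F φ (lam φ)) = 1) {w₀ : V}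
    (hw : w₀ ∈ F φ (lam φ) ∧ P.cForm φ (J w₀) (J w₀) = 1) {σ : ℝ} (hσ : 0 < σ) (hσ1 : σ < 1) :
    ∃ δ > 0, ∃ r > 0, ∃ (S : Linf Ω → V × ℝ) (S' : Linf Ω → (Linf Ω →L[ℝ] V × ℝ)),
      (∀ ϑ ∈ Metric.ball φ δ,
        (∀ w : V, ((w ∈ F ϑ (lam ϑ) ∧ P.cForm ϑ (J w) (J w) = 1) ∧ σ < P.cForm φ (J w) (J w₀))
          ↔ w = (S ϑ).1) ∧
        (S ϑ).2 = lam ϑ ∧ S ϑ ∈ Metric.ball (w₀, lam φ) r ∧ (2 ≤ i → 0 < lam ϑ)) ∧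
      (∀ ϑ ∈ Metric.ball φ δ, HasFDerivAt S (S' ϑ) ϑ) ∧
      ContinuousOn S' (Metric.ball φ δ) ∧
      (∀ ϑ ∈ Metric.ball φ δ, ∀ h : Linf Ω, (S' ϑ h).2
        = gradForm (fun x => deriv P.a (ϑ x) * h x) (J (S ϑ).1) (J (S ϑ).1)
          + massForm (fun x => deriv P.b (ϑ x) * h x) (J (S ϑ).1) (J (S ϑ).1)
          - lam ϑ * massForm (fun x => deriv P.c (ϑ x) * h x) (J (S ϑ).1) (J (S ϑ).1)) := by
  obtain rfl : F = fun ϑ => formEigenspace (P.energyL J ϑ) (P.weightL J ϑ) := funext fun ϑ =>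
    eq_formEigenspace fun l w => by simp only [hF, energyL_apply, weightL_apply]
  obtain rfl : lam = fun ϑ => formEigenvalue (P.energyL J ϑ) (P.weightL J ϑ) i := funext hlam
  simp only [← weightL_apply] at hw ⊢
  obtain ⟨δ, hδ, r, hr, S, S', h1, h2, h3, h4⟩ := _root_.exists_contDiff_eigenpair
    (P.contDiff_energyL J) (P.contDiff_weightL J) (P.isSpectralPair J hd hΩ) hV hi hs
    hw.1 hw.2 hσ hσ1
  refine ⟨δ, hδ, r, hr, S, S', h1, h2, h3, fun ϑ hϑ h => ?_⟩
  rw [h4 ϑ hϑ h, fderiv_energyL, fderiv_weightL]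

/-- The coefficients with `b` replaced by `0`. -/
def neumannPart : Coefficients where
  __ := P
  b := 0
  b_reg := ⟨contDiff_const, by
    rw [deriv_zero]
    exact LocallyLipschitz.const 0⟩
  b_nonneg := fun _ => le_rfl

lemma massForm_zero_weight (u v : H1 Ω) : massForm (fun _ => 0) u v = 0 := by
  simp [massForm]

/-- As `Ω` is bounded, the constant `1` is in `H¹(Ω)`. Its gradient vanishes, so testing with it
leaves `l ∫ c(φ) w = 0`. -/
lemma mem_meanZero_of_mem_neumannEigenspace (hΩ : IsBoundedLipschitzDomain Ω) {φ : Linf Ω} {l : ℝ}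
    (hl : l ≠ 0) {w : H1 Ω} (hw : w ∈ P.neumannEigenspace φ l) : w ∈ P.meanZero φ := by
  have : IsFiniteMeasure (volume.restrict Ω) :=
    isFiniteMeasure_restrict.2 hΩ.isBounded.measure_lt_top.ne
  have hgrad : gradient (fun _ : E d => (1 : ℝ)) = 0 := by
    funext x
    exact gradient_fun_const x 1
  obtain ⟨η, h1, h2⟩ := exists_H1_of_contDiff (Ω := Ω) (f := fun _ => (1 : ℝ)) contDiff_const
    (memLp_const 1) (by rw [hgrad]; exact MemLp.zero)
  rw [hgrad] at h2
  have h := hw η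
  have hg : gradForm (fun x => P.a (φ x)) w η = 0 := by
    refine integral_eq_zero_of_ae ?_
    filter_upwards [h2] with x hx
    simp [hx]
  rw [hg, eq_comm, mul_eq_zero, or_iff_right hl] at h
  refine Eq.trans (integral_congr_ae ?_) h
  filter_upwards [h1] with x hx
  rw [hx, mul_one]

end Coefficients

end

noncomputable section

variable {d : ℕ}

/-! ### The two boundary conditions -/

namespace Coefficients

variable (P : Coefficients) {Ω : Set (E d)}

set_option maxHeartbeats 800000 in
theorem exists_contDiff_dirichlet_eigenpair (hd : 1 ≤ d) (hΩ : IsBoundedLipschitzDomain Ω)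
    {φ : Linf Ω} {i : ℕ} (hi : 1 ≤ i) (hs : P.DirichletSimple i φ) {w₀ : H10 Ω}
    (hw : P.IsNormalizedDirichlet i φ w₀) {σ : ℝ} (hσ : 0 < σ) (hσ1 : σ < 1) :
      ∃ δ > 0, ∃ r > 0, ∃ (S : Linf Ω → H10 Ω × ℝ) (S' : Linf Ω → (Linf Ω →L[ℝ] H10 Ω × ℝ)),
        (∀ ϑ ∈ Metric.ball φ δ,
          (∀ w : H10 Ω, (P.IsNormalizedDirichlet i ϑ w ∧ σ < P.cForm φ (w : H1 Ω) w₀)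
            ↔ w = (S ϑ).1) ∧
          (S ϑ).2 = P.dirichletEigenvalue i ϑ ∧
          S ϑ ∈ Metric.ball (w₀, P.dirichletEigenvalue i φ) r) ∧
        (∀ ϑ ∈ Metric.ball φ δ, HasFDerivAt S (S' ϑ) ϑ) ∧
        ContinuousOn S' (Metric.ball φ δ) ∧
        (∀ ϑ ∈ Metric.ball φ δ, ∀ h : Linf Ω,
          (S' ϑ h).2
            = gradForm (fun x => deriv P.a (ϑ x) * h x) ((S ϑ).1 : H1 Ω) (S ϑ).1
              + massForm (fun x => deriv P.b (ϑ x) * h x) ((S ϑ).1 : H1 Ω) (S ϑ).1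
              - P.dirichletEigenvalue i ϑ *
                massForm (fun x => deriv P.c (ϑ x) * h x) ((S ϑ).1 : H1 Ω) (S ϑ).1) := by
  obtain ⟨δ, hδ, r, hr, S, S', h1, h2, h3, h4⟩ := P.exists_contDiff_eigenpair (V := H10 Ω)
    (instV := (H10 Ω).normedAddCommGroup) (instInnerV := (H10 Ω).innerProductSpace)
    (H10 Ω).subtypeₗᵢ hd hΩ (not_finiteDimensional_H10 hd hΩ.isOpen hΩ.isConnected.nonempty)
    (F := P.dirichletEigenspace) (fun _ _ _ => Iff.rfl) hi (lam := P.dirichletEigenvalue i)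
    (fun _ => rfl) hs hw hσ hσ1
  exact ⟨δ, hδ, r, hr, S, S', fun ϑ hϑ => ⟨(h1 ϑ hϑ).1, (h1 ϑ hϑ).2.1, (h1 ϑ hϑ).2.2.1⟩,
    h2, h3, h4⟩

set_option maxHeartbeats 800000 in
theorem exists_contDiff_neumann_eigenpair (hd : 1 ≤ d) (hΩ : IsBoundedLipschitzDomain Ω)
    {φ : Linf Ω} {i : ℕ} (hi : 1 ≤ i) (hs : P.NeumannSimple i φ) {w₀ : H1 Ω}
    (hw : P.IsNormalizedNeumann i φ w₀) {σ : ℝ} (hσ : 0 < σ) (hσ1 : σ < 1) :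
      ∃ δ > 0, ∃ r > 0, ∃ (S : Linf Ω → H1 Ω × ℝ) (S' : Linf Ω → (Linf Ω →L[ℝ] H1 Ω × ℝ)),
        (∀ ϑ ∈ Metric.ball φ δ,
          (∀ w : H1 Ω, (P.IsNormalizedNeumann i ϑ w ∧ σ < P.cForm φ w w₀) ↔ w = (S ϑ).1) ∧
          (S ϑ).1 ∈ P.meanZero ϑ ∧
          (S ϑ).2 = P.neumannEigenvalue i ϑ ∧
          S ϑ ∈ Metric.ball (w₀, P.neumannEigenvalue i φ) r) ∧
        (∀ ϑ ∈ Metric.ball φ δ, HasFDerivAt S (S' ϑ) ϑ) ∧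
        ContinuousOn S' (Metric.ball φ δ) ∧
        (∀ ϑ ∈ Metric.ball φ δ, ∀ h : Linf Ω,
          (S' ϑ h).2
            = gradForm (fun x => deriv P.a (ϑ x) * h x) (S ϑ).1 (S ϑ).1
              - P.neumannEigenvalue i ϑ *
                massForm (fun x => deriv P.c (ϑ x) * h x) (S ϑ).1 (S ϑ).1) := by
  have hb : ∀ (k : ℝ → ℝ) (ϑ : Linf Ω) (u v : H1 Ω),
      gradForm (fun x => k (ϑ x)) u v + massForm (fun _ => 0) u v
        = gradForm (fun x => k (ϑ x)) u v :=
    fun k ϑ u v => by rw [massForm_zero_weight, add_zero]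
  -- The Neumann problem is the case `b = 0`. The general list counts from `1`, so `μ_i` is its
  -- entry with index `i + 1`.
  obtain ⟨δ, hδ, r, hr, S, S', h1, h2, h3, h4⟩ := P.neumannPart.exists_contDiff_eigenpair
    (V := H1 Ω) (instV := (H1 Ω).normedAddCommGroup) (instInnerV := (H1 Ω).innerProductSpace) .id hd hΩ
    (not_finiteDimensional_H1 hd hΩ.isOpen hΩ.isConnected.nonempty)
    (F := P.neumannEigenspace)
    (fun ϑ l w => forall_congr' fun η => by
      exact Eq.congr_left (hb P.a ϑ w η).symm)
    (Nat.le_add_left 1 i) (lam := P.neumannEigenvalue i) (fun _ => rfl) hs hw hσ hσ1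
  refine ⟨δ, hδ, r, hr, S, S', fun ϑ hϑ => ⟨(h1 ϑ hϑ).1, ?_, (h1 ϑ hϑ).2.1, (h1 ϑ hϑ).2.2.1⟩,
    h2, h3, fun ϑ hϑ h => ?_⟩
  -- Since `i + 1 ≥ 2`, the simple eigenvalue `μ_i^ϑ` is positive, which forces the weighted mean of
  -- its eigenfunction to vanish.
  · exact P.mem_meanZero_of_mem_neumannEigenspace hΩ
      (ne_of_gt ((h1 ϑ hϑ).2.2.2 (Nat.succ_le_succ hi))) (((h1 ϑ hϑ).1 _).2 rfl).1.1
  · have h0 : massForm (fun x => deriv P.neumannPart.b (ϑ x) * h x) (S ϑ).1 (S ϑ).1 = 0 := by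
      refine Eq.trans (congrArg (fun ρ => massForm ρ (S ϑ).1 (S ϑ).1) ?_) (massForm_zero_weight _ _)
      funext x
      change deriv (0 : ℝ → ℝ) (ϑ x) * h x = 0
      rw [deriv_zero]
      exact zero_mul _
    exact (h4 ϑ hϑ h).trans (congrArg (· - _) ((congrArg (_ + ·) h0).trans (add_zero _)))

end Coefficients

end

theorem mainTheorem10 {d : ℕ} (hd : 1 ≤ d) (Ω : Set (E d)) (hΩ : IsBoundedLipschitzDomain Ω)
    (P : Coefficients) (φ : Linf Ω) (i : ℕ) (hi : 1 ≤ i) :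
    -- the Dirichlet case
    (P.DirichletSimple i φ → ∀ w₀ : H10 Ω, P.IsNormalizedDirichlet i φ w₀ →
      ∀ σ : ℝ, 0 < σ → σ < 1 →
      ∃ δ > 0, ∃ r > 0, ∃ (S : Linf Ω → H10 Ω × ℝ) (S' : Linf Ω → (Linf Ω →L[ℝ] H10 Ω × ℝ)),
        -- `S` maps `ϑ` to the pair of the eigenfunction selected by the sign condition and `λ_i^ϑ`
        (∀ ϑ ∈ Metric.ball φ δ,
          (∀ w : H10 Ω, (P.IsNormalizedDirichlet i ϑ w ∧ σ < P.cForm φ (w : H1 Ω) w₀)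
            ↔ w = (S ϑ).1) ∧
          (S ϑ).2 = P.dirichletEigenvalue i ϑ ∧
          S ϑ ∈ Metric.ball (w₀, P.dirichletEigenvalue i φ) r) ∧
        -- `S` is continuously Fréchet differentiable
        (∀ ϑ ∈ Metric.ball φ δ, HasFDerivAt S (S' ϑ) ϑ) ∧
        ContinuousOn S' (Metric.ball φ δ) ∧
        -- the derivative of the eigenvalue
        (∀ ϑ ∈ Metric.ball φ δ, ∀ h : Linf Ω,
          (S' ϑ h).2
            = gradForm (fun x => deriv P.a (ϑ x) * h x) ((S ϑ).1 : H1 Ω) (S ϑ).1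
              + massForm (fun x => deriv P.b (ϑ x) * h x) ((S ϑ).1 : H1 Ω) (S ϑ).1
              - P.dirichletEigenvalue i ϑ *
                massForm (fun x => deriv P.c (ϑ x) * h x) ((S ϑ).1 : H1 Ω) (S ϑ).1)) ∧
    -- the Neumann case
    (P.NeumannSimple i φ → ∀ w₀ : H1 Ω, P.IsNormalizedNeumann i φ w₀ →
      ∀ σ : ℝ, 0 < σ → σ < 1 →
      ∃ δ > 0, ∃ r > 0, ∃ (S : Linf Ω → H1 Ω × ℝ) (S' : Linf Ω → (Linf Ω →L[ℝ] H1 Ω × ℝ)),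
        -- `S` maps `ϑ` to the pair of the eigenfunction selected by the sign condition and `μ_i^ϑ`
        (∀ ϑ ∈ Metric.ball φ δ,
          (∀ w : H1 Ω, (P.IsNormalizedNeumann i ϑ w ∧ σ < P.cForm φ w w₀) ↔ w = (S ϑ).1) ∧
          (S ϑ).1 ∈ P.meanZero ϑ ∧
          (S ϑ).2 = P.neumannEigenvalue i ϑ ∧
          S ϑ ∈ Metric.ball (w₀, P.neumannEigenvalue i φ) r) ∧
        -- `S` is continuously Fréchet differentiable
        (∀ ϑ ∈ Metric.ball φ δ, HasFDerivAt S (S' ϑ) ϑ) ∧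
        ContinuousOn S' (Metric.ball φ δ) ∧
        -- the derivative of the eigenvalue
        (∀ ϑ ∈ Metric.ball φ δ, ∀ h : Linf Ω,
          (S' ϑ h).2
            = gradForm (fun x => deriv P.a (ϑ x) * h x) (S ϑ).1 (S ϑ).1
              - P.neumannEigenvalue i ϑ *
                massForm (fun x => deriv P.c (ϑ x) * h x) (S ϑ).1 (S ϑ).1)) :=
  ⟨fun hs _ hw _ hσ hσ1 => P.exists_contDiff_dirichlet_eigenpair hd hΩ hi hs hw hσ hσ1,
    fun hs _ hw _ hσ hσ1 => P.exists_contDiff_neumann_eigenpair hd hΩ hi hs hw hσ hσ1⟩
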